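/- Let $k$ be an algebraically closed field, $X$ a projective scheme over $k$ (for instance a projective variety), $L_1,\dots,L_n$ effective Cartier divisors on $X$, and $p_1,\dots,p_n\ge 2$ integers. Write $\mathcal O=\mathcal O_X$ and let $\mathcal O(-L_i)\subseteq\mathcal O$ be the (invertible) ideal sheaf of $L_i$. Put $F_i=-\otimes_{\mathcal O}\mathcal O(-L_i)$, and let $\eta_i\colon F_i\to\mathrm{id}$ be the natural transformation induced by the inclusion $\mathcal O(-L_i)\subseteq\mathcal O$, i.e. $m\otimes s\mapsto sm$ on local sections. The functors $F_i$ commute with each other up to the canonical isomorphisms $(m\otimes s)\otimes t\mapsto(m\otimes t)\otimes s$. **The order.** Let $T_{p_i}(\mathcal O,\mathcal O(-L_i))$ be the sheaf of $\mathcal O$-algebras of $p_i\times p_i$ matrices with entries in $\mathcal O$ on and below the diagonal and entries in $\mathcal O(-L_i)$ above the diagonal. Let $A=\bigotimes_{i=1}^n T_{p_i}(\mathcal O,\mathcal O(-L_i))$, the tensor product of sheaves of $\mathcal O$-algebras, and let $\operatorname{mod}A$ be the category of sheaves of left $A$-modules that are coherent as $\mathcal O$-modules. **The grid category.** Let $\mathcal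 A$ be a category with endofunctors $F_1,\dots,F_n$ that commute with each other and natural transformations $\eta_i\colon F_i\to\mathrm{id}_{\mathcal A}$. Let $S=\{1,\dots,p_1\}\times\dots\times\{1,\dots,p_n\}\subset\mathbb Z^n$, with $\mathbf e_i$ the $i$-th basis vector. For objects and morphisms indexed by $S$, indices with non-positive entries are also allowed and are interpreted through $M_{\mathbf a}:=F_iM_{\mathbf a+p_i\mathbf e_i}$, and similarly for morphisms. The objects of $\mathcal A[\eta_1^{1/p_1},\dots,\eta_n^{1/p_n}]$ are families $\bigl((M_{\mathbf a})_{\mathbf a\in S},(f^i_{\mathbf a}\colon M_{\mathbf a-\mathbf e_i}\to M_{\mathbf a})_{1\le i\le n,\ \mathbf a\in S}\bigr)$ of objects and morphisms of $\mathcal A$ such that, for all $i,j$ and all $\mathbf a\in S$ (morphisms being composed from left to right), - $f^j_{\mathbf a-\mathbf e_i}\,f^i_{\mathbf a}=f^i_{\mathbf a-\mathbf e_j}\,f^j_{\mathbf a}$ as morphisms $M_{\mathbf a-\mathbf e_i-\mathbf e_j}\to M_{\mathbf a}$ (commutativity condition); - $f^i_{\mathbf a-(p_i-1)\mathbf e_i}\cdots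 f^i_{\mathbf a-\mathbf e_i}\,f^i_{\mathbf a}=\eta_i(M_{\mathbf a})\colon F_iM_{\mathbf a}\to M_{\mathbf a}$ (cycle condition). A morphism $(M_{\mathbf a},f^i_{\mathbf a})\to(N_{\mathbf a},g^i_{\mathbf a})$ is a family of morphisms $\varphi_{\mathbf a}\colon M_{\mathbf a}\to N_{\mathbf a}$, $\mathbf a\in S$, with $f^i_{\mathbf a}\varphi_{\mathbf a}=\varphi_{\mathbf a-\mathbf e_i}g^i_{\mathbf a}$ for all $i$ and $\mathbf a\in S$. **Proposition.** The functors $F_i$ map coherent sheaves to coherent sheaves, and, with $\mathcal A=\operatorname{coh}X$ and the above $F_i$ and $\eta_i$, there is a $k$-linear equivalence of categories $$\operatorname{mod}A\;\simeq\;\mathcal A[\eta_1^{1/p_1},\dots,\eta_n^{1/p_n}].$$ -/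

import Mathlib

open CategoryTheory AlgebraicGeometry Opposite TopologicalSpace MonoidalCategory
open scoped TensorProduct

universe u v w

/-! ## Tensoring with a presheaf of modules preserves local bijectivity

Helper facts, needed only to see that the functors `- ⊗ 𝒪(-L)` commute with each other. -/

namespace GLOrder

/-- The equational criterion: if `z` dies in `N' ⊗ M`, then this is witnessed by finitely many
relations. -/
lemma exists_relations {R M N N' : Type*} [CommRing R] [AddCommGroup M] [Module R M]
    [AddCommGroup N] [Module R N] [AddCommGroup N'] [Module R N'] (φ : N →ₗ[R] N')
    (z : N ⊗[R] M) (hz : φ.rTensor M z = 0) :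
    ∃ (l k : ℕ) (m : Fin l → M) (n : Fin l → N) (a : Fin l → Fin k → R) (y : Fin k → N'),
      z = ∑ i, n i ⊗ₜ m i ∧ (∀ i, φ (n i) = ∑ j, a i j • y j) ∧ ∀ j, ∑ i, a i j • m i = 0 := by
  obtain ⟨P, hP, t, ht⟩ := TensorProduct.exists_of_fg (TensorProduct.comm R N M z)
  have h0 : P.subtype.rTensor N' (φ.lTensor P t) = 0 := by
    have : P.subtype.rTensor N' (φ.lTensor P t) = φ.lTensor M (P.subtype.rTensor N t) := by
      simp only [← LinearMap.comp_apply, LinearMap.rTensor_comp_lTensor,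
        LinearMap.lTensor_comp_rTensor]
    rw [this, ht]
    have h2 : TensorProduct.comm R N' M (φ.rTensor M z) = φ.lTensor M (TensorProduct.comm R N M z) := by
      simp [← LinearMap.comm_comp_rTensor_comp_comm_eq]
    rw [← h2, hz, map_zero]
  obtain ⟨Q, hPQ, hQ, h1⟩ := TensorProduct.eq_zero_of_fg_of_subtype_eq_zero hP h0
  obtain ⟨l, q, hq⟩ := Submodule.fg_iff_exists_fin_generating_family.mp (Module.Finite.iff_fg.mpr hQ).1
  have hex : ∀ t : Q ⊗[R] N, ∃ n : Fin l → N, t = ∑ i, q i ⊗ₜ n i := by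
    intro t
    induction t with
    | zero => exact ⟨0, by simp⟩
    | add x y hx hy =>
      obtain ⟨n, rfl⟩ := hx
      obtain ⟨n', rfl⟩ := hy
      exact ⟨n + n', by simp [TensorProduct.tmul_add, Finset.sum_add_distrib]⟩
    | tmul x y =>
      have hx : x ∈ Submodule.span R (Set.range q) := hq ▸ Submodule.mem_top
      obtain ⟨c, rfl⟩ := (Submodule.mem_span_range_iff_exists_fun R).mp hx
      exact ⟨fun i => c i • y, by simp [TensorProduct.sum_tmul, TensorProduct.smul_tmul]⟩
  obtain ⟨n, hn⟩ := hex ((Submodule.inclusion hPQ).rTensor N t)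
  have h3 : ∑ i, q i ⊗ₜ[R] φ (n i) = 0 := by
    have : φ.lTensor Q ((Submodule.inclusion hPQ).rTensor N t) = 0 := by
      rw [← h1]
      simp only [← LinearMap.comp_apply, LinearMap.rTensor_comp_lTensor,
        LinearMap.lTensor_comp_rTensor]
    rw [hn] at this
    simpa using this
  obtain ⟨k, a, y, hy, ha⟩ := TensorProduct.vanishesTrivially_of_sum_tmul_eq_zero R hq h3
  refine ⟨l, k, fun i => q i, n, a, y, ?_, hy, fun j => by simpa using congrArg Q.subtype (ha j)⟩
  apply (TensorProduct.comm R N M).injective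
  rw [← ht, ← Submodule.subtype_comp_inclusion _ _ hPQ, LinearMap.rTensor_comp,
    LinearMap.comp_apply, hn]
  simp

section
variable {C : Type v} [Category.{w} C] (J : GrothendieckTopology C) {R : Cᵒᵖ ⥤ CommRingCat.{u}}
  {P P' : PresheafOfModules.{u} (R ⋙ forget₂ CommRingCat.{u} RingCat.{u})} (f : P ⟶ P')

lemma toPresheaf_map_app {U : Cᵒᵖ} (x : P.obj U) :
    (((PresheafOfModules.toPresheaf _).map f).app U) x = f.app U x := rfl

lemma exists_common_cover {U : C} {n : ℕ} (S : Fin n → Sieve U) (h : ∀ i, S i ∈ J U) :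
    ∃ T ∈ J U, ∀ i, T ≤ S i := by
  induction n with
  | zero => exact ⟨⊤, J.top_mem U, fun i => i.elim0⟩
  | succ n ih =>
    obtain ⟨T, hT, hTS⟩ := ih (fun i => S i.succ) (fun i => h _)
    refine ⟨S 0 ⊓ T, J.intersection_covering (h 0) hT, fun i => ?_⟩
    cases i using Fin.cases with
    | zero => exact inf_le_left
    | succ i => exact inf_le_right.trans (hTS i)

variable (P) in
/-- The restriction maps of a presheaf of modules, as additive maps. -/
noncomputable def res {U V : Cᵒᵖ} (g : U ⟶ V) : P.obj U →+ P.obj V := (P.presheaf.map g).hom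

lemma res_smul {U V : Cᵒᵖ} (g : U ⟶ V) (a : R.obj U) (x : P.obj U) :
    res P g (a • x) = (R.map g a : R.obj V) • res P g x := P.map_smul g a x

lemma res_comp {U V W : Cᵒᵖ} (g : U ⟶ V) (h : V ⟶ W) (x : P.obj U) :
    res P (g ≫ h) x = res P h (res P g x) := by
  change P.presheaf.map (g ≫ h) x = P.presheaf.map h (P.presheaf.map g x)
  rw [P.presheaf.map_comp]
  rfl

lemma app_res {U V : Cᵒᵖ} (g : U ⟶ V) (x : P.obj U) :
    f.app V (res P g x) = res P' g (f.app U x) :=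
  NatTrans.naturality_apply ((PresheafOfModules.toPresheaf _).map f) g x

variable (Q : PresheafOfModules.{u} (R ⋙ forget₂ CommRingCat.{u} RingCat.{u}))

lemma res_tmul {U V : Cᵒᵖ} (g : U ⟶ V) (x : P.obj U) (y : Q.obj U) :
    res (P ⊗ Q) g (x ⊗ₜ[R.obj U] y : P.obj U ⊗[R.obj U] Q.obj U) =
      (res P g x ⊗ₜ[R.obj V] res Q g y : P.obj V ⊗[R.obj V] Q.obj V) := rfl

lemma isLocallySurjective_whiskerRight
    (hf : Presheaf.IsLocallySurjective J ((PresheafOfModules.toPresheaf _).map f)) :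
    Presheaf.IsLocallySurjective J ((PresheafOfModules.toPresheaf _).map (f ▷ Q)) where
  imageSieve_mem {U} s := by
    change P'.obj (op U) ⊗[R.obj (op U)] Q.obj (op U) at s
    induction s with
    | zero =>
      exact J.superset_covering (fun V g _ => ⟨0, by
        rw [map_zero]; exact (map_zero (res (P' ⊗ Q) g.op)).symm⟩) (J.top_mem U)
    | add x y hx hy =>
      refine J.superset_covering ?_ (J.intersection_covering hx hy)
      rintro V g ⟨⟨a, ha⟩, b, hb⟩
      exact ⟨a + b, by rw [map_add, ha, hb]; exact (map_add (res (P' ⊗ Q) g.op) x y).symm⟩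
    | tmul x y =>
      refine J.superset_covering ?_ (hf.imageSieve_mem x)
      rintro V g ⟨a, ha⟩
      exact ⟨(a ⊗ₜ[R.obj (op V)] res Q g.op y : P.obj (op V) ⊗[R.obj (op V)] Q.obj (op V)),
        congrArg (fun t : P'.obj (op V) => t ⊗ₜ[R.obj (op V)] res Q g.op y) ha⟩

lemma isLocallyInjective_whiskerRight
    (hf : Presheaf.IsLocallyInjective J ((PresheafOfModules.toPresheaf _).map f))
    (hf' : Presheaf.IsLocallySurjective J ((PresheafOfModules.toPresheaf _).map f)) :
    Presheaf.IsLocallyInjective J ((PresheafOfModules.toPresheaf _).map (f ▷ Q)) where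
  equalizerSieve_mem {U} z z' h := by
    have key : ∀ z : P.obj U ⊗[R.obj U] Q.obj U, (f.app U).hom.rTensor (Q.obj U) z = 0 →
        Presheaf.equalizerSieve (F := (P ⊗ Q).presheaf) z 0 ∈ J U.unop := by
      intro z hz
      obtain ⟨l, k, m, n, a, y, rfl, hy, ha⟩ :=
        exists_relations (R := R.obj U) (M := Q.obj U) (N := P.obj U) (N' := P'.obj U)
          (f.app U).hom z hz
      obtain ⟨T, hT, hTS⟩ := exists_common_cover J _ (fun j => hf'.imageSieve_mem (y j))
      refine J.transitive hT _ fun V g hg => ?_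
      choose x hx using fun j => hTS j g hg
      let x' (j : Fin k) : P.obj (op V) := x j
      have hx' (j : Fin k) : f.app (op V) (x' j) = res P' g.op (y j) := hx j
      let b (i : Fin l) (j : Fin k) : R.obj (op V) := R.map g.op (a i j)
      have hn (i : Fin l) : f.app (op V) (res P g.op (n i)) =
          f.app (op V) (∑ j, b i j • x' j) := by
        rw [app_res]
        have h1 : f.app (op V) (∑ j, b i j • x' j) = ∑ j, b i j • f.app (op V) (x' j) := by
          have := map_sum (f.app (op V)).hom (fun j => b i j • x' j) Finset.univ
          refine this.trans (Finset.sum_congr rfl fun j _ => ?_)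
          exact (f.app (op V)).hom.map_smul _ _
        rw [h1]
        refine (congrArg (res P' g.op) (hy i)).trans ?_
        rw [map_sum]
        refine Finset.sum_congr rfl fun j _ => ?_
        rw [hx', res_smul]
      obtain ⟨T', hT', hTS'⟩ := exists_common_cover J _ (fun i => hf.equalizerSieve_mem
        (X := op V) (res P g.op (n i)) (∑ j, b i j • x' j) (hn i))
      refine J.superset_covering ?_ hT'
      intro W t ht
      have hz (i : Fin l) : res P t.op (res P g.op (n i)) = res P t.op (∑ j, b i j • x' j) :=
        hTS' i t ht
      change res (P ⊗ Q) (t ≫ g).op (∑ i, (n i ⊗ₜ[R.obj U] m i : P.obj U ⊗[R.obj U] Q.obj U)) =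
        res (P ⊗ Q) (t ≫ g).op 0
      rw [map_zero]
      let x'' (j : Fin k) : P.obj (op W) := res P t.op (x' j)
      let m'' (i : Fin l) : Q.obj (op W) := res Q (t ≫ g).op (m i)
      let c (i : Fin l) (j : Fin k) : R.obj (op W) := R.map (t ≫ g).op (a i j)
      have hn' (i : Fin l) : res P (t ≫ g).op (n i) = ∑ j, c i j • x'' j := by
        rw [op_comp, res_comp, hz, map_sum]
        refine Finset.sum_congr rfl fun j _ => ?_
        rw [res_smul]
        congr 1
        change R.map t.op (R.map g.op (a i j)) = R.map (t ≫ g).op (a i j)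
        rw [op_comp, R.map_comp]
        rfl
      have hm' (j : Fin k) : ∑ i, c i j • m'' i = 0 := by
        have := congrArg (res Q (t ≫ g).op) (ha j)
        rw [map_sum, map_zero] at this
        rw [← this]
        exact Finset.sum_congr rfl fun i _ => (res_smul _ _ _).symm
      have e : ∑ i, ((∑ j, c i j • x'' j) ⊗ₜ[R.obj (op W)] m'' i :
          P.obj (op W) ⊗[R.obj (op W)] Q.obj (op W)) = 0 := by
        have e' : ∑ i, ((∑ j, c i j • x'' j) ⊗ₜ[R.obj (op W)] m'' i :
            P.obj (op W) ⊗[R.obj (op W)] Q.obj (op W)) =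
            ∑ j, x'' j ⊗ₜ[R.obj (op W)] (∑ i, c i j • m'' i) := by
          simp only [TensorProduct.sum_tmul, TensorProduct.tmul_sum, TensorProduct.tmul_smul,
            TensorProduct.smul_tmul']
          rw [Finset.sum_comm]
        rw [e']
        simp only [hm', TensorProduct.tmul_zero, Finset.sum_const_zero]
      refine (map_sum (res (P ⊗ Q) (t ≫ g).op)
        (fun i => (n i ⊗ₜ[R.obj U] m i : P.obj U ⊗[R.obj U] Q.obj U)) Finset.univ).trans
        (Eq.trans (Finset.sum_congr rfl fun i _ => ?_) e)
      exact congrArg (fun u : P.obj (op W) => u ⊗ₜ[R.obj (op W)] m'' i) (hn' i)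
    refine J.superset_covering ?_ (key (z - z') (sub_eq_zero.mp ?_))
    · intro V g hg
      change res (P ⊗ Q) g.op (z - z') = res (P ⊗ Q) g.op 0 at hg
      rw [map_zero] at hg
      exact sub_eq_zero.mp ((map_sub (res (P ⊗ Q) g.op) z z').symm.trans hg)
    · rw [sub_zero]
      exact (map_sub ((f.app U).hom.rTensor (Q.obj U)) z z').trans (sub_eq_zero.mpr h)
end

/-! ## Projective schemes and effective Cartier divisors -/

noncomputable section

section Projective

attribute [local instance] MvPolynomial.gradedAlgebra

/-- The projective space `ℙ^r` over the field `k`. -/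
def projectiveSpace (k : Type u) [Field k] (r : ℕ) : Scheme.{u} :=
  Proj (MvPolynomial.homogeneousSubmodule (Fin (r + 1)) k)

/-- The structure morphism `ℙ^r ⟶ Spec k`. -/
def projectiveSpaceToSpec (k : Type u) [Field k] (r : ℕ) :
    projectiveSpace k r ⟶ Spec (.of k) :=
  Proj.toSpecZero (MvPolynomial.homogeneousSubmodule (Fin (r + 1)) k) ≫
    Spec.map (CommRingCat.ofHom
      (algebraMap k (MvPolynomial.homogeneousSubmodule (Fin (r + 1)) k 0)))

/-- A `k`-scheme is projective if it admits a closed immersion over `k` into some `ℙ^r`. -/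
def IsProjectiveOver {k : Type u} [Field k] {X : Scheme.{u}} (s : X ⟶ Spec (.of k)) : Prop :=
  ∃ (r : ℕ) (i : X ⟶ projectiveSpace k r),
    IsClosedImmersion i ∧ i ≫ projectiveSpaceToSpec k r = s

end Projective

variable {X : Scheme.{u}}

/-- A closed subscheme, given by its ideal sheaf, is an effective Cartier divisor if its ideal
sheaf is locally generated by a single nonzerodivisor. -/
def IsEffectiveCartier (L : X.IdealSheafData) : Prop :=
  ∀ x : X, ∃ U : X.affineOpens, x ∈ U.1 ∧
    ∃ f ∈ nonZeroDivisors Γ(X, U.1), L.ideal U = Ideal.span {f}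

/-- The sections over `U` of the ideal sheaf of `L`: the functions on `U` whose restriction to each
affine open `V ⊆ U` lies in the ideal of `L` on `V`. -/
def idealSections (L : X.IdealSheafData) (U : X.Opens) : Ideal Γ(X, U) where
  carrier := {s | ∀ (V : X.affineOpens) (h : V.1 ≤ U),
    X.presheaf.map (homOfLE h).op s ∈ L.ideal V}
  add_mem' ha hb V h := by rw [map_add]; exact add_mem (ha V h) (hb V h)
  zero_mem' V h := by rw [map_zero]; exact zero_mem _
  smul_mem' c x hx V h := by
    rw [smul_eq_mul, map_mul]; exact Ideal.mul_mem_left _ _ (hx V h)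

lemma idealSections_map (L : X.IdealSheafData) {U V : X.Opensᵒᵖ} (f : U ⟶ V) :
    idealSections L U.unop ≤ (idealSections L V.unop).comap (X.presheaf.map f).hom := by
  intro s hs W h
  have := hs W (h.trans f.unop.le)
  rw [← ConcreteCategory.comp_apply, ← X.presheaf.map_comp]
  exact this

/-! ## Twisting by `𝒪(-L)` -/

/-- Presheaves of `𝒪_X`-modules, with their (presheaf) tensor product. -/
abbrev PreMod (X : Scheme.{u}) :=
  _root_.PresheafOfModules.{u} (X.presheaf ⋙ forget₂ CommRingCat.{u} RingCat.{u})

/-- `𝒪(-L)`, the ideal sheaf of `L` as an `𝒪_X`-submodule of `𝒪_X`. -/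
def idealSubmodule (L : X.IdealSheafData) :
    PresheafOfModules.Submodule
      (PresheafOfModules.unit (X.presheaf ⋙ forget₂ CommRingCat.{u} RingCat.{u})) where
  obj U := idealSections L U.unop
  map f _ hs := idealSections_map L f hs

/-- `𝒪(-L)`, as a presheaf of `𝒪_X`-modules (it is in fact a sheaf). -/
def invO (L : X.IdealSheafData) : PreMod X := (idealSubmodule L).toPresheafOfModules

/-- The inclusion `𝒪(-L) ⟶ 𝒪_X`. -/
def invOIncl (L : X.IdealSheafData) : invO L ⟶ 𝟙_ (PreMod X) := (idealSubmodule L).ι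

/-- The underlying presheaf of an `𝒪_X`-module. -/
def toPre (X : Scheme.{u}) : X.Modules ⥤ PreMod X := Scheme.Modules.toPresheafOfModules X

/-- The sheafification of presheaves of `𝒪_X`-modules, with its usual domain. -/
def sheafify₀ (X : Scheme.{u}) : X.PresheafOfModules ⥤ X.Modules :=
  PresheafOfModules.sheafification (𝟙 X.ringCatSheaf.obj)

/-- Sheafification is left adjoint to the forgetful functor. -/
def sheafifyAdj₀ (X : Scheme.{u}) : sheafify₀ X ⊣ Scheme.Modules.toPresheafOfModules X :=
  PresheafOfModules.sheafificationAdjunction (𝟙 X.ringCatSheaf.obj)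

/-- The sheafification of presheaves of `𝒪_X`-modules. -/
def sheafify (X : Scheme.{u}) : PreMod X ⥤ X.Modules := sheafify₀ X

/-- Sheafification is left adjoint to the forgetful functor. -/
def sheafifyAdj (X : Scheme.{u}) : sheafify X ⊣ toPre X := sheafifyAdj₀ X

/-- The functor `F = - ⊗ 𝒪(-L)`: the sheafification of the presheaf tensor product. -/
def twist (L : X.IdealSheafData) : X.Modules ⥤ X.Modules :=
  toPre X ⋙ tensorRight (invO L) ⋙ sheafify X

/-- The natural transformation `η : - ⊗ 𝒪(-L) ⟶ id` induced by `𝒪(-L) ⊆ 𝒪_X`; on local sections it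
is `m ⊗ s ↦ s • m`. -/
def twistToId (L : X.IdealSheafData) : twist L ⟶ 𝟭 X.Modules where
  app M := ((sheafifyAdj X).homEquiv _ _).symm
    ((toPre X).obj M ◁ invOIncl L ≫ (ρ_ ((toPre X).obj M)).hom)
  naturality M N f := by
    dsimp [twist]
    rw [← Adjunction.homEquiv_naturality_left_symm, ← Adjunction.homEquiv_naturality_right_symm]
    congr 1
    rw [← whisker_exchange_assoc, rightUnitor_naturality, Category.assoc]

lemma isIso_sheafify_map_iff {P P' : PreMod X} (f : P ⟶ P') :
    IsIso ((sheafify X).map f) ↔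
      Presheaf.IsLocallyInjective (Opens.grothendieckTopology X)
        ((PresheafOfModules.toPresheaf _).map f) ∧
      Presheaf.IsLocallySurjective (Opens.grothendieckTopology X)
        ((PresheafOfModules.toPresheaf _).map f) := by
  rw [← GrothendieckTopology.W_iff_isLocallyBijective]
  have h := PresheafOfModules.inverseImage_W_toPresheaf_eq_inverseImage_isomorphisms
    (𝟙 X.ringCatSheaf.obj)
  exact (iff_of_eq (congrFun (congrFun (congrFun h P) P') f)).symm

instance isIso_map_whiskerRight {P P' : PreMod X} (f : P ⟶ P') [hf : IsIso ((sheafify X).map f)]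
    (Q : PreMod X) : IsIso ((sheafify X).map (f ▷ Q)) :=
  (isIso_sheafify_map_iff _).mpr
    ⟨isLocallyInjective_whiskerRight _ f Q ((isIso_sheafify_map_iff f).mp hf).1
      ((isIso_sheafify_map_iff f).mp hf).2,
    isLocallySurjective_whiskerRight _ f Q ((isIso_sheafify_map_iff f).mp hf).2⟩

instance isIso_map_unit (P : PreMod X) : IsIso ((sheafify X).map ((sheafifyAdj X).unit.app P)) := by
  have : IsIso (sheafifyAdj X).counit := inferInstanceAs
    (IsIso (PresheafOfModules.sheafificationAdjunction (𝟙 X.ringCatSheaf.obj)).counit)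
  exact IsIso.of_isIso_fac_right ((sheafifyAdj X).left_triangle_components P)

/-- `(M ⊗ 𝒪(-L)) ⊗ 𝒪(-L')` is the sheafification of the twofold presheaf tensor product. -/
def twistTwist (L L' : X.IdealSheafData) :
    toPre X ⋙ (tensorRight (invO L) ⋙ tensorRight (invO L')) ⋙ sheafify X ≅ twist L ⋙ twist L' :=
  NatIso.ofComponents
    (fun M =>
      @asIso _ _ _ _
        ((sheafify X).map ((sheafifyAdj X).unit.app ((toPre X).obj M ⊗ invO L) ▷ invO L'))
        (isIso_map_whiskerRight _ _))
    (fun {M N} f => by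
      have h := (sheafifyAdj X).unit.naturality ((toPre X).map f ▷ invO L)
      dsimp at h
      dsimp [twist]
      rw [← Functor.map_comp, ← Functor.map_comp, ← comp_whiskerRight, ← comp_whiskerRight, h])

/-- `(M ⊗ I) ⊗ J ≅ (M ⊗ J) ⊗ I`, naturally in `M`, by `(m ⊗ s) ⊗ t ↦ (m ⊗ t) ⊗ s`. -/
def tensorRightComm (I J : PreMod X) :
    tensorRight I ⋙ tensorRight J ≅ tensorRight J ⋙ tensorRight I :=
  NatIso.ofComponents
    (fun M => α_ M I J ≪≫ whiskerLeftIso M (β_ I J) ≪≫ (α_ M J I).symm)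
    (fun {M N} f => by
      dsimp
      simp only [Category.assoc, whiskerLeftIso_hom, ← associator_inv_naturality_left,
        associator_naturality_left_assoc, whisker_exchange_assoc])

/-- The canonical isomorphism `(- ⊗ 𝒪(-L)) ⊗ 𝒪(-L') ≅ (- ⊗ 𝒪(-L')) ⊗ 𝒪(-L)`, by
`(m ⊗ s) ⊗ t ↦ (m ⊗ t) ⊗ s` on local sections. -/
def twistComm (L L' : X.IdealSheafData) : twist L ⋙ twist L' ≅ twist L' ⋙ twist L :=
  (twistTwist L L').symm ≪≫
    Functor.isoWhiskerLeft (toPre X)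
      (Functor.isoWhiskerRight (tensorRightComm (invO L) (invO L')) (sheafify X)) ≪≫
    twistTwist L' L

/-- Coherent sheaves: quasi-coherent and of finite type. (For the locally Noetherian schemes that
are considered here this is the usual notion.) -/
def IsCoherent : ObjectProperty X.Modules :=
  fun M => M.IsQuasicoherent ∧ SheafOfModules.IsFiniteType M

/-! ## Grid categories -/

section Grid

variable {n : ℕ} {A : Type v} [Category.{w} A]

/-- The input of the grid construction: endofunctors `F i` of a category that commute with each
other, and natural transformations `η i : F i ⟶ id`. -/
structure GridData (n : ℕ) (A : Type v) [Category.{w} A] where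
  /-- the endofunctors -/
  F : Fin n → A ⥤ A
  /-- the endofunctors commute -/
  comm (i j : Fin n) : F i ⋙ F j ≅ F j ⋙ F i
  /-- the natural transformations -/
  η (i : Fin n) : F i ⟶ 𝟭 A

/-- Restriction of the input data to a full subcategory that is stable under the functors. -/
def GridData.restrict (D : GridData n A) (P : ObjectProperty A)
    (hP : ∀ i M, P M → P ((D.F i).obj M)) : GridData n P.FullSubcategory where
  F i := P.lift (P.ι ⋙ D.F i) (fun M => hP i _ M.property)
  comm i j := NatIso.ofComponents (fun M => P.isoMk ((D.comm i j).app M.obj))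
    (fun f => by ext; exact (D.comm i j).hom.naturality f.hom)
  η i :=
    { app M := P.homMk ((D.η i).app M.obj)
      naturality M N f := by ext; exact (D.η i).naturality f.hom }

/-- The index set `{1, …, p₁} × ⋯ × {1, …, pₙ}`, with each factor numbered from `0` instead. -/
abbrev Idx (p : Fin n → ℕ) := ∀ i, Fin (p i)

/-- `b = a + eᵢ`, both inside the index set. -/
def IsStep {p : Fin n → ℕ} (i : Fin n) (a b : Idx p) : Prop :=
  (b i : ℕ) = a i + 1 ∧ ∀ j, j ≠ i → b j = a j

/-- `a` is the last and `b` is the first index on a line in direction `i`,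
that is, `b - eᵢ = a - pᵢ eᵢ`. -/
def IsWrap {p : Fin n → ℕ} (i : Fin n) (a b : Idx p) : Prop :=
  (a i : ℕ) + 1 = p i ∧ (b i : ℕ) = 0 ∧ ∀ j, j ≠ i → b j = a j

/-- The composites of consecutive steps in direction `i`. -/
inductive IsClimb {p : Fin n → ℕ} {M : Idx p → A}
    (step : ∀ (i : Fin n) (a b : Idx p), IsStep i a b → (M a ⟶ M b)) (i : Fin n) :
    ∀ {a b : Idx p}, (M a ⟶ M b) → Prop
  | refl (a : Idx p) : IsClimb step i (𝟙 (M a))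
  | cons {a b c : Idx p} {f : M a ⟶ M b} (hf : IsClimb step i f) (h : IsStep i b c) :
    IsClimb step i (f ≫ step i b c h)

/-- The objects of the grid category `A[η₁^{1/p₁}, …, ηₙ^{1/pₙ}]`. With the convention
`M_{a - pᵢ eᵢ} = Fᵢ M_a` and `f_{a - pᵢ eᵢ} = Fᵢ f_a`, the structure morphism
`f^i_b : M_{b - eᵢ} ⟶ M_b` is `step` if `b - eᵢ` is in the index set and is `wrap` otherwise. -/
structure Grid (D : GridData n A) (p : Fin n → ℕ) where
  /-- the objects `M_a` -/
  obj : Idx p → A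
  /-- the morphism `f^i_b : M_{b - eᵢ} ⟶ M_b` when `a = b - eᵢ` is in the index set -/
  step (i : Fin n) (a b : Idx p) : IsStep i a b → (obj a ⟶ obj b)
  /-- the morphism `f^i_b : M_{b - eᵢ} = Fᵢ M_a ⟶ M_b` when `b` is the first and `a` is the last
  index on a line in direction `i` -/
  wrap (i : Fin n) (a b : Idx p) : IsWrap i a b → ((D.F i).obj (obj a) ⟶ obj b)
  /-- commutativity of the squares in the interior -/
  step_step {i j : Fin n} (hij : i ≠ j) {a b c d : Idx p} (hab : IsStep i a b) (hbd : IsStep j b d)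
    (hac : IsStep j a c) (hcd : IsStep i c d) :
    step i a b hab ≫ step j b d hbd = step j a c hac ≫ step i c d hcd
  /-- commutativity of the squares that wrap around in one of the two directions -/
  wrap_step {i j : Fin n} (hij : i ≠ j) {a b c d : Idx p} (hab : IsWrap i a b) (hbd : IsStep j b d)
    (hac : IsStep j a c) (hcd : IsWrap i c d) :
    wrap i a b hab ≫ step j b d hbd = (D.F i).map (step j a c hac) ≫ wrap i c d hcd
  /-- commutativity of the squares that wrap around in both directions -/
  wrap_wrap {i j : Fin n} (hij : i ≠ j) {a b c d : Idx p} (hab : IsWrap i a b) (hbd : IsWrap j b d)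
    (hac : IsWrap j a c) (hcd : IsWrap i c d) :
    (D.F j).map (wrap i a b hab) ≫ wrap j b d hbd =
      (D.comm i j).hom.app (obj a) ≫ (D.F i).map (wrap j a c hac) ≫ wrap i c d hcd
  /-- the cycle condition: going once around from `Fᵢ M_a` to `M_a` is `ηᵢ` -/
  cycle {i : Fin n} {a b c : Idx p} {f : obj a ⟶ obj b} {g : obj c ⟶ obj a}
    (hf : IsClimb step i f) (hbc : IsWrap i b c) (hg : IsClimb step i g) :
    (D.F i).map f ≫ wrap i b c hbc ≫ g = (D.η i).app (obj a)

namespace Grid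

variable {D : GridData n A} {p : Fin n → ℕ}

/-- A morphism of grids: a family of morphisms that commutes with all structure morphisms. -/
@[ext]
structure Hom (M N : Grid D p) where
  /-- the components -/
  app (a : Idx p) : M.obj a ⟶ N.obj a
  step_app {i : Fin n} {a b : Idx p} (h : IsStep i a b) :
    M.step i a b h ≫ app b = app a ≫ N.step i a b h
  wrap_app {i : Fin n} {a b : Idx p} (h : IsWrap i a b) :
    M.wrap i a b h ≫ app b = (D.F i).map (app a) ≫ N.wrap i a b h

instance : Category (Grid D p) where
  Hom := Hom
  id M :=
    { app a := 𝟙 (M.obj a)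
      step_app h := by simp
      wrap_app h := by simp }
  comp f g :=
    { app a := f.app a ≫ g.app a
      step_app h := by rw [← Category.assoc, f.step_app, Category.assoc, g.step_app, Category.assoc]
      wrap_app h := by
        rw [← Category.assoc, f.wrap_app, Category.assoc, g.wrap_app, Functor.map_comp,
          Category.assoc] }

end Grid

end Grid

/-- The input data `Fᵢ = - ⊗ 𝒪(-Lᵢ)` and `ηᵢ : Fᵢ ⟶ id` on the category of `𝒪_X`-modules. -/
def twistData {n : ℕ} (L : Fin n → X.IdealSheafData) : GridData n X.Modules where
  F i := twist (L i)
  comm i j := twistComm (L i) (L j)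
  η i := twistToId (L i)

/-! ## The order `⨂ᵢ T_{pᵢ}(𝒪, 𝒪(-Lᵢ))` -/

section Algebra

variable {R S : Type u} [CommRing R] [CommRing S]

/-- The algebra `T_p(R, I)` of `p × p` matrices whose entries above the diagonal lie in `I`. -/
def triangular (p : ℕ) (I : Ideal R) : Subalgebra R (Matrix (Fin p) (Fin p) R) where
  carrier := {m | ∀ a b, a < b → m a b ∈ I}
  mul_mem' {m m'} hm hm' a c hac := by
    rw [Matrix.mul_apply]
    refine Ideal.sum_mem _ fun b _ => ?_
    by_cases hab : a < b
    · exact Ideal.mul_mem_right _ _ (hm a b hab)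
    · exact Ideal.mul_mem_left _ _ (hm' b c (lt_of_le_of_lt (not_lt.mp hab) hac))
  add_mem' hm hm' a b hab := add_mem (hm a b hab) (hm' a b hab)
  algebraMap_mem' r a b hab := by
    rw [Matrix.algebraMap_matrix_apply, if_neg hab.ne]
    exact zero_mem _

/-- Applying a ring homomorphism `R → S` that maps `I` into `J` to all entries. -/
def triangularMap (p : ℕ) {I : Ideal R} {J : Ideal S} (f : R →+* S) (h : I ≤ J.comap f) :
    triangular p I →+* triangular p J :=
  ((f.mapMatrix : Matrix (Fin p) (Fin p) R →+* _).comp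
    (triangular p I).val.toRingHom).codRestrict (triangular p J)
      (fun m a b hab => h (m.2 a b hab))

variable {n : ℕ}

/-- The algebra `⨂ᵢ T_{pᵢ}(R, Iᵢ)` over `R`. -/
abbrev tensorOrder (p : Fin n → ℕ) (I : Fin n → Ideal R) : Type u :=
  ⨂[R] i, triangular (p i) (I i)

/-- The map `⨂ᵢ T_{pᵢ}(R, Iᵢ) → ⨂ᵢ T_{pᵢ}(S, Jᵢ)` by `⨂ mᵢ ↦ ⨂ f(mᵢ)`. -/
def tensorOrderMap (p : Fin n → ℕ) {I : Fin n → Ideal R} {J : Fin n → Ideal S} (f : R →+* S)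
    (h : ∀ i, I i ≤ (J i).comap f) : tensorOrder p I →+* tensorOrder p J :=
  letI : Algebra R (tensorOrder p J) := Algebra.compHom _ f
  (PiTensorProduct.liftAlgHom
    { toFun m := PiTensorProduct.tprod S fun i => triangularMap (p i) f (h i) (m i)
      map_update_add' m i x y := by
        simp only [Function.apply_update (fun i => triangularMap (p i) f (h i)), map_add,
          MultilinearMap.map_update_add]
      map_update_smul' m i r x := by
        have hr : triangularMap (p i) f (h i) (r • x) = f r • triangularMap (p i) f (h i) x := by
          ext a b
          exact map_mul f r _
        simp only [Function.apply_update (fun i => triangularMap (p i) f (h i)), hr,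
          MultilinearMap.map_update_smul]
        rfl }
    (congrArg (PiTensorProduct.tprod S) (funext fun i => map_one (triangularMap (p i) f (h i))))
    (fun x y => (congrArg (PiTensorProduct.tprod S)
      (funext fun i => map_mul (triangularMap (p i) f (h i)) (x i) (y i))).trans
        (PiTensorProduct.tprod_mul_tprod _ _).symm)).toRingHom

lemma tensorOrderMap_smul_tprod (p : Fin n → ℕ) {I : Fin n → Ideal R} {J : Fin n → Ideal S}
    (f : R →+* S) (h : ∀ i, I i ≤ (J i).comap f) (r : R) (m : ∀ i, triangular (p i) (I i)) :
    tensorOrderMap p f h (r • PiTensorProduct.tprod R m) =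
      f r • PiTensorProduct.tprod S fun i => triangularMap (p i) f (h i) (m i) := by
  let _ : Algebra R (tensorOrder p J) := Algebra.compHom _ f
  refine (map_smul (PiTensorProduct.liftAlgHom _ _ _) r (PiTensorProduct.tprod R m)).trans ?_
  rw [PiTensorProduct.liftAlgHom_apply, PiTensorProduct.lift.tprod]
  rfl

lemma tensorOrder_ringHom_ext {p : Fin n → ℕ} {I : Fin n → Ideal R} {T : Type u} [Ring T]
    {φ ψ : tensorOrder p I →+* T}
    (h : ∀ (r : R) m, φ (r • PiTensorProduct.tprod R m) = ψ (r • PiTensorProduct.tprod R m)) :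
    φ = ψ := by
  ext x
  induction x using PiTensorProduct.induction_on with
  | smul_tprod r m => exact h r m
  | add x y hx hy =>
    exact (RingHom.map_add φ x y).trans
      ((congrArg₂ (· + ·) hx hy).trans (RingHom.map_add ψ x y).symm)

end Algebra

/-- The presheaf of rings `U ↦ ⨂ᵢ T_{pᵢ}(𝒪(U), 𝒪(-Lᵢ)(U))`. -/
def preOrder {n : ℕ} (L : Fin n → X.IdealSheafData) (p : Fin n → ℕ) :
    X.Opensᵒᵖ ⥤ RingCat.{u} where
  obj U := RingCat.of (tensorOrder (R := Γ(X, U.unop)) p fun i => idealSections (L i) U.unop)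
  map f := RingCat.ofHom
    (tensorOrderMap p (X.presheaf.map f).hom fun i => idealSections_map (L i) f)
  map_id U := by
    ext1
    refine tensorOrder_ringHom_ext fun r m => ?_
    refine (tensorOrderMap_smul_tprod _ _ _ r m).trans ?_
    have hr : (X.presheaf.map (𝟙 U)).hom r = r := by rw [X.presheaf.map_id]; rfl
    rw [hr]
    refine congrArg (r • PiTensorProduct.tprod _ ·) (funext fun i => ?_)
    ext a b
    change (X.presheaf.map (𝟙 U)).hom ((m i).1 a b) = _
    rw [X.presheaf.map_id]
    rfl
  map_comp {U V W} f g := by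
    ext1
    refine tensorOrder_ringHom_ext fun r m => ?_
    refine (tensorOrderMap_smul_tprod _ _ _ r m).trans ?_
    refine Eq.trans ?_ (congrArg (tensorOrderMap p (X.presheaf.map g).hom
      fun i => idealSections_map (L i) g) (tensorOrderMap_smul_tprod _ _ _ r m)).symm
    refine Eq.trans ?_ (tensorOrderMap_smul_tprod _ _ _ _ _).symm
    have hr (r) : (X.presheaf.map (f ≫ g)).hom r =
        (X.presheaf.map g).hom ((X.presheaf.map f).hom r) := by rw [X.presheaf.map_comp]; rfl
    rw [hr]
    refine congrArg (_ • PiTensorProduct.tprod _ ·) (funext fun i => ?_)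
    ext a b
    exact hr _

/-- The map from `𝒪_X` to the presheaf of `𝒪_X`-algebras `preOrder L p`. -/
def toPreOrder {n : ℕ} (L : Fin n → X.IdealSheafData) (p : Fin n → ℕ) :
    X.presheaf ⋙ forget₂ CommRingCat.{u} RingCat.{u} ⟶ preOrder L p where
  app U := RingCat.ofHom (algebraMap Γ(X, U.unop)
    (tensorOrder p fun i => idealSections (L i) U.unop))
  naturality U V f := by
    ext r
    change algebraMap Γ(X, V.unop) (tensorOrder p fun i => idealSections (L i) V.unop)
      ((X.presheaf.map f).hom r) = tensorOrderMap p (X.presheaf.map f).hom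
        (fun i => idealSections_map (L i) f) (algebraMap Γ(X, U.unop) _ r)
    rw [Algebra.algebraMap_eq_smul_one, Algebra.algebraMap_eq_smul_one, PiTensorProduct.one_def,
      PiTensorProduct.one_def, tensorOrderMap_smul_tprod]
    refine congrArg (_ • PiTensorProduct.tprod _ ·) (funext fun i => ?_)
    exact (map_one (triangularMap (p i) _ (idealSections_map (L i) f))).symm

/-- The sheaf of noncommutative algebras `A = ⨂ᵢ T_{pᵢ}(𝒪, 𝒪(-Lᵢ))`, as a sheaf of rings: the
tensor product of sheaves of `𝒪_X`-algebras is the sheafification of the sectionwise one. -/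
def order {n : ℕ} (L : Fin n → X.IdealSheafData) (p : Fin n → ℕ) :
    Sheaf (Opens.grothendieckTopology X) RingCat.{u} :=
  (presheafToSheaf (Opens.grothendieckTopology X) RingCat.{u}).obj (preOrder L p)

/-- The structure map `𝒪_X ⟶ A`. -/
def toOrder {n : ℕ} (L : Fin n → X.IdealSheafData) (p : Fin n → ℕ) :
    X.ringCatSheaf ⟶ order L p :=
  ⟨toPreOrder L p ≫ toSheafify (Opens.grothendieckTopology X) (preOrder L p)⟩

/-- The `𝒪_X`-module that underlies a sheaf of left `A`-modules. -/
def orderForget {n : ℕ} (L : Fin n → X.IdealSheafData) (p : Fin n → ℕ) :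
    SheafOfModules.{u} (order L p) ⥤ X.Modules :=
  SheafOfModules.restrictScalars (toOrder L p)

/-- The sheaves of left `A`-modules that are coherent over `𝒪_X`. -/
def orderCoherent {n : ℕ} (L : Fin n → X.IdealSheafData) (p : Fin n → ℕ) :
    ObjectProperty (SheafOfModules.{u} (order L p)) :=
  IsCoherent.inverseImage (orderForget L p)

/-- `mod A`: the category of sheaves of left `A`-modules that are coherent over `𝒪_X`. -/
abbrev OrderMod {n : ℕ} (L : Fin n → X.IdealSheafData) (p : Fin n → ℕ) :=
  (orderCoherent L p).FullSubcategory

/-! ## Linearity over the base field -/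

section Linear

variable {k : Type u} [Field k] (s : X ⟶ Spec (.of k))

/-- A scalar `c : k` as a function on the open subset `U` of the `k`-scheme `X`. -/
def scalar (c : k) (U : X.Opens) : Γ(X, U) :=
  X.presheaf.map (homOfLE le_top).op (s.appTop ((Scheme.ΓSpecIso (.of k)).inv c))

/-- `f = c • g`, for morphisms `f`, `g` of `𝒪_X`-modules and a scalar `c : k`. -/
def IsScalarMul (c : k) {M N : X.Modules} (f g : M ⟶ N) : Prop :=
  ∀ (U : X.Opens) (m : Γ(M, U)), f.app U m = scalar s c U • g.app U m

/-- A functor from `mod A` to a category of grids of coherent sheaves is `k`-linear. -/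
def IsLinear {n : ℕ} {L : Fin n → X.IdealSheafData} {p : Fin n → ℕ}
    {D : GridData n (IsCoherent (X := X)).FullSubcategory} (Φ : OrderMod L p ⥤ Grid D p) : Prop :=
  (∀ {M N : OrderMod L p} (f g : M ⟶ N) (a : Idx p),
    (Φ.map (f + g)).app a = (Φ.map f).app a + (Φ.map g).app a) ∧
  (∀ (c : k) {M N : OrderMod L p} (f g : M ⟶ N),
    IsScalarMul s c ((orderForget L p).map f.hom) ((orderForget L p).map g.hom) →
    ∀ a : Idx p, IsScalarMul s c ((Φ.map f).app a).hom ((Φ.map g).app a).hom)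

end Linear

end

end GLOrder

/-! The equivalence is a Peirce decomposition. Over an open set, with R the functions and I_i the
ideal of L_i, the algebra ⨂ T_{p_i}(R, I_i) has orthogonal idempotents e_a, a in the index set, with
sum 1. An A-module N therefore splits, as an 𝒪-module, into components e_a N. In direction i, the
matrix units just below the diagonal act as maps between neighbouring components. An upper right
corner entry s in 𝒪(-L_i) sends the last component of a line to the first, bilinearly in s, hence as
a morphism out of the twist. Units in different directions commute, which gives the commutativity
condition. A full turn through the corner entry s multiplies e_a by s, which gives the cycle
condition.

Conversely, T_p(R, I) is presented by the diagonal idempotents, the sum of the units below the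
diagonal and the corner entries, with a short list of relations (`TriRel`, `TriRel.hom`). A grid
provides such operators on the direct sum of its objects. Those of different directions commute, so
together they give an action of the tensor product (`ModuleGrid.act`, `Grid.action`).

Two sheafifications have to be controlled. The order is one, but a module over it is the same as an
𝒪-module with an action of the presheaf `preOrder` (`exists_map_eq`, `OrderAction.module`). The
twist is another: morphisms out of it are tested on sections m ⊗ s (`twist_hom_ext`,
`twist_twist_hom_ext`) and are built from bilinear maps (`TwistBilin.lift`).

Coherence enters three times. It passes to retracts, hence to components (`isCoherent_of_retract`).
It passes to finite sums, hence to the total object of a grid (`isCoherent_biproduct`). It passes to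
twists, because multiplication by a local equation identifies M with its twist locally
(`isCoherent_twist`).

The functor `toGrid` is fully faithful because equivariant morphisms are block diagonal
(`IsEquivariant.eq_of_gridHom_eq`, `exists_gridHom_eq`). It is essentially surjective by
`Grid.fromTotal`. -/

noncomputable section
namespace GLOrder
open Limits Scheme.Modules

/-! ### Local criteria for quasi-coherence and finite type -/

section
variable {C : Type w} [Category.{v} C] {J : GrothendieckTopology C} {R : Sheaf J RingCat.{u}}
  [HasWeakSheafify J AddCommGrpCat.{u}] [J.WEqualsLocallyBijective AddCommGrpCat.{u}]
  [∀ (X : C), HasWeakSheafify (J.over X) AddCommGrpCat.{u}]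
  [∀ (X : C), (J.over X).WEqualsLocallyBijective AddCommGrpCat.{u}]

lemma isFiniteType_of_localGeneratorsData {M : SheafOfModules.{u} R}
    (σ : SheafOfModules.LocalGeneratorsData.{w} M)
    (h : ∀ i, Finite (σ.generators i).I) : M.IsFiniteType :=
  ⟨σ, ⟨fun i => ⟨h i⟩⟩⟩

lemma exists_finite_localGeneratorsData {M : SheafOfModules.{u} R} (h : M.IsFiniteType) :
    ∃ σ : SheafOfModules.LocalGeneratorsData.{w} M, ∀ i, Finite (σ.generators i).I := by
  obtain ⟨σ, hσ⟩ := h.exists_localGeneratorsData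
  exact ⟨σ, fun i => (hσ.isFiniteType i).finite⟩

/-- Maps out of a free module are families of sections, so two morphisms agree after composition
with the map from the free module exactly when they agree on the chosen sections. -/
lemma epi_freeHomEquiv_symm_iff {M : SheafOfModules.{u} R} {I : Type u} (s : I → M.sections) :
    Epi (M.freeHomEquiv.symm s) ↔ ∀ (N : SheafOfModules.{u} R) (f g : M ⟶ N),
      (∀ i, SheafOfModules.sectionsMap f (s i) = SheafOfModules.sectionsMap g (s i)) → f = g := by
  constructor
  · intro h N f g hfg
    rw [← cancel_epi (M.freeHomEquiv.symm s), SheafOfModules.freeHomEquiv_symm_comp,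
      SheafOfModules.freeHomEquiv_symm_comp]
    exact congrArg _ (funext hfg)
  · refine fun h => ⟨fun {N} f g hfg => h N f g fun i => ?_⟩
    rw [SheafOfModules.freeHomEquiv_symm_comp, SheafOfModules.freeHomEquiv_symm_comp] at hfg
    exact congrFun (N.freeHomEquiv.symm.injective hfg) i

/-- If the images of the `ι j` generate a sheaf of modules, then so do the generating sections of
the sources. -/
def generatingSectionsOfJointlyEpi {J' : Type u} {M : J' → SheafOfModules.{u} R}
    {N : SheafOfModules.{u} R} (ι : ∀ j, M j ⟶ N)
    (hι : ∀ (Z : SheafOfModules.{u} R) (f g : N ⟶ Z), (∀ j, ι j ≫ f = ι j ≫ g) → f = g)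
    (G : ∀ j, (M j).GeneratingSections) : N.GeneratingSections where
  I := Σ j, (G j).I
  s x := SheafOfModules.sectionsMap (ι x.1) ((G x.1).s x.2)
  epi := (epi_freeHomEquiv_symm_iff _).mpr fun Z f g h => hι Z f g fun j =>
    (epi_freeHomEquiv_symm_iff (G j).s).mp (G j).epi Z _ _ fun i => by
      simpa [SheafOfModules.sectionsMap_comp] using h ⟨j, i⟩
end

variable {X : Scheme.{u}}

/-- The structure sheaf of the slice site corresponds to that of the open subscheme. -/
def overEquivInverseUnit (U : X.Opens) :
    SheafOfModules.unit (X.ringCatSheaf.over U) ≅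
      (overEquiv U).inverse.obj (SheafOfModules.unit (U : Scheme.{u}).ringCatSheaf) :=
  (overEquiv U).unitIso.app _ ≪≫ (overEquiv U).inverse.mapIso
    ((overFunctorEquiv U).app (SheafOfModules.unit X.ringCatSheaf) ≪≫ restrictUnitIso U.ι)

/-- The inverse of `overEquiv`, as a functor between categories of sheaves of modules. -/
def overInverse (U : X.Opens) : SheafOfModules.{u} (U : Scheme.{u}).ringCatSheaf ⥤
    SheafOfModules.{u} (X.ringCatSheaf.over U) := (overEquiv U).inverse

instance (U : X.Opens) : PreservesColimitsOfSize.{u, u} (overInverse U) := by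
  have : PreservesColimitsOfSize.{u, u} (overEquiv U).inverse := inferInstance
  exact this

/-- `overEquiv`, as a functor between categories of sheaves of modules. -/
def overFunctor' (U : X.Opens) : SheafOfModules.{u} (X.ringCatSheaf.over U) ⥤
    SheafOfModules.{u} (U : Scheme.{u}).ringCatSheaf := (overEquiv U).functor

instance (U : X.Opens) : PreservesColimitsOfSize.{u, u} (overFunctor' U) := by
  have : PreservesColimitsOfSize.{u, u} (overEquiv U).functor := inferInstance
  exact this

/-- `restrictFunctor`, as a functor between categories of sheaves of modules. -/
def restrictFunctor' {Y : Scheme.{u}} (f : X ⟶ Y) [IsOpenImmersion f] :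
    SheafOfModules.{u} Y.ringCatSheaf ⥤ SheafOfModules.{u} X.ringCatSheaf := restrictFunctor f

instance {Y : Scheme.{u}} (f : X ⟶ Y) [IsOpenImmersion f] :
    PreservesColimitsOfSize.{u, u} (restrictFunctor' f) := by
  have : PreservesColimitsOfSize.{u, u} (restrictFunctor f) := inferInstance
  exact this

/-- A sheaf of modules over the slice site, recovered from the restriction to an open
subscheme. -/
def overInverseRestrict (M : X.Modules) (U : X.Opens) :
    (overInverse U).obj (M.restrict U.ι) ≅ SheafOfModules.over (R := X.ringCatSheaf) M U :=
  (overEquiv U).inverse.mapIso ((overFunctorEquiv U).symm.app M) ≪≫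
      (overEquiv U).unitIso.symm.app _

/-- The restriction to an open subscheme, recovered from a sheaf of modules over the slice site. -/
def overFunctorRestrict (M : X.Modules) (U : X.Opens) :
    (overFunctor' U).obj (SheafOfModules.over (R := X.ringCatSheaf) M U) ≅
      (M.restrict U.ι : SheafOfModules.{u} (U : Scheme.{u}).ringCatSheaf) :=
  (overFunctorEquiv U).app M

/-- Restricting to a smaller open subscheme. -/
def restrictRestrict (M : X.Modules) {U V : X.Opens} (h : V ≤ U) :
    (restrictFunctor' (X.homOfLE h)).obj (M.restrict U.ι) ≅
      (M.restrict V.ι : SheafOfModules.{u} (V : Scheme.{u}).ringCatSheaf) :=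
  ((restrictFunctorComp _ _).symm ≪≫ (restrictFunctorCongr (by simp))).app M

/-- A presentation of the restriction to an open subscheme gives one over the slice site. -/
def presentationOver {M : X.Modules} {U : X.Opens} (P : (M.restrict U.ι).Presentation) :
    (SheafOfModules.over (R := X.ringCatSheaf) M U).Presentation :=
  SheafOfModules.Presentation.ofIsIso.{u, u, u} (overInverseRestrict M U).hom
    (P.map (overInverse U) (overEquivInverseUnit U))

/-- The generating sections of a sheaf of modules on an open subscheme. -/
abbrev GenOn (M : X.Modules) (U : X.Opens) :=
  SheafOfModules.GeneratingSections (R := (U : Scheme.{u}).ringCatSheaf) (M.restrict U.ι)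

/-- Generating sections of the restriction to an open subscheme give ones over the slice site. -/
def generatorsOver {M : X.Modules} {U : X.Opens} (G : GenOn M U) :
    (SheafOfModules.over (R := X.ringCatSheaf) M U).GeneratingSections :=
  SheafOfModules.GeneratingSections.equivOfIso (overInverseRestrict M U)
    (SheafOfModules.GeneratingSections.map G (overInverse U) (overEquivInverseUnit U))

/-- Generating sections over the slice site give ones of the restriction to an open subscheme. -/
def generatorsOfOver {M : X.Modules} {U : X.Opens}
    (G : (SheafOfModules.over (R := X.ringCatSheaf) M U).GeneratingSections) : GenOn M U :=
  SheafOfModules.GeneratingSections.equivOfIso (overFunctorRestrict M U)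
    (SheafOfModules.GeneratingSections.map G (overFunctor' U)
      ((overFunctorEquiv U).app (SheafOfModules.unit X.ringCatSheaf) ≪≫ restrictUnitIso U.ι).symm)

/-- The generating sections of the restriction to a smaller open subscheme. -/
def generatorsRestrict {M : X.Modules} {U V : X.Opens} (h : V ≤ U) (G : GenOn M U) : GenOn M V :=
  SheafOfModules.GeneratingSections.equivOfIso (restrictRestrict M h)
    (SheafOfModules.GeneratingSections.map G (restrictFunctor' (X.homOfLE h))
      (restrictUnitIso _).symm)

/-- Quasi-coherence is defined by presentations over the slice sites of a cover. `presentationOver`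
moves a presentation from the open subscheme to the slice site, and the cover is indexed by the
points of X. -/
lemma isQuasicoherent_of_forall_exists_presentation (M : X.Modules)
    (h : ∀ x : X, ∃ U : X.Opens, x ∈ U ∧ Nonempty (M.restrict U.ι).Presentation) :
    M.IsQuasicoherent := by
  choose U hxU P using h
  refine SheafOfModules.QuasicoherentData.isQuasicoherent (M := M)
    { I := X
      X := U
      coversTop := (Opens.coversTop_iff _ _).mpr ?_
      presentation := fun x => presentationOver (P x).some }
  exact (eq_top_iff.mpr fun x _ => Opens.mem_iSup.mpr ⟨x, hxU x⟩)

lemma isFiniteType_of_forall_exists_generators (M : X.Modules)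
    (h : ∀ x : X, ∃ U : X.Opens, x ∈ U ∧ ∃ G : GenOn M U, Finite G.I) :
    SheafOfModules.IsFiniteType (R := X.ringCatSheaf) M := by
  choose U hxU G hG using h
  have cov : (Opens.grothendieckTopology X).CoversTop U := (Opens.coversTop_iff _ _).mpr
    (eq_top_iff.mpr fun x _ => Opens.mem_iSup.mpr ⟨x, hxU x⟩)
  exact isFiniteType_of_localGeneratorsData (R := X.ringCatSheaf) (M := M)
    { I := X
      X := U
      coversTop := cov
      generators := fun x => generatorsOver (G x) } hG

lemma exists_generators_restrict (M : X.Modules)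
    (h : SheafOfModules.IsFiniteType (R := X.ringCatSheaf) M) (x : X) :
    ∃ U : X.Opens, x ∈ U ∧ ∃ G : GenOn M U, Finite G.I := by
  obtain ⟨σ, hσ⟩ := exists_finite_localGeneratorsData h
  have cov := σ.coversTop
  rw [Opens.coversTop_iff, IsOpenCover] at cov
  obtain ⟨i, hi⟩ := Opens.mem_iSup.mp (cov ▸ Opens.mem_top x : x ∈ ⨆ i, σ.X i)
  exact ⟨_, hi, generatorsOfOver (σ.generators i), hσ i⟩

lemma exists_presentation_restrict (M : X.Modules) [M.IsQuasicoherent] (x : X) :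
    ∃ U : X.Opens, x ∈ U ∧ IsAffineOpen U ∧ Nonempty (M.restrict U.ι).Presentation := by
  obtain ⟨ι, U, P, hU, hU'⟩ := M.exists_isOpenCover_presentation
  obtain ⟨i, hi⟩ := Opens.mem_iSup.mp (hU ▸ Opens.mem_top x : x ∈ ⨆ i, U i)
  exact ⟨_, hi, hU' i, ⟨P i⟩⟩

end GLOrder
end

/-! ### Coherence under local isomorphisms, retracts and finite sums -/

noncomputable section
namespace GLOrder
open Limits Scheme.Modules
attribute [local instance] Abelian.hasFiniteBiproducts

section
variable {C : Type w} [Category.{v} C] {J : GrothendieckTopology C} {R : Sheaf J RingCat.{u}}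
  [HasSheafify J AddCommGrpCat.{u}] [J.WEqualsLocallyBijective AddCommGrpCat.{u}]
  {M N : SheafOfModules.{u} R}

/-- Transport of a presentation along an isomorphism. -/
def presentationOfIso (e : M ≅ N) (P : M.Presentation) : N.Presentation :=
  SheafOfModules.Presentation.ofIsIso e.hom P

/-- The images of generating sections under an epimorphism. -/
def generatorsOfEpi (r : M ⟶ N) (hr : Epi r) (G : M.GeneratingSections) : N.GeneratingSections :=
  G.ofEpi r

end

variable {X : Scheme.{u}}

/-- The presentation of the restriction to a smaller open subscheme. -/
def presentationRestrictLE {M : X.Modules} {U V : X.Opens} (h : V ≤ U)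
    (P : (M.restrict U.ι).Presentation) : (M.restrict V.ι).Presentation :=
  presentationOfIso (restrictRestrict M h)
    (P.map (restrictFunctor' (X.homOfLE h)) (restrictUnitIso _).symm)

/-- An isomorphism over an open subscheme restricts to a smaller open subscheme. -/
def restrictIsoLE {M N : X.Modules} {U V : X.Opens} (h : V ≤ U)
    (e : M.restrict U.ι ≅ N.restrict U.ι) : M.restrict V.ι ≅ N.restrict V.ι :=
  (restrictRestrict M h).symm ≪≫ (restrictFunctor' (X.homOfLE h)).mapIso e ≪≫
    restrictRestrict N h

/-- A sheaf of modules that is locally isomorphic to a coherent one is coherent. -/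
lemma isCoherent_of_locally_iso {M N : X.Modules} (hN : IsCoherent N)
    (h : ∀ x : X, ∃ U : X.Opens, x ∈ U ∧ Nonempty (N.restrict U.ι ≅ M.restrict U.ι)) :
    IsCoherent M := by
  constructor
  · refine isQuasicoherent_of_forall_exists_presentation M fun x => ?_
    obtain ⟨U, hxU, ⟨e⟩⟩ := h x
    have := hN.1
    obtain ⟨V, hxV, -, ⟨P⟩⟩ := exists_presentation_restrict N x
    exact ⟨U ⊓ V, ⟨hxU, hxV⟩, ⟨presentationOfIso (restrictIsoLE inf_le_left e)
      (presentationRestrictLE inf_le_right P)⟩⟩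
  · refine isFiniteType_of_forall_exists_generators M fun x => ?_
    obtain ⟨U, hxU, ⟨e⟩⟩ := h x
    obtain ⟨V, hxV, G, hG⟩ := exists_generators_restrict N hN.2 x
    let e' := restrictIsoLE (V := U ⊓ V) inf_le_left e
    exact ⟨U ⊓ V, ⟨hxU, hxV⟩, SheafOfModules.GeneratingSections.equivOfIso
      (R := (U ⊓ V : X.Opens).toScheme.ringCatSheaf) e'
      (generatorsRestrict inf_le_right G), hG⟩

/-- On an affine open subscheme, sheaves of modules in the image of `tilde` are presented. -/
lemma exists_presentation_of_isIso_fromTildeΓ (M : X.Modules) {U : X.Opens} (hU : IsAffineOpen U)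
    (h : IsIso (fromTildeΓ (M.restrict hU.fromSpec))) : Nonempty (M.restrict U.ι).Presentation := by
  -- All elements of the module serve as generators and the whole kernel as relations;
  -- quasi-coherence asks for no finiteness.
  have P := presentationTilde.{u} (R := Γ(X, U))
    ((modulesSpecToSheaf.obj (M.restrict hU.fromSpec)).presheaf.obj (.op ⊤)) .univ (by simp) _
    (Submodule.span_eq _)
  have P' := presentationOfIso (R := (Spec Γ(X, U)).ringCatSheaf)
    (@asIso _ _ _ _ (fromTildeΓ (M.restrict hU.fromSpec)) h) P
  refine ⟨presentationOfIso (((restrictFunctorComp hU.isoSpec.hom hU.fromSpec).symm ≪≫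
    restrictFunctorCongr (by simp)).app M) (presentationRestrict hU.isoSpec.hom P')⟩

lemma isQuasicoherent_of_forall_isIso_fromTildeΓ (M : X.Modules)
    (h : ∀ (U : X.Opens) (hU : IsAffineOpen U), IsIso (fromTildeΓ (M.restrict hU.fromSpec))) :
    M.IsQuasicoherent := by
  refine isQuasicoherent_of_forall_exists_presentation M fun x => ?_
  obtain ⟨U, hU, hx, -⟩ := (Opens.isBasis_iff_nbhd.mp X.isBasis_affineOpens) (Opens.mem_top x)
  exact ⟨U, hx, exists_presentation_of_isIso_fromTildeΓ M hU (h U hU)⟩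

/-- The inverse at M is the inverse at N, cut down by the retraction; naturality does the rest. -/
lemma isIso_app_of_retract {C : Type v} [Category.{w} C] {F G : C ⥤ C} (α : F ⟶ G) {M N : C}
    (i : M ⟶ N) (r : N ⟶ M) (h : i ≫ r = 𝟙 M) (hN : IsIso (α.app N)) : IsIso (α.app M) := by
  refine ⟨G.map i ≫ inv (α.app N) ≫ F.map r, ?_, ?_⟩
  · rw [← α.naturality_assoc, IsIso.hom_inv_id_assoc, ← F.map_comp, h, F.map_id]
  · rw [Category.assoc, Category.assoc, α.naturality, IsIso.inv_hom_id_assoc, ← G.map_comp, h,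
      G.map_id]

/-- Quasi-coherence means that on affine opens the natural map `fromTildeΓ` is invertible, and
invertibility of a natural transformation passes to retracts. Finite type passes along `r`, which is
a split epimorphism. This covers the components of a module over the order, which are known only as
splittings of idempotents. -/
lemma isCoherent_of_retract {M N : X.Modules} (i : M ⟶ N) (r : N ⟶ M) (h : i ≫ r = 𝟙 M)
    (hN : IsCoherent N) : IsCoherent M := by
  constructor
  · have := hN.1
    refine isQuasicoherent_of_forall_isIso_fromTildeΓ M fun U hU => ?_
    have hN' : IsIso (fromTildeΓ (N.restrict hU.fromSpec)) := inferInstance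
    exact isIso_app_of_retract fromTildeΓNatTrans ((restrictFunctor hU.fromSpec).map i)
      ((restrictFunctor hU.fromSpec).map r) (by rw [← Functor.map_comp, h, CategoryTheory.Functor.map_id]) hN'
  · refine isFiniteType_of_forall_exists_generators M fun x => ?_
    obtain ⟨V, hxV, G, hG⟩ := exists_generators_restrict N hN.2 x
    have : IsSplitEpi r := ⟨⟨⟨i, h⟩⟩⟩
    exact ⟨V, hxV, generatorsOfEpi (R := V.toScheme.ringCatSheaf) ((restrictFunctor V.ι).map r)
      (inferInstance : Epi ((restrictFunctor V.ι).map r)) G, hG⟩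

instance {Y : Scheme.{u}} (f : X ⟶ Y) [IsOpenImmersion f] : (restrictFunctor f).Additive :=
  have := Limits.preservesBinaryBiproducts_of_preservesBinaryCoproducts (restrictFunctor f)
  Functor.additive_of_preservesBinaryBiproducts _

/-- On an affine open, each summand is a tilde module, and both tilde and restriction commute with
finite biproducts. For finite type, the generators of the summands are put together over the
intersection of finitely many neighbourhoods. -/
lemma isCoherent_biproduct {J : Type} [Finite J] (M : J → X.Modules)
    (hM : ∀ j, IsCoherent (M j)) : IsCoherent (⨁ M) := by
  constructor
  · refine isQuasicoherent_of_forall_isIso_fromTildeΓ _ fun U hU => ?_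
    have h (j) : (tilde.functor Γ(X, U)).essImage ((M j).restrict hU.fromSpec) := by
      have := (hM j).1
      exact isIso_fromTildeΓ_iff.mp inferInstance
    choose T e using h
    rw [isIso_fromTildeΓ_iff]
    exact ⟨⨁ T, ⟨(tilde.functor Γ(X, U)).mapBiproduct T ≪≫
      biproduct.mapIso (fun j => (e j).some) ≪≫
      ((restrictFunctor hU.fromSpec).mapBiproduct M).symm⟩⟩
  · refine isFiniteType_of_forall_exists_generators _ fun x => ?_
    choose V hxV G hG using fun j => exists_generators_restrict (M j) (hM j).2 x
    let W : X.Opens := ⨅ j, V j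
    -- The index type lives in the lowest universe and is lifted to the one in which generating
    -- sections are indexed.
    let G' (j : ULift.{u} J) : GenOn (M j.down) W := generatorsRestrict (iInf_le _ _) (G j.down)
    let ι (j : ULift.{u} J) : (M j.down).restrict W.ι ⟶ (⨁ M).restrict W.ι :=
      (restrictFunctor W.ι).map (biproduct.ι M j.down)
    have hι (Z : W.toScheme.Modules) (f g : (⨁ M).restrict W.ι ⟶ Z)
        (h : ∀ j, ι j ≫ f = ι j ≫ g) : f = g := by
      rw [← cancel_epi ((restrictFunctor W.ι).mapBiproduct M).inv]
      refine biproduct.hom_ext' _ _ fun j => ?_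
      rw [Functor.mapBiproduct_inv, biproduct.ι_desc_assoc, biproduct.ι_desc_assoc]
      exact h ⟨j⟩
    have hx : x ∈ W := by
      rw [← SetLike.mem_coe, Opens.coe_iInf]
      exact Set.mem_iInter.mpr hxV
    refine ⟨W, hx, generatingSectionsOfJointlyEpi (R := W.toScheme.ringCatSheaf) ι hι G', ?_⟩
    have (j : ULift.{u} J) : Finite (G' j).I := hG j.down
    exact inferInstanceAs (Finite (Σ j, (G' j).I))
end GLOrder
end

/-! ### Sections m ⊗ s of the twist and its universal property -/

noncomputable section
namespace GLOrder
variable {X : Scheme.{u}} {L L' : X.IdealSheafData} {M N : X.Modules} {U V : X.Opens}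

/-- The presheaf tensor product of a sheaf of modules with `𝒪(-L)`, on sections. -/
abbrev preTw (L : X.IdealSheafData) (M : X.Modules) (U : X.Opens) : Type u :=
  (((toPre X).obj M).obj (op U)) ⊗[Γ(X, U)] ((invO L).obj (op U))

/-- The map from the presheaf tensor product to its sheafification. -/
def toTwist (L : X.IdealSheafData) (M : X.Modules) :
    (toPre X).obj M ⊗ invO L ⟶ (toPre X).obj ((twist L).obj M) :=
  (sheafifyAdj X).unit.app ((toPre X).obj M ⊗ invO L)

/-- The section `m ⊗ s` of `M ⊗ 𝒪(-L)`. -/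
def tw (m : Γ(M, U)) (s : idealSections L U) : Γ((twist L).obj M, U) :=
  (toTwist L M).app (op U) ((m ⊗ₜ s : preTw L M U))

lemma tw_add_left (m m' : Γ(M, U)) (s : idealSections L U) :
    tw (m + m') s = tw m s + tw m' s := by
  unfold tw
  refine Eq.trans ?_ (map_add ((toTwist L M).app (op U)).hom _ _)
  exact congrArg ((toTwist L M).app (op U)) (TensorProduct.add_tmul _ _ _)

lemma tw_add_right (m : Γ(M, U)) (s s' : idealSections L U) :
    tw m (s + s') = tw m s + tw m s' := by
  refine Eq.trans ?_ (map_add ((toTwist L M).app (op U)).hom _ _)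
  exact congrArg ((toTwist L M).app (op U)) (TensorProduct.tmul_add _ _ _)

lemma tw_smul_left (r : Γ(X, U)) (m : Γ(M, U)) (s : idealSections L U) :
    tw (r • m) s = r • tw m s := by
  refine Eq.trans ?_ (map_smul ((toTwist L M).app (op U)).hom r _)
  rfl

lemma tw_smul_right (r : Γ(X, U)) (m : Γ(M, U)) (s : idealSections L U) :
    tw m (r • s) = r • tw m s := by
  refine Eq.trans ?_ (map_smul ((toTwist L M).app (op U)).hom r _)
  exact congrArg ((toTwist L M).app (op U)) (TensorProduct.tmul_smul _ _ _)

/-- The restriction of sections of `𝒪(-L)`. -/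
def idealRes (h : V ≤ U) (s : idealSections L U) : idealSections L V :=
  ⟨X.presheaf.map (homOfLE h).op s, idealSections_map L (homOfLE h).op s.2⟩

lemma map_tw (h : V ≤ U) (m : Γ(M, U)) (s : idealSections L U) :
    ((twist L).obj M).presheaf.map (homOfLE h).op (tw m s) =
      tw (M.presheaf.map (homOfLE h).op m) (idealRes h s) :=
  (app_res (toTwist L M) (homOfLE h).op ((m ⊗ₜ s : preTw L M U))).symm

lemma tensor_hom_ext {P P' Q : PreMod X} {f g : P ⊗ P' ⟶ Q}
    (h : ∀ (U : X.Opens) (m : P.obj (op U)) (s : P'.obj (op U)),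
      f.app (op U) ((m ⊗ₜ s : P.obj (op U) ⊗[Γ(X, U)] P'.obj (op U))) =
        g.app (op U) ((m ⊗ₜ s : P.obj (op U) ⊗[Γ(X, U)] P'.obj (op U)))) : f = g := by
  ext U x
  refine TensorProduct.induction_on (R := Γ(X, U.unop)) (M := P.obj U)
    (N := P'.obj U) (motive := fun x => (f.app U).hom x = (g.app U).hom x) x ?_ ?_ ?_
  · exact (map_zero (f.app U).hom).trans (map_zero (g.app U).hom).symm
  · exact fun x y => h U.unop x y
  · intro x y hx hy
    exact (map_add (f.app U).hom x y).trans ((congrArg₂ (· + ·) hx hy).trans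
      (map_add (g.app U).hom x y).symm)

/-- The universal property of `M ⊗ 𝒪(-L)`. -/
def twistEquiv (L : X.IdealSheafData) (M N : X.Modules) :
    ((twist L).obj M ⟶ N) ≃ ((toPre X).obj M ⊗ invO L ⟶ (toPre X).obj N) :=
  (sheafifyAdj X).homEquiv _ _

lemma twistEquiv_apply (f : (twist L).obj M ⟶ N) :
    twistEquiv L M N f = toTwist L M ≫ (toPre X).map f :=
  (sheafifyAdj X).homEquiv_unit ..

lemma toTwist_comp_twistEquiv_symm (f : (toPre X).obj M ⊗ invO L ⟶ (toPre X).obj N) :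
    toTwist L M ≫ (toPre X).map ((twistEquiv L M N).symm f) = f := by
  rw [← twistEquiv_apply, Equiv.apply_symm_apply]

lemma twistEquiv_symm_app_tw (f : (toPre X).obj M ⊗ invO L ⟶ (toPre X).obj N) (m : Γ(M, U))
    (s : idealSections L U) :
    ((twistEquiv L M N).symm f).app U (tw m s) = f.app (op U) ((m ⊗ₜ s : preTw L M U)) :=
  congrArg (fun φ => φ.app (op U) ((m ⊗ₜ s : preTw L M U))) (toTwist_comp_twistEquiv_symm f)

/-- A section of the twist need not be a sum of sections m ⊗ s. The sheafification adjunction moves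
the comparison to the presheaf tensor product, where pure tensors generate. Identities between
morphisms out of a twist are proved later by this evaluation. -/
lemma twist_hom_ext {f g : (twist L).obj M ⟶ N}
    (h : ∀ (U : X.Opens) (m : Γ(M, U)) (s : idealSections L U),
      f.app U (tw m s) = g.app U (tw m s)) : f = g := by
  apply (twistEquiv L M N).injective
  rw [twistEquiv_apply, twistEquiv_apply]
  exact tensor_hom_ext h

lemma twist_map_tw (f : M ⟶ N) (m : Γ(M, U)) (s : idealSections L U) :
    ((twist L).map f).app U (tw m s) = tw (f.app U m) s := by
  have := (sheafifyAdj X).unit.naturality ((toPre X).map f ▷ invO L)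
  have h2 := congrArg (fun φ => φ.app (op U) ((m ⊗ₜ s : preTw L M U))) this
  exact h2.symm

lemma twistToId_tw (m : Γ(M, U)) (s : idealSections L U) :
    ((twistToId L).app M).app U (tw m s) = s.1 • m :=
  twistEquiv_symm_app_tw ((toPre X).obj M ◁ invOIncl L ≫ (ρ_ ((toPre X).obj M)).hom) m s

/-- A morphism of presheaves of modules, from compatible linear maps on sections. -/
def preHomMk {P Q : PreMod X} (φ : ∀ U : X.Opens, P.obj (op U) →ₗ[Γ(X, U)] Q.obj (op U))
    (nat : ∀ (U V : X.Opens) (h : V ≤ U) x, φ V (res P (homOfLE h).op x) =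
      res Q (homOfLE h).op (φ U x)) : P ⟶ Q where
  app U := ModuleCat.ofHom (φ U.unop)
  naturality {U V} f := by
    ext x
    exact nat U.unop V.unop f.unop.le x

/-- A natural family of bilinear maps `M(U) × 𝒪(-L)(U) → N(U)`. -/
structure TwistBilin (L : X.IdealSheafData) (M N : X.Modules) where
  /-- the bilinear maps -/
  map (U : X.Opens) : Γ(M, U) → idealSections L U → Γ(N, U)
  add_left (U : X.Opens) (m m' : Γ(M, U)) (s : idealSections L U) :
    map U (m + m') s = map U m s + map U m' s
  add_right (U : X.Opens) (m : Γ(M, U)) (s s' : idealSections L U) :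
    map U m (s + s') = map U m s + map U m s'
  smul_left (U : X.Opens) (r : Γ(X, U)) (m : Γ(M, U)) (s : idealSections L U) :
    map U (r • m) s = r • map U m s
  smul_right (U : X.Opens) (r : Γ(X, U)) (m : Γ(M, U)) (s : idealSections L U) :
    map U m (r • s) = r • map U m s
  nat (U V : X.Opens) (h : V ≤ U) (m : Γ(M, U)) (s : idealSections L U) :
    N.presheaf.map (homOfLE h).op (map U m s) =
      map V (M.presheaf.map (homOfLE h).op m) (idealRes h s)

/-- The linear maps on presheaf tensor products induced by a natural family of bilinear maps. -/
def TwistBilin.lin (β : TwistBilin L M N) (U : X.Opens) :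
    preTw L M U →ₗ[Γ(X, U)] ((toPre X).obj N).obj (op U) :=
  TensorProduct.lift (P₂ := ((toPre X).obj N).obj (op U))
    (LinearMap.mk₂ Γ(X, U) (M := ((toPre X).obj M).obj (op U)) (Nₗ := (invO L).obj (op U))
      (Pₗ := ((toPre X).obj N).obj (op U)) (β.map U)
      (β.add_left U) (β.smul_left U) (β.add_right U) (β.smul_right U))

/-- A morphism from the presheaf tensor product from a natural family of bilinear maps. -/
def TwistBilin.preLift (β : TwistBilin L M N) : (toPre X).obj M ⊗ invO L ⟶ (toPre X).obj N :=
  preHomMk (P := (toPre X).obj M ⊗ invO L) β.lin fun U V h x => by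
    refine TensorProduct.induction_on (R := Γ(X, U)) (M := ((toPre X).obj M).obj (op U))
      (N := (invO L).obj (op U)) (motive := fun x => β.lin V
        (res ((toPre X).obj M ⊗ invO L) (homOfLE h).op x) =
        res ((toPre X).obj N) (homOfLE h).op (β.lin U x)) x ?_ ?_ ?_
    · refine (congrArg (β.lin V) (map_zero (res ((toPre X).obj M ⊗ invO L) (homOfLE h).op))).trans ?_
      rw [map_zero]
      exact (map_zero (β.lin V)).trans (map_zero (res ((toPre X).obj N) (homOfLE h).op)).symm
    · exact fun m s => (β.nat U V h m s).symm
    · intro x y hx hy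
      refine (congrArg (β.lin V) (map_add (res ((toPre X).obj M ⊗ invO L) (homOfLE h).op)
        x y)).trans ?_
      refine (map_add (β.lin V) _ _).trans ?_
      rw [map_add]
      exact (congrArg₂ (· + ·) hx hy).trans
        (map_add (res ((toPre X).obj N) (homOfLE h).op) _ _).symm

/-- A morphism out of `M ⊗ 𝒪(-L)` from a natural family of bilinear maps. -/
def TwistBilin.lift (β : TwistBilin L M N) : (twist L).obj M ⟶ N :=
  (twistEquiv L M N).symm β.preLift

lemma TwistBilin.lift_tw (β : TwistBilin L M N) (m : Γ(M, U)) (s : idealSections L U) :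
    β.lift.app U (tw m s) = β.map U m s :=
  twistEquiv_symm_app_tw β.preLift m s

/-- The section `(m ⊗ s) ⊗ t` of the sheafification of the twofold presheaf tensor product. -/
def tw₂ (m : Γ(M, U)) (s : idealSections L U) (t : idealSections L' U) :
    Γ((sheafify X).obj (((toPre X).obj M ⊗ invO L) ⊗ invO L'), U) :=
  ((sheafifyAdj X).unit.app (((toPre X).obj M ⊗ invO L) ⊗ invO L')).app (op U)
    (((m ⊗ₜ s : preTw L M U) ⊗ₜ t :
      (((toPre X).obj M ⊗ invO L).obj (op U)) ⊗[Γ(X, U)] ((invO L').obj (op U))))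

lemma twistTwist_hom_app_tw₂ (m : Γ(M, U)) (s : idealSections L U) (t : idealSections L' U) :
    Scheme.Modules.Hom.app ((twistTwist L L').hom.app M) U (tw₂ m s t) = tw (tw m s) t := by
  have := (sheafifyAdj X).unit.naturality (toTwist L M ▷ invO L')
  have h2 := congrArg (fun φ => φ.app (op U) (((m ⊗ₜ s : preTw L M U) ⊗ₜ t :
          (((toPre X).obj M ⊗ invO L).obj (op U)) ⊗[Γ(X, U)] ((invO L').obj (op U))))) this
  exact h2.symm

lemma tensor_tensor_hom_ext {P P' P'' Q : PreMod X} {f g : (P ⊗ P') ⊗ P'' ⟶ Q}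
    (h : ∀ (U : X.Opens) (m : P.obj (op U)) (s : P'.obj (op U)) (t : P''.obj (op U)),
      f.app (op U) ((m ⊗ₜ s : P.obj (op U) ⊗[Γ(X, U)] P'.obj (op U)) ⊗ₜ t :
          ((P ⊗ P').obj (op U)) ⊗[Γ(X, U)] (P''.obj (op U))) =
        g.app (op U) ((m ⊗ₜ s : P.obj (op U) ⊗[Γ(X, U)] P'.obj (op U)) ⊗ₜ t :
          ((P ⊗ P').obj (op U)) ⊗[Γ(X, U)] (P''.obj (op U)))) : f = g := by
  refine tensor_hom_ext fun U x t => ?_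
  let φ (f : (P ⊗ P') ⊗ P'' ⟶ Q) :
      (P.obj (op U) ⊗[Γ(X, U)] P'.obj (op U)) →ₗ[Γ(X, U)] Q.obj (op U) :=
    (f.app (op U)).hom ∘ₗ (TensorProduct.mk Γ(X, U) ((P ⊗ P').obj (op U)) (P''.obj (op U))).flip t
  have : φ f = φ g := TensorProduct.ext' fun m s => h U m s t
  exact LinearMap.congr_fun this x

lemma tw₂_hom_ext {f g : (sheafify X).obj (((toPre X).obj M ⊗ invO L) ⊗ invO L') ⟶ N}
    (h : ∀ (U : X.Opens) (m : Γ(M, U)) (s : idealSections L U) (t : idealSections L' U),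
      f.app U (tw₂ m s t) = g.app U (tw₂ m s t)) : f = g := by
  apply ((sheafifyAdj X).homEquiv (((toPre X).obj M ⊗ invO L) ⊗ invO L') N).injective
  rw [Adjunction.homEquiv_unit, Adjunction.homEquiv_unit]
  exact tensor_tensor_hom_ext h

/-- The inner twist is already a sheafification, so one application of `twist_hom_ext` would leave
arbitrary sections of it. Precomposing with the isomorphism `twistTwist` leads to the sheafification
of a threefold presheaf tensor product, which is generated by (m ⊗ s) ⊗ t. -/
lemma twist_twist_hom_ext {f g : (twist L').obj ((twist L).obj M) ⟶ N}
    (h : ∀ (U : X.Opens) (m : Γ(M, U)) (s : idealSections L U) (t : idealSections L' U),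
      f.app U (tw (tw m s) t) = g.app U (tw (tw m s) t)) : f = g := by
  have e : IsIso ((twistTwist L L').hom.app M) := inferInstance
  refine (@cancel_epi _ _ _ _ _ ((twistTwist L L').hom.app M)
    (@IsIso.epi_of_iso _ _ _ _ _ e) f g).mp ?_
  refine tw₂_hom_ext fun U m s t => ?_
  refine (congrArg (f.app U) (twistTwist_hom_app_tw₂ m s t)).trans ?_
  exact (h U m s t).trans (congrArg (g.app U) (twistTwist_hom_app_tw₂ m s t)).symm

/-- Through `twistTwist` on both sides the isomorphism becomes the sheafification of the presheaf
symmetry, and naturality of the unit evaluates that on pure tensors. -/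
lemma twistComm_tw (m : Γ(M, U)) (s : idealSections L U) (t : idealSections L' U) :
    Scheme.Modules.Hom.app ((twistComm L L').hom.app M) U (tw (tw m s) t) = tw (tw m t) s := by
  rw [← twistTwist_hom_app_tw₂, ← twistTwist_hom_app_tw₂]
  have h1 : (twistTwist L L').hom.app M ≫ (twistComm L L').hom.app M =
      (sheafify X).map ((tensorRightComm (invO L) (invO L')).hom.app ((toPre X).obj M)) ≫
        (twistTwist L' L).hom.app M := by
    simp [twistComm]
  have h2 := congrArg (fun φ => φ.app U (tw₂ m s t)) h1
  refine h2.trans (congrArg (Scheme.Modules.Hom.app ((twistTwist L' L).hom.app M) U) ?_)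
  have := (sheafifyAdj X).unit.naturality
    ((tensorRightComm (invO L) (invO L')).hom.app ((toPre X).obj M))
  have h3 := congrArg (fun φ => φ.app (op U) (((m ⊗ₜ s : preTw L M U) ⊗ₜ t :
          (((toPre X).obj M ⊗ invO L).obj (op U)) ⊗[Γ(X, U)] ((invO L').obj (op U))))) this
  exact h3.symm

end GLOrder
end

/-! ### Twisting by an effective Cartier divisor preserves coherence -/

noncomputable section
namespace GLOrder
variable {X : Scheme.{u}} {L L' : X.IdealSheafData} {M N : X.Modules} {U V W : X.Opens}

lemma map_map_le (h : V ≤ U) (h' : W ≤ V) (m : Γ(M, U)) :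
    M.presheaf.map (homOfLE h').op (M.presheaf.map (homOfLE h).op m) =
      M.presheaf.map (homOfLE (h'.trans h)).op m := by
  rw [← ConcreteCategory.comp_apply, ← Functor.map_comp]
  rfl

lemma section_ext {m m' : Γ(M, U)} (h : ∀ x ∈ U, ∃ (V : X.Opens) (hV : V ≤ U), x ∈ V ∧
    M.presheaf.map (homOfLE hV).op m = M.presheaf.map (homOfLE hV).op m') : m = m' := by
  refine TopCat.Presheaf.IsSheaf.section_ext M.isSheaf fun x hx => ?_
  obtain ⟨V, hV, hxV, e⟩ := h x hx
  exact ⟨V, hV, hxV, e⟩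

/-- Injectivity makes local preimages unique, so they agree on overlaps and glue. -/
lemma isIso_of_injective_of_locally_surjective (φ : M ⟶ N)
    (hinj : ∀ U, Function.Injective (φ.app U))
    (hsurj : ∀ (U : X.Opens) (t : Γ(N, U)) (x : X), x ∈ U → ∃ (V : X.Opens) (h : V ≤ U) (m : Γ(M, V)),
      x ∈ V ∧ φ.app V m = N.presheaf.map (homOfLE h).op t) : IsIso φ := by
  rw [Scheme.Modules.Hom.isIso_iff_isIso_app]
  intro U
  rw [ConcreteCategory.isIso_iff_bijective]
  refine ⟨hinj U, ?_⟩
  refine TopCat.Presheaf.app_surjective_of_injective_of_locally_surjective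
    (F := ⟨M.presheaf, M.isSheaf⟩) (G := ⟨N.presheaf, N.isSheaf⟩) ⟨φ.mapPresheaf⟩ U
    (fun x _ => TopCat.Presheaf.stalkFunctor_map_injective_of_app_injective hinj x) ?_
  intro t x hx
  obtain ⟨V, h, m, hxV, e⟩ := hsurj U t x hx
  exact ⟨V, hxV, homOfLE h, m, e⟩

/-- A section of `M ⊗ 𝒪(-L)` comes locally from the presheaf tensor product. -/
lemma exists_toTwist_eq (t : Γ((twist L).obj M, U)) {x : X} (hx : x ∈ U) :
    ∃ (V : X.Opens) (h : V ≤ U) (z : preTw L M V), x ∈ V ∧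
      (toTwist L M).app (op V) z = ((twist L).obj M).presheaf.map (homOfLE h).op t := by
  have := ((isIso_sheafify_map_iff (toTwist L M)).mp (isIso_map_unit _)).2
  obtain ⟨V, f, ⟨z, hz⟩, hxV⟩ := this.imageSieve_mem t x hx
  exact ⟨V, f.le, z, hxV, hz⟩

/-- An element of the presheaf tensor product that dies in `M ⊗ 𝒪(-L)` is locally zero. -/
lemma exists_res_eq_zero (z : preTw L M U)
    (hz : (toTwist L M).app (op U) z = (0 : Γ((twist L).obj M, U))) {x : X} (hx : x ∈ U) :
    ∃ (V : X.Opens) (h : V ≤ U), x ∈ V ∧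
      res ((toPre X).obj M ⊗ invO L) (homOfLE h).op z = 0 := by
  have := ((isIso_sheafify_map_iff (toTwist L M)).mp (isIso_map_unit _)).1
  obtain ⟨V, f, hf, hxV⟩ := this.equalizerSieve_mem (X := op U) z 0
    (hz.trans (map_zero ((toTwist L M).app (op U)).hom).symm) x hx
  refine ⟨V, f.le, hxV, ?_⟩
  exact (show res ((toPre X).obj M ⊗ invO L) f.op z = res ((toPre X).obj M ⊗ invO L) f.op 0 from
    hf).trans (map_zero _)

/-- Over `U` the ideal sheaf of `L` is freely generated by `g`. -/
def IsGenerator (g : idealSections L U) : Prop :=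
  ∀ (V : X.Opens) (h : V ≤ U), Function.Bijective
    (fun r : Γ(X, V) => r • idealRes h g)

lemma exists_basicOpen_le (hU : IsAffineOpen U) (h : V ≤ U) {x : X} (hx : x ∈ V) :
    ∃ f : Γ(X, U), X.basicOpen f ≤ V ∧ x ∈ X.basicOpen f := by
  exact hU.exists_basicOpen_le ⟨x, hx⟩ (h hx)

lemma ringRes_ringRes (h : V ≤ U) (h' : W ≤ V) (r : Γ(X, U)) :
    X.presheaf.map (homOfLE h').op (X.presheaf.map (homOfLE h).op r) =
      X.presheaf.map (homOfLE (h'.trans h)).op r := by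
  rw [← ConcreteCategory.comp_apply, ← Functor.map_comp]
  rfl

lemma idealRes_idealRes (h : V ≤ U) (h' : W ≤ V) (s : idealSections L U) :
    idealRes h' (idealRes h s) = idealRes (h'.trans h) s :=
  Subtype.ext (ringRes_ringRes h h' s.1)

/-- A local equation f is given on one affine open, but generation is needed over every smaller open
V, affine or not. Basic opens of U inside V suffice: there f stays a nonzerodivisor and generates
the ideal, and the resulting unique quotients s / f glue over V. -/
lemma exists_isGenerator (hL : IsEffectiveCartier L) (x : X) :
    ∃ (U : X.Opens) (g : idealSections L U), x ∈ U ∧ IsGenerator g := by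
  obtain ⟨U, hxU, f, hf, hLf⟩ := hL x
  have hLW (W : X.affineOpens) (h : W.1 ≤ U.1) :
      L.ideal W = Ideal.span {X.presheaf.map (homOfLE h).op f} := by
    rw [← L.map_ideal h, hLf, Ideal.map_span, Set.image_singleton]
    rfl
  let g : idealSections L U.1 := ⟨f, fun W h => hLW W h ▸ Ideal.mem_span_singleton_self _⟩
  -- Functions on a basic open are a localization of those on U, and localization preserves
  -- nonzerodivisors.
  have hreg (a : Γ(X, U.1)) (r : Γ(X, X.basicOpen a))
      (hr : r * X.presheaf.map (homOfLE (X.basicOpen_le a)).op f = 0) : r = 0 := by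
    have := U.2.isLocalization_basicOpen a
    have h := IsLocalization.map_nonZeroDivisors_le (Submonoid.powers a) Γ(X, X.basicOpen a)
      ⟨f, hf, rfl⟩
    exact h.2 _ hr
  have hinj (V : X.Opens) (h : V ≤ U.1) (r : Γ(X, V))
      (hr : r * X.presheaf.map (homOfLE h).op f = 0) : r = 0 := by
    refine TopCat.Presheaf.IsSheaf.section_ext X.sheaf.2 fun x hx => ?_
    obtain ⟨a, ha, hxa⟩ := exists_basicOpen_le U.2 h hx
    refine ⟨_, ha, hxa, ?_⟩
    refine (hreg a _ ?_).trans (map_zero (X.presheaf.map (homOfLE ha).op).hom).symm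
    have := congrArg (X.presheaf.map (homOfLE ha).op) hr
    rw [map_zero, map_mul, ringRes_ringRes] at this
    exact this
  have hinj' (V : X.Opens) (h : V ≤ U.1) (r r' : Γ(X, V))
      (hr : r * X.presheaf.map (homOfLE h).op f = r' * X.presheaf.map (homOfLE h).op f) :
      r = r' :=
    sub_eq_zero.mp (hinj V h _ (by rw [sub_mul, hr, sub_self]))
  refine ⟨U, g, hxU, fun V h => ⟨fun r r' e => hinj' V h r r' (congrArg Subtype.val e), ?_⟩⟩
  intro s
  have hloc (x : V) : ∃ (W : X.Opens) (hW : W ≤ V) (r : Γ(X, W)), x.1 ∈ W ∧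
      r * X.presheaf.map (homOfLE (hW.trans h)).op f = X.presheaf.map (homOfLE hW).op s.1 := by
    obtain ⟨a, ha, hxa⟩ := exists_basicOpen_le U.2 h x.2
    have := s.2 (X.affineBasicOpen a) ha
    rw [hLW _ (ha.trans h), Ideal.mem_span_singleton'] at this
    obtain ⟨r, hr⟩ := this
    exact ⟨_, ha, r, hxa, hr⟩
  choose W hW r hxW hr using hloc
  -- The local quotients agree on overlaps because their products with f do and f can be cancelled
  -- by `hinj'`.
  obtain ⟨t, ht, -⟩ := TopCat.Sheaf.existsUnique_gluing' X.sheaf W V (fun x => homOfLE (hW x))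
    (fun x hx => Opens.mem_iSup.mpr ⟨⟨x, hx⟩, hxW _⟩) r (fun x y => by
      refine hinj' _ (inf_le_left.trans ((hW x).trans h)) _ _ ?_
      have h1 := congrArg (X.presheaf.map (homOfLE (inf_le_left : W x ⊓ W y ≤ W x)).op) (hr x)
      have h2 := congrArg (X.presheaf.map (homOfLE (inf_le_right : W x ⊓ W y ≤ W y)).op) (hr y)
      rw [map_mul, ringRes_ringRes, ringRes_ringRes] at h1 h2
      exact h1.trans h2.symm)
  refine ⟨t, Subtype.ext ?_⟩
  refine TopCat.Presheaf.IsSheaf.section_ext X.sheaf.2 fun x hx => ?_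
  refine ⟨_, hW ⟨x, hx⟩, hxW _, ?_⟩
  refine Eq.trans ?_ (hr ⟨x, hx⟩)
  refine (map_mul (X.presheaf.map (homOfLE (hW ⟨x, hx⟩)).op).hom _ _).trans ?_
  exact congrArg₂ (· * ·) (ht ⟨x, hx⟩) (ringRes_ringRes h (hW ⟨x, hx⟩) f)

lemma exists_tmul_eq {g : idealSections L U} (hg : IsGenerator g) (h : V ≤ U) (z : preTw L M V) :
    ∃ m : Γ(M, V), z = (m ⊗ₜ idealRes h g : preTw L M V) := by
  refine TensorProduct.induction_on (R := Γ(X, V)) (M := ((toPre X).obj M).obj (op V))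
    (N := (invO L).obj (op V)) (motive := fun z => ∃ m : Γ(M, V),
      z = (m ⊗ₜ idealRes h g : preTw L M V)) z ?_ ?_ ?_
  · exact ⟨0, (TensorProduct.zero_tmul _ _).symm⟩
  · intro m s
    obtain ⟨r, rfl⟩ := (hg V h).2 s
    exact ⟨r • m, (TensorProduct.smul_tmul (R := Γ(X, V)) (R' := Γ(X, V)) r
      (m : ((toPre X).obj M).obj (op V)) (idealRes h g : (invO L).obj (op V))).symm⟩
  · rintro _ _ ⟨m, rfl⟩ ⟨m', rfl⟩
    exact ⟨m + m', (TensorProduct.add_tmul (R := Γ(X, V)) (m : ((toPre X).obj M).obj (op V)) m'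
      (idealRes h g : (invO L).obj (op V))).symm⟩

/-- Since g is a basis of I, there is an isomorphism M ⊗ I ≅ M ⊗ R ≅ M that sends m ⊗ g to m. -/
lemma eq_zero_of_tmul_eq_zero {R M I : Type*} [CommRing R] [AddCommGroup M] [Module R M]
    [AddCommGroup I] [Module R I] {g : I} (hg : Function.Bijective fun r : R => r • g) {m : M}
    (hm : m ⊗ₜ[R] g = 0) : m = 0 := by
  let e := LinearEquiv.ofBijective (LinearMap.toSpanSingleton R I g) hg
  have he : e.symm g = 1 := by rw [LinearEquiv.symm_apply_eq]; exact (one_smul R g).symm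
  simpa [he] using congrArg (TensorProduct.rid R M ∘ e.symm.toLinearMap.lTensor M) hm

/-- By additivity it suffices to treat a section m with m ⊗ g = 0 in the sheafification. Then the
tensor vanishes locally already in the presheaf, where g is a basis, so m vanishes locally. -/
lemma tw_injective {g : idealSections L U} (hg : IsGenerator g) (h : V ≤ U) {m m' : Γ(M, V)}
    (e : tw m (idealRes h g) = tw m' (idealRes h g)) : m = m' := by
  have key (m : Γ(M, V)) (e : tw m (idealRes h g) = 0) : m = 0 := by
    refine section_ext fun x hx => ?_
    obtain ⟨W, hW, hxW, hz⟩ := exists_res_eq_zero _ e hx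
    refine ⟨W, hW, hxW, ?_⟩
    rw [map_zero]
    refine eq_zero_of_tmul_eq_zero (R := Γ(X, W)) (M := ((toPre X).obj M).obj (op W))
      (I := (invO L).obj (op W)) (hg W (hW.trans h)) ?_
    refine Eq.trans ?_ hz
    exact congrArg (fun s => (M.presheaf.map (homOfLE hW).op m ⊗ₜ s : preTw L M W))
      (idealRes_idealRes h hW g).symm
  refine sub_eq_zero.mp (key _ ?_)
  rw [sub_eq_add_neg, tw_add_left, e, ← tw_add_left, add_neg_cancel]
  simpa using tw_smul_left 0 (0 : Γ(M, V)) (idealRes h g)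

lemma exists_tw_eq {g : idealSections L U} (hg : IsGenerator g) (h : V ≤ U)
    (t : Γ((twist L).obj M, V)) {x : X} (hx : x ∈ V) :
    ∃ (W : X.Opens) (hW : W ≤ V) (m : Γ(M, W)), x ∈ W ∧
      tw m (idealRes (hW.trans h) g) = ((twist L).obj M).presheaf.map (homOfLE hW).op t := by
  obtain ⟨W, hW, z, hxW, e⟩ := exists_toTwist_eq t hx
  obtain ⟨m, rfl⟩ := exists_tmul_eq hg (hW.trans h) z
  exact ⟨W, hW, m, hxW, e⟩

/-- Multiplication by a local generator of `𝒪(-L)`. -/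
def mulGenerator (M : X.Modules) (g : idealSections L U) :
    M.restrict U.ι ⟶ ((twist L).obj M).restrict U.ι where
  val :=
    { app W := ModuleCat.ofHom (X := (M.restrict U.ι).val.obj W)
        (Y := (((twist L).obj M).restrict U.ι).val.obj W)
        { toFun m := tw (M := M) (U := U.ι ''ᵁ W.unop) m (idealRes (U.ι_image_le W.unop) g)
          map_add' m m' := tw_add_left _ _ _
          map_smul' r m := tw_smul_left _ _ _ }
      naturality f := by
        ext m
        refine Eq.trans ?_ (map_tw (M := M) (U.ι.opensFunctor.map f.unop).le m
          (idealRes (U.ι_image_le _) g)).symm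
        exact congrArg (tw (M.presheaf.map (U.ι.opensFunctor.map f.unop).op m))
          (idealRes_idealRes (U.ι_image_le _) (U.ι.opensFunctor.map f.unop).le g).symm }

/-- Near each point m ↦ m ⊗ g, with g a local generator of the ideal sheaf, identifies M with its
twist, and coherence is local. This is where the divisors have to be Cartier. -/
lemma isCoherent_twist (hL : IsEffectiveCartier L) (hM : IsCoherent M) :
    IsCoherent ((twist L).obj M) := by
  refine isCoherent_of_locally_iso hM fun x => ?_
  obtain ⟨U, g, hxU, hg⟩ := exists_isGenerator hL x
  have : IsIso (mulGenerator M g) := by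
    refine isIso_of_injective_of_locally_surjective _ (fun W m m' e => ?_) ?_
    · exact tw_injective hg _ e
    · intro W t y hy
      obtain ⟨W', hW', m, hyW', e⟩ := exists_tw_eq (V := U.ι ''ᵁ W) hg (U.ι_image_le W) t
        (x := U.ι y) ⟨y, hy, rfl⟩
      -- W' is an open subset of X, while local surjectivity is tested on opens of the scheme U. The
      -- section is therefore restricted to the image of the preimage of W'.
      have hV : U.ι ⁻¹ᵁ W' ≤ W := fun z hz => U.mem_ι_image_iff.mp (hW' hz)
      have hV' : U.ι ''ᵁ (U.ι ⁻¹ᵁ W') ≤ W' := U.ι.image_preimage_le W'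
      refine ⟨U.ι ⁻¹ᵁ W', hV, M.presheaf.map (homOfLE hV').op m, hyW', ?_⟩
      have h1 := congrArg (((twist L).obj M).presheaf.map (homOfLE hV').op) e
      refine Eq.trans ?_ (h1.trans (map_map_le hW' hV' t))
      refine Eq.trans ?_ (map_tw hV' m _).symm
      exact congrArg (tw _) (idealRes_idealRes _ _ _).symm
  exact ⟨U, hxU, ⟨asIso (mulGenerator M g)⟩⟩

end GLOrder
end

/-! ### Generators and relations for the algebra T_p(R, I) -/

noncomputable section
namespace GLOrder

section Triangular
variable {R : Type u} [CommRing R] {p : ℕ} {I : Ideal R}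

/-- The matrix of `T_p(R, I)` with the single entry `s` in row `b` and column `a`. -/
def triSingle (I : Ideal R) (b a : Fin p) (s : R) (h : b < a → s ∈ I) : triangular p I :=
  ⟨Matrix.single b a s, fun x y hxy => by
    rw [Matrix.single_apply]
    split_ifs with e
    · exact h (by rwa [e.1, e.2])
    · exact zero_mem _⟩

lemma triSingle_mul (c b a : Fin p) (t s : R) (h h') :
    triSingle I c b t h * triSingle I b a s h' = triSingle I c a (t * s) (fun hca => by
      by_cases hcb : c < b
      · exact I.mul_mem_right _ (h hcb)
      · exact I.mul_mem_left _ (h' (lt_of_le_of_lt (not_lt.mp hcb) hca))) :=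
  Subtype.ext (Matrix.single_mul_single_same _ _ _ _ _)

lemma triSingle_mul_of_ne (c b b' a : Fin p) (t s : R) (h h') (hb : b ≠ b') :
    triSingle I c b t h * triSingle I b' a s h' = 0 :=
  Subtype.ext (Matrix.single_mul_single_of_ne _ _ _ _ hb _)

lemma triSingle_add (b a : Fin p) (t s : R) (h h') :
    triSingle I b a (t + s) (fun hba => I.add_mem (h hba) (h' hba)) =
      triSingle I b a t h + triSingle I b a s h' :=
  Subtype.ext (Matrix.single_add _ _ _ _)

lemma smul_triSingle (b a : Fin p) (t s : R) (h) :
    t • triSingle I b a s h = triSingle I b a (t * s) (fun hba => I.mul_mem_left _ (h hba)) :=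
  Subtype.ext (Matrix.smul_single _ _ _ _)

lemma one_eq_sum_triSingle :
    (1 : triangular p I) = ∑ a, triSingle I a a 1 (fun h => absurd h (lt_irrefl a)) := by
  apply Subtype.ext
  rw [AddSubmonoidClass.coe_finsetSum]
  exact Matrix.sum_single_one.symm

lemma eq_sum_triSingle (m : triangular p I) :
    m = ∑ b, ∑ a, triSingle I b a (m.1 b a) (m.2 b a) := by
  apply Subtype.ext
  simp only [AddSubmonoidClass.coe_finsetSum]
  exact Matrix.matrix_eq_sum_single _

/-- A subring of `T_p(R, I)` that contains the scalars, the idempotents, the matrix units just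
below the diagonal and the entries in the upper right corner is everything. -/
lemma triangular_subring_eq_top (S : Subring (triangular p I))
    (h0 : ∀ r, algebraMap R _ r ∈ S)
    (h1 : ∀ a, triSingle I a a 1 (fun h => absurd h (lt_irrefl a)) ∈ S)
    (h2 : ∀ (a b : Fin p) (h : (b : ℕ) = a + 1),
      triSingle I b a 1 (fun h' => absurd h' (by rw [Fin.lt_def]; omega)) ∈ S)
    (h3 : ∀ (a b : Fin p) (s : R) (hs : s ∈ I), (a : ℕ) + 1 = p → (b : ℕ) = 0 →
      triSingle I b a s (fun _ => hs) ∈ S) : S = ⊤ := by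
  -- A matrix unit k places below the diagonal is a product of k units just below it.
  have h4 (k : ℕ) : ∀ (a b : Fin p) (h : (b : ℕ) = a + k),
      triSingle I b a 1 (fun h' => absurd h' (by rw [Fin.lt_def]; omega)) ∈ S := by
    induction k with
    | zero =>
      intro a b h
      obtain rfl : b = a := Fin.ext h
      exact h1 b
    | succ k ih =>
      intro a b h
      let c : Fin p := ⟨a + k, by omega⟩
      have := S.mul_mem (h2 c b h) (ih a c rfl)
      rw [triSingle_mul] at this
      simpa using this
  rw [eq_top_iff]
  intro m _
  rw [eq_sum_triSingle m]
  refine S.sum_mem fun b _ => S.sum_mem fun a _ => ?_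
  by_cases hba : b < a
  · have hs := m.2 b a hba
    let z : Fin p := ⟨0, b.pos⟩
    let l : Fin p := ⟨p - 1, by have := b.pos; omega⟩
    -- An entry s above the diagonal factors through the corner: row b from row 0, then s from the
    -- last column to row 0, then the last row from column a.
    have := S.mul_mem (S.mul_mem (h4 b z b (by simp [z])) (h3 l z _ hs (by
      have := b.pos; simp only [l]; omega) rfl)) (h4 (p - 1 - a) a l (by simp only [l]; omega))
    rw [triSingle_mul, triSingle_mul] at this
    simpa using this
  · have := S.mul_mem (h0 (m.1 b a)) (h4 (b - a) a b (by rw [Fin.lt_def] at hba; omega))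
    rw [← Algebra.smul_def, smul_triSingle] at this
    simpa using this
end Triangular

section TriRel
variable {R : Type u} [CommRing R]

/-- Operators that satisfy the relations of the generators of `T_p(R, I)`: the idempotents, the
sum of the matrix units just below the diagonal and the entries in the upper right corner. -/
structure TriRel (p : ℕ) (I : Ideal R) (B : Type v) [Ring B] [Algebra R B] where
  /-- the idempotents -/
  P : Fin p → B
  /-- the sum of the matrix units just below the diagonal -/
  X : B
  /-- the entries in the upper right corner -/
  W : I →ₗ[R] B
  P_mul_self (a : Fin p) : P a * P a = P a
  P_mul_ne (a b : Fin p) : a ≠ b → P a * P b = 0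
  sum_P : ∑ a, P a = 1
  X_mul_P (a b : Fin p) : (b : ℕ) = a + 1 → X * P a = P b * X
  P_mul_W (a : Fin p) (s : I) : (a : ℕ) ≠ 0 → P a * W s = 0
  W_mul_P (a : Fin p) (s : I) : (a : ℕ) + 1 ≠ p → W s * P a = 0
  cycle (a : Fin p) (s : I) : X ^ (a : ℕ) * W s * X ^ (p - 1 - a) * P a = s.1 • P a

namespace TriRel
variable {p : ℕ} {I : Ideal R} {B : Type v} [Ring B] [Algebra R B] (D : TriRel p I B)

lemma pow_mul_P (k : ℕ) (a b : Fin p) (h : (b : ℕ) = a + k) :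
    D.X ^ k * D.P a = D.P b * D.X ^ k := by
  induction k generalizing b with
  | zero => obtain rfl : b = a := Fin.ext h; simp
  | succ k ih =>
    let c : Fin p := ⟨a + k, by omega⟩
    rw [pow_succ', mul_assoc, ih c rfl, ← mul_assoc, D.X_mul_P c b h, mul_assoc]

lemma P_mul_W_zero (z : Fin p) (hz : (z : ℕ) = 0) (s : I) : D.P z * D.W s = D.W s := by
  conv_rhs => rw [← one_mul (D.W s), ← D.sum_P, Finset.sum_mul]
  rw [Finset.sum_eq_single z]
  · intro a _ ha
    exact D.P_mul_W a s fun h => ha (Fin.ext (h.trans hz.symm))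
  · simp

lemma W_mul_P_last (l : Fin p) (hl : (l : ℕ) + 1 = p) (s : I) : D.W s * D.P l = D.W s := by
  conv_rhs => rw [← mul_one (D.W s), ← D.sum_P, Finset.mul_sum]
  rw [Finset.sum_eq_single l]
  · intro a _ ha
    exact D.W_mul_P a s fun h => ha (Fin.ext (by omega))
  · simp

open Classical in
/-- The image of a matrix with a single entry. -/
def T (b a : Fin p) (s : R) : B :=
  if b < a then (if h : s ∈ I then D.X ^ (b : ℕ) * D.W ⟨s, h⟩ * D.X ^ (p - 1 - a) * D.P a else 0)
    else s • (D.X ^ ((b : ℕ) - a) * D.P a)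

lemma T_of_lt (b a : Fin p) (s : R) (hba : b < a) (h : s ∈ I) :
    D.T b a s = D.X ^ (b : ℕ) * D.W ⟨s, h⟩ * D.X ^ (p - 1 - a) * D.P a := by
  rw [T, if_pos hba, dif_pos h]

lemma T_of_le (b a : Fin p) (s : R) (hba : a ≤ b) :
    D.T b a s = s • (D.X ^ ((b : ℕ) - a) * D.P a) := by
  rw [T, if_neg (not_lt.mpr hba)]

/-- On or below the diagonal the path through the corner contains a full turn, which the cycle
relation replaces by the scalar s. Hence an entry in I may be written in the corner form at every
position, which spares case distinctions for products. -/
lemma T_of_mem (b a : Fin p) (s : R) (h : s ∈ I) :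
    D.X ^ (b : ℕ) * D.W ⟨s, h⟩ * D.X ^ (p - 1 - a) * D.P a = D.T b a s := by
  by_cases hba : b < a
  · rw [D.T_of_lt b a s hba h]
  · rw [D.T_of_le b a s (not_lt.mp hba)]
    obtain ⟨k, hk⟩ : ∃ k, (b : ℕ) = k + a := ⟨b - a, by rw [Fin.lt_def] at hba; omega⟩
    have := D.cycle a ⟨s, h⟩
    rw [hk, pow_add, mul_assoc, mul_assoc, mul_assoc (D.X ^ k)]
    simp only [mul_assoc] at this
    rw [this, mul_smul_comm]
    simp

lemma T_add (b a : Fin p) (s t : R) (hs : b < a → s ∈ I) (ht : b < a → t ∈ I) :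
    D.T b a (s + t) = D.T b a s + D.T b a t := by
  by_cases hba : b < a
  · rw [D.T_of_lt b a _ hba (I.add_mem (hs hba) (ht hba)), D.T_of_lt b a _ hba (hs hba),
      D.T_of_lt b a _ hba (ht hba), ← add_mul, ← add_mul, ← mul_add, ← map_add]
    rfl
  · simp only [D.T_of_le b a _ (not_lt.mp hba), add_smul]

lemma T_smul (b a : Fin p) (r s : R) (hs : b < a → s ∈ I) :
    D.T b a (r * s) = r • D.T b a s := by
  by_cases hba : b < a
  · rw [D.T_of_lt b a _ hba (I.mul_mem_left r (hs hba)), D.T_of_lt b a _ hba (hs hba),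
      ← smul_mul_assoc, ← smul_mul_assoc, ← mul_smul_comm, ← map_smul]
    rfl
  · simp only [D.T_of_le b a _ (not_lt.mp hba), mul_smul]

lemma P_mul_T (b a : Fin p) (s : R) : D.P b * D.T b a s = D.T b a s := by
  by_cases hba : b < a
  · by_cases h : s ∈ I
    · let z : Fin p := ⟨0, b.pos⟩
      rw [D.T_of_lt b a s hba h, ← D.P_mul_W_zero z rfl]
      have := D.pow_mul_P b z b (by simp [z])
      simp only [← mul_assoc]
      rw [← this, mul_assoc _ (D.P z) (D.P z), D.P_mul_self]
    · rw [T, if_pos hba, dif_neg h, mul_zero]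
  · rw [D.T_of_le b a _ (not_lt.mp hba), mul_smul_comm, ← mul_assoc,
      ← D.pow_mul_P (b - a) a b (by rw [Fin.lt_def] at hba; omega), mul_assoc, D.P_mul_self]

lemma T_mul_P (b a : Fin p) (s : R) : D.T b a s * D.P a = D.T b a s := by
  unfold T
  split_ifs
  · rw [mul_assoc, D.P_mul_self]
  · rw [zero_mul]
  · rw [smul_mul_assoc, mul_assoc, D.P_mul_self]

lemma T_mul_T_of_ne (c b b' a : Fin p) (t s : R) (h : b ≠ b') : D.T c b t * D.T b' a s = 0 := by
  rw [← D.T_mul_P, ← D.P_mul_T b', mul_assoc, ← mul_assoc (D.P b), D.P_mul_ne b b' h, zero_mul,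
    mul_zero]

/-- The cases depend on whether each factor lies above the diagonal. With at most one such factor,
it is enough to combine powers of X and move a scalar. With two, the inner part contains a full turn
and collapses by the cycle relation. -/
lemma T_mul_T (c b a : Fin p) (t s : R) (ht : c < b → t ∈ I) (hs : b < a → s ∈ I) :
    D.T c b t * D.T b a s = D.T c a (t * s) := by
  let z : Fin p := ⟨0, b.pos⟩
  let l : Fin p := ⟨p - 1, by have := b.pos; omega⟩
  have hl : (l : ℕ) + 1 = p := by have := b.pos; simp only [l]; omega
  by_cases hcb : c < b
  · rw [D.T_of_lt c b t hcb (ht hcb), mul_assoc _ (D.P b), D.P_mul_T]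
    have ht' := I.mul_mem_right s (ht hcb)
    rw [← D.T_of_mem c a _ ht']
    have e : D.W ⟨t * s, ht'⟩ = s • D.W ⟨t, ht hcb⟩ := by
      rw [← map_smul]; congr 1; exact Subtype.ext (mul_comm _ _)
    by_cases hba : b < a
    · have h1 := D.cycle l ⟨s, hs hba⟩
      rw [show p - 1 - (l : ℕ) = 0 from by simp [l], pow_zero, mul_one, mul_assoc,
        D.W_mul_P_last l hl] at h1
      rw [D.T_of_lt b a s hba (hs hba), e]
      have h2 : D.X ^ (p - 1 - (b : ℕ)) * D.X ^ (b : ℕ) = D.X ^ (l : ℕ) := by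
        rw [← pow_add]; congr 1; simp only [l]; omega
      calc _ = D.X ^ (c : ℕ) * D.W ⟨t, ht hcb⟩ * ((D.X ^ (p - 1 - (b : ℕ)) * D.X ^ (b : ℕ)) *
              D.W ⟨s, hs hba⟩) * D.X ^ (p - 1 - (a : ℕ)) * D.P a := by simp only [mul_assoc]
        _ = D.X ^ (c : ℕ) * (D.W ⟨t, ht hcb⟩ * (s • D.P l)) * D.X ^ (p - 1 - (a : ℕ)) * D.P a := by
            rw [h2, h1, mul_assoc (D.X ^ (c : ℕ))]
        _ = _ := by rw [mul_smul_comm, D.W_mul_P_last l hl]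
    · rw [D.T_of_le b a s (not_lt.mp hba), e]
      have h2 : D.X ^ (p - 1 - (b : ℕ)) * D.X ^ ((b : ℕ) - a) = D.X ^ (p - 1 - (a : ℕ)) := by
        rw [← pow_add]; congr 1; rw [Fin.lt_def] at hba; omega
      rw [← h2]
      simp only [mul_smul_comm, smul_mul_assoc, mul_assoc]
  · rw [D.T_of_le c b t (not_lt.mp hcb), smul_mul_assoc, mul_assoc, D.P_mul_T]
    by_cases hba : b < a
    · rw [← D.T_of_mem c a _ (I.mul_mem_left t (hs hba)), D.T_of_lt b a s hba (hs hba)]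
      have e : D.W ⟨t * s, I.mul_mem_left t (hs hba)⟩ = t • D.W ⟨s, hs hba⟩ := by
        rw [← map_smul]; rfl
      have h2 : D.X ^ (c : ℕ) = D.X ^ ((c : ℕ) - b) * D.X ^ (b : ℕ) := by
        rw [← pow_add]; congr 1; rw [Fin.lt_def] at hcb; omega
      rw [e, h2]
      simp only [mul_smul_comm, smul_mul_assoc, mul_assoc]
    · rw [D.T_of_le b a s (not_lt.mp hba), D.T_of_le c a _ ((not_lt.mp hba).trans (not_lt.mp hcb))]
      have h2 : D.X ^ ((c : ℕ) - a) = D.X ^ ((c : ℕ) - b) * D.X ^ ((b : ℕ) - a) := by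
        rw [← pow_add]; congr 1; rw [Fin.lt_def] at hcb hba; omega
      rw [h2, mul_smul_comm, smul_smul, mul_assoc]

lemma T_zero (b a : Fin p) : D.T b a 0 = 0 := by
  have := D.T_smul b a 0 0 fun _ => I.zero_mem
  rwa [zero_smul, mul_zero] at this

/-- The linear map from `T_p(R, I)` determined by the images of the generators. -/
def lin : triangular p I →ₗ[R] B where
  toFun m := ∑ b, ∑ a, D.T b a (m.1 b a)
  map_add' m m' := by
    simp only [← Finset.sum_add_distrib]
    exact Finset.sum_congr rfl fun b _ => Finset.sum_congr rfl fun a _ =>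
      D.T_add b a _ _ (m.2 b a) (m'.2 b a)
  map_smul' r m := by
    simp only [RingHom.id_apply, Finset.smul_sum]
    exact Finset.sum_congr rfl fun b _ => Finset.sum_congr rfl fun a _ =>
      D.T_smul b a r _ (m.2 b a)

lemma lin_triSingle (b a : Fin p) (s : R) (h : b < a → s ∈ I) :
    D.lin (triSingle I b a s h) = D.T b a s := by
  change ∑ b', ∑ a', D.T b' a' (Matrix.single b a s b' a') = _
  rw [Finset.sum_eq_single b, Finset.sum_eq_single a, Matrix.single_apply_same]
  · intro a' _ ha'
    rw [Matrix.single_apply_of_ne _ _ _ _ _ (fun e => ha' e.2.symm), T_zero]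
  · simp
  · intro b' _ hb'
    refine Finset.sum_eq_zero fun a' _ => ?_
    rw [Matrix.single_apply_of_ne _ _ _ _ _ (fun e => hb' e.1.symm), T_zero]
  · simp

/-- The algebra homomorphism from `T_p(R, I)` determined by the images of the generators. -/
def hom : triangular p I →ₐ[R] B :=
  AlgHom.ofLinearMap D.lin
    (by
      rw [one_eq_sum_triSingle, map_sum, ← D.sum_P]
      refine Finset.sum_congr rfl fun a _ => ?_
      rw [lin_triSingle, D.T_of_le a a 1 le_rfl]
      simp)
    (fun m m' => by
      calc D.lin (m * m') = D.lin ((∑ c, ∑ b, triSingle I c b (m.1 c b) (m.2 c b)) *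
            (∑ b, ∑ a, triSingle I b a (m'.1 b a) (m'.2 b a))) := by
            rw [← eq_sum_triSingle, ← eq_sum_triSingle]
        _ = D.lin (∑ c, ∑ b, triSingle I c b (m.1 c b) (m.2 c b)) *
            D.lin (∑ b, ∑ a, triSingle I b a (m'.1 b a) (m'.2 b a)) := by
            simp only [Finset.sum_mul, map_sum]
            simp only [Finset.mul_sum, map_sum]
            refine Finset.sum_congr rfl fun c _ => Finset.sum_congr rfl fun b _ =>
              Finset.sum_congr rfl fun b' _ => Finset.sum_congr rfl fun a _ => ?_
            by_cases hb : b = b'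
            · subst hb
              rw [triSingle_mul, lin_triSingle, lin_triSingle, lin_triSingle,
                D.T_mul_T _ _ _ _ _ (m.2 c b) (m'.2 b a)]
            · rw [triSingle_mul_of_ne _ _ _ _ _ _ _ _ hb, lin_triSingle, lin_triSingle,
                D.T_mul_T_of_ne _ _ _ _ _ _ hb, map_zero]
        _ = D.lin m * D.lin m' := by rw [← eq_sum_triSingle, ← eq_sum_triSingle])

lemma hom_triSingle (b a : Fin p) (s : R) (h : b < a → s ∈ I) :
    D.hom (triSingle I b a s h) = D.T b a s := D.lin_triSingle b a s h

lemma hom_idem (a : Fin p) (h) : D.hom (triSingle I a a 1 h) = D.P a := by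
  rw [hom_triSingle, D.T_of_le a a 1 le_rfl]
  simp

lemma hom_step (a b : Fin p) (hab : (b : ℕ) = a + 1) (h) :
    D.hom (triSingle I b a 1 h) = D.X * D.P a := by
  rw [hom_triSingle, D.T_of_le b a 1 (by rw [Fin.le_def]; omega), hab]
  simp

lemma hom_wrap (a b : Fin p) (s : I) (ha : (a : ℕ) + 1 = p) (hb : (b : ℕ) = 0) :
    D.hom (triSingle I b a s.1 fun _ => s.2) = D.W s := by
  rw [hom_triSingle, ← D.T_of_mem b a s.1 s.2, hb, show p - 1 - (a : ℕ) = 0 by omega, pow_zero,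
    one_mul, mul_one, D.W_mul_P_last a ha]

/-- The image of `T_p(R, I)` lies in any subring that contains the images of the generators. -/
lemma hom_mem (S : Subring B) (h0 : ∀ r, algebraMap R B r ∈ S) (h1 : ∀ a, D.P a ∈ S)
    (h2 : D.X ∈ S) (h3 : ∀ s, D.W s ∈ S) (m : triangular p I) : D.hom m ∈ S := by
  have : S.comap (D.hom : triangular p I →+* B) = ⊤ := triangular_subring_eq_top _
    (fun r => by simpa using h0 r)
    (fun a => by simpa [hom_idem] using h1 a)
    (fun a b h => by
      rw [Subring.mem_comap, RingHom.coe_coe, D.hom_step a b h]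
      exact S.mul_mem h2 (h1 a))
    (fun a b s hs ha hb => by
      rw [Subring.mem_comap, RingHom.coe_coe]
      exact (D.hom_wrap a b ⟨s, hs⟩ ha hb).symm ▸ h3 ⟨s, hs⟩)
  exact (this ▸ Subring.mem_top m : m ∈ S.comap _)

end TriRel
end TriRel

/-! ### Homomorphisms out of a tensor product of algebras -/

section Lift
variable {R : Type u} [CommRing R]

/-- The target is noncommutative, so the products are taken in the fixed order of the factors. Only
`g 0` has to move past the later values of f, and it commutes with them. This gives multiplicativity
of `liftCommuting`. -/
lemma prod_ofFn_mul {B : Type*} [Monoid B] {n : ℕ} (f g : Fin n → B)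
    (h : ∀ i j, i ≠ j → Commute (f i) (g j)) :
    (List.ofFn fun i => f i * g i).prod = (List.ofFn f).prod * (List.ofFn g).prod := by
  induction n with
  | zero => simp
  | succ n ih =>
    simp only [List.ofFn_succ, List.prod_cons]
    rw [ih (fun i => f i.succ) (fun i => g i.succ) fun i j hij => h _ _ (by simpa using hij)]
    have : Commute (g 0) (List.ofFn fun i : Fin n => f i.succ).prod := by
      refine Commute.list_prod_right _ _ fun x hx => ?_
      obtain ⟨i, rfl⟩ := (List.mem_ofFn' _ _).mp hx
      exact (h _ _ (Fin.succ_ne_zero i)).symm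
    rw [mul_assoc, ← mul_assoc (g 0), this.eq]
    simp only [mul_assoc]

lemma prod_ofFn_single {B : Type*} [Monoid B] {n : ℕ} (f : Fin n → B) (i : Fin n)
    (h : ∀ j, j ≠ i → f j = 1) : (List.ofFn f).prod = f i := by
  induction n with
  | zero => exact i.elim0
  | succ n ih =>
    rw [List.ofFn_succ, List.prod_cons]
    cases i using Fin.cases with
    | zero =>
      rw [List.prod_eq_one, mul_one]
      intro x hx
      obtain ⟨j, rfl⟩ := (List.mem_ofFn' _ _).mp hx
      exact h _ (Fin.succ_ne_zero j)
    | succ i =>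
      rw [h 0 (Fin.succ_ne_zero i).symm, one_mul]
      exact ih (fun j => f j.succ) i fun j hj => h _ (by simpa using hj)

variable {n : ℕ} {A : Fin n → Type u} [∀ i, Ring (A i)] [∀ i, Algebra R (A i)]
  {B : Type v} [Ring B] [Algebra R B]

/-- Homomorphisms of algebras with commuting images induce one from the tensor product. -/
def liftCommuting (ρ : ∀ i, A i →ₐ[R] B)
    (h : ∀ i j, i ≠ j → ∀ x y, Commute (ρ i x) (ρ j y)) : (⨂[R] i, A i) →ₐ[R] B :=
  PiTensorProduct.liftAlgHom
    ((MultilinearMap.mkPiAlgebraFin R n B).compLinearMap fun i => (ρ i).toLinearMap)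
    (by simp) (fun x y => by simpa using prod_ofFn_mul _ _ fun i j hij => h i j hij _ _)

lemma liftCommuting_single (ρ : ∀ i, A i →ₐ[R] B)
    (h : ∀ i j, i ≠ j → ∀ x y, Commute (ρ i x) (ρ j y)) (i : Fin n) (x : A i) :
    liftCommuting ρ h (PiTensorProduct.tprod R (Function.update 1 i x)) = ρ i x := by
  rw [liftCommuting, PiTensorProduct.liftAlgHom_apply, PiTensorProduct.lift.tprod]
  simp only [MultilinearMap.compLinearMap_apply, MultilinearMap.mkPiAlgebraFin_apply]
  rw [prod_ofFn_single _ i]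
  · simp
  · intro j hj
    simp [Function.update_of_ne hj]

/-- A pure tensor is the product of tensors with one nontrivial factor each; the induction fills in
the factors one at a time. -/
lemma tprod_mem (S : Subring (⨂[R] i, A i))
    (hS : ∀ i x, PiTensorProduct.tprod R (Function.update 1 i x) ∈ S) (m : ∀ i, A i) :
    PiTensorProduct.tprod R m ∈ S := by
  classical
  have key (s : Finset (Fin n)) :
      PiTensorProduct.tprod R (fun i => if i ∈ s then m i else 1) ∈ S := by
    induction s using Finset.induction_on with
    | empty => simp only [Finset.notMem_empty, if_false]; exact S.one_mem
    | insert i s hi ih =>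
      have := S.mul_mem (hS i (m i)) ih
      rw [PiTensorProduct.tprod_mul_tprod] at this
      convert this using 2
      funext j
      by_cases hj : j = i
      · subst hj; simp [hi]
      · simp [hj]
  simpa using key Finset.univ

lemma tensor_subring_eq_top (S : Subring (⨂[R] i, A i)) (h0 : ∀ r, algebraMap R _ r ∈ S)
    (hS : ∀ i x, PiTensorProduct.tprod R (Function.update 1 i x) ∈ S) : S = ⊤ := by
  rw [eq_top_iff]
  intro x _
  induction x using PiTensorProduct.induction_on with
  | smul_tprod r m => rw [Algebra.smul_def]; exact S.mul_mem (h0 r) (tprod_mem S hS m)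
  | add x y hx hy => exact S.add_mem (hx trivial) (hy trivial)
end Lift

end GLOrder
end

/-! ### Matrix units in the tensor product of triangular algebras -/

noncomputable section
namespace GLOrder

section MatrixUnits
variable {R : Type u} [CommRing R] {n : ℕ} {p : Fin n → ℕ} {I : Fin n → Ideal R}

/-- The tensor product of the matrices with the single entries `s i` in row `b i` and column
`a i`. -/
def unitTensor (I : Fin n → Ideal R) (b a : Idx p) (s : Fin n → R)
    (h : ∀ i, b i < a i → s i ∈ I i) : tensorOrder p I :=
  PiTensorProduct.tprod R fun i => triSingle (I i) (b i) (a i) (s i) (h i)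

lemma unitTensor_congr {b a : Idx p} {s t : Fin n → R} (hst : s = t) (h) :
    unitTensor I b a s h = unitTensor I b a t (hst ▸ h) := by subst hst; rfl

lemma unitTensor_mul (c b a : Idx p) (t s : Fin n → R) (h h') :
    unitTensor I c b t h * unitTensor I b a s h' = unitTensor I c a (t * s) (fun i hca => by
      by_cases hcb : c i < b i
      · exact (I i).mul_mem_right _ (h i hcb)
      · exact (I i).mul_mem_left _ (h' i (lt_of_le_of_lt (not_lt.mp hcb) hca))) := by
  refine (PiTensorProduct.tprod_mul_tprod _ _).trans (congrArg _ (funext fun i => ?_))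
  exact triSingle_mul _ _ _ _ _ _ _

lemma unitTensor_mul_of_ne (c b b' a : Idx p) (t s : Fin n → R) (h h') (hb : b ≠ b') :
    unitTensor I c b t h * unitTensor I b' a s h' = 0 := by
  obtain ⟨i, hi⟩ := Function.ne_iff.mp hb
  refine (PiTensorProduct.tprod_mul_tprod _ _).trans ?_
  exact (PiTensorProduct.tprod R).map_coord_zero i (triSingle_mul_of_ne _ _ _ _ _ _ _ _ hi)

/-- The primitive idempotent of index `a`. -/
def idem (I : Fin n → Ideal R) (a : Idx p) : tensorOrder p I :=
  unitTensor I a a 1 (fun i h => absurd h (lt_irrefl (a i)))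

/-- Expand 1 ⊗ ⋯ ⊗ 1 multilinearly, writing each 1 as the sum of the diagonal units. -/
lemma sum_idem : ∑ a : Idx p, idem I a = 1 := by
  have h := (PiTensorProduct.tprod R).map_sum
    (fun i (c : Fin (p i)) => triSingle (I i) c c 1 (fun h => absurd h (lt_irrefl c)))
  refine h.symm.trans ?_
  rw [PiTensorProduct.one_def]
  exact congrArg _ (funext fun i => one_eq_sum_triSingle.symm)

lemma idem_mul_self (a : Idx p) : idem I a * idem I a = idem I a := by
  refine (unitTensor_mul _ _ _ _ _ _ _).trans (unitTensor_congr (mul_one 1) _)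

lemma idem_mul_of_ne {a b : Idx p} (h : a ≠ b) : idem I a * idem I b = 0 :=
  unitTensor_mul_of_ne _ _ _ _ _ _ _ _ h

lemma unitTensor_mul_idem (b a : Idx p) (s : Fin n → R) (h) :
    unitTensor I b a s h * idem I a = unitTensor I b a s h :=
  (unitTensor_mul _ _ _ _ _ _ _).trans (unitTensor_congr (mul_one s) _)

lemma idem_mul_unitTensor (b a : Idx p) (s : Fin n → R) (h) :
    idem I b * unitTensor I b a s h = unitTensor I b a s h :=
  (unitTensor_mul _ _ _ _ _ _ _).trans (unitTensor_congr (one_mul s) _)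

/-- The element `1 ⊗ ⋯ ⊗ x ⊗ ⋯ ⊗ 1`. -/
def inFactor (i : Fin n) (x : triangular (p i) (I i)) : tensorOrder p I :=
  PiTensorProduct.tprod R (Function.update 1 i x)

lemma inFactor_mul_idem_of_ne (i : Fin n) (a : Idx p) (c b : Fin (p i)) (t : R) (h) (hb : b ≠ a i) :
    inFactor i (triSingle (I i) c b t h) * idem I a = 0 := by
  refine (PiTensorProduct.tprod_mul_tprod _ _).trans ?_
  refine (PiTensorProduct.tprod R).map_coord_zero i ?_
  simp only [Pi.mul_apply, Function.update_self]
  exact triSingle_mul_of_ne _ _ _ _ _ _ _ _ hb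

/-- An element of a single factor acts along all lines in its direction at once. Multiplication by
the idempotent of index a selects one line and leaves a single matrix unit. -/
lemma inFactor_mul_idem (i : Fin n) (b a : Idx p) (t : R) (h) (hb : ∀ j, j ≠ i → b j = a j) (h'') :
    inFactor i (triSingle (I i) (b i) (a i) t h) * idem I a =
      unitTensor I b a (Function.update 1 i t) h'' := by
  refine (PiTensorProduct.tprod_mul_tprod _ _).trans (congrArg _ (funext fun j => ?_))
  by_cases hj : j = i
  · subst hj
    simp only [Function.update_self, triSingle_mul, Pi.mul_apply, Pi.one_apply, mul_one]
  · simp [Function.update_of_ne hj, hb j hj]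

/-- A scalar placed in one tensor factor can be pulled out of the whole tensor. This is how a turn
in direction i becomes multiplication by a function in the cycle condition. -/
lemma smul_idem (i : Fin n) (a : Idx p) (s : R) :
    unitTensor I a a (Function.update 1 i s) (fun i h => absurd h (lt_irrefl (a i))) =
      algebraMap R (tensorOrder p I) s * idem I a := by
  rw [← Algebra.smul_def, ← inFactor_mul_idem i a a s (fun h => absurd h (lt_irrefl (a i)))
    (fun _ _ => rfl)]
  refine (PiTensorProduct.tprod_mul_tprod _ _).trans ?_
  have := (PiTensorProduct.tprod R).map_update_smul
    (fun j => triSingle (I j) (a j) (a j) 1 (fun h => absurd h (lt_irrefl (a j)))) i s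
    (triSingle (I i) (a i) (a i) 1 (fun h => absurd h (lt_irrefl (a i))))
  rw [Function.update_eq_self] at this
  refine Eq.trans (congrArg _ (funext fun j => ?_)) this
  by_cases hj : j = i
  · subst hj
    simp only [Function.update_self, triSingle_mul, Pi.mul_apply, Pi.one_apply, smul_triSingle]
  · simp [Function.update_of_ne hj]

/-- The matrix unit of a step `a → b`. -/
def stepUnit (I : Fin n → Ideal R) {i : Fin n} {a b : Idx p} (h : IsStep i a b) :
    tensorOrder p I :=
  unitTensor I b a 1 (fun j hj => absurd hj (by
    by_cases hji : j = i
    · subst hji; rw [Fin.lt_def, h.1]; omega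
    · rw [h.2 j hji]; exact lt_irrefl _))

lemma wrap_mem {i : Fin n} {a b : Idx p} (h : IsWrap i a b) {s : R} (hs : s ∈ I i) :
    ∀ j, b j < a j → Function.update (1 : Fin n → R) i s j ∈ I j := fun j hj => by
  by_cases hji : j = i
  · subst hji; simpa using hs
  · rw [h.2.2 j hji] at hj; exact absurd hj (lt_irrefl _)

/-- The element of `⨂ᵢ T_{pᵢ}(R, Iᵢ)` with the single entry `s` that goes from the last index `a`
on a line to the first index `b`. -/
def wrapUnit {i : Fin n} {a b : Idx p} (h : IsWrap i a b) (s : I i) : tensorOrder p I :=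
  unitTensor I b a (Function.update 1 i s.1) (wrap_mem h s.2)

lemma inFactor_mul_idem_step {i : Fin n} {a b : Idx p} (h : IsStep i a b) :
    inFactor i (triSingle (I i) (b i) (a i) 1 (fun h' => absurd h' (by
      rw [Fin.lt_def, h.1]; omega))) * idem I a = stepUnit I h :=
  (inFactor_mul_idem i b a 1 _ h.2 fun j hj => absurd hj (by
    by_cases hji : j = i
    · subst hji; rw [Fin.lt_def, h.1]; omega
    · rw [h.2 j hji]; exact lt_irrefl _)).trans
    (unitTensor_congr (Function.update_eq_self i (1 : Fin n → R)) _)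

lemma inFactor_mul_idem_wrap {i : Fin n} {a b : Idx p} (h : IsWrap i a b) (s : I i) :
    inFactor i (triSingle (I i) (b i) (a i) s.1 (fun _ => s.2)) * idem I a = wrapUnit h s :=
  inFactor_mul_idem i b a s.1 _ h.2.2 (wrap_mem h s.2)

/-- A subring of `⨂ᵢ T_{pᵢ}(R, Iᵢ)` that contains the scalars, the primitive idempotents and the
elements that correspond to the structure morphisms of a grid is everything. -/
lemma tensorOrder_subring_eq_top (S : Subring (tensorOrder p I))
    (h0 : ∀ r, algebraMap R _ r ∈ S) (h1 : ∀ a, idem I a ∈ S)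
    (h2 : ∀ (i : Fin n) (a b : Idx p) (h : IsStep i a b), stepUnit I h ∈ S)
    (h3 : ∀ (i : Fin n) (a b : Idx p) (h : IsWrap i a b) (s : I i), wrapUnit h s ∈ S) : S = ⊤ := by
  refine tensor_subring_eq_top S h0 fun i x => ?_
  let f : triangular (p i) (I i) →+* tensorOrder p I :=
    (PiTensorProduct.singleAlgHom (R := R) (A := fun i => triangular (p i) (I i)) i).toRingHom
  have hf (x) : f x = inFactor i x := rfl
  -- Since the idempotents sum to 1, membership may be tested after right multiplication by each of
  -- them.
  have hS (y : tensorOrder p I) (h : ∀ a, y * idem I a ∈ S) : y ∈ S := by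
    rw [← mul_one y, ← sum_idem, Finset.mul_sum]
    exact S.sum_mem fun a _ => h a
  have key : S.comap f = ⊤ := by
    refine triangular_subring_eq_top _ ?_ ?_ ?_ ?_
    · intro r
      have : f (algebraMap R _ r) = algebraMap R (tensorOrder p I) r :=
        (PiTensorProduct.singleAlgHom (R := R) (A := fun i => triangular (p i) (I i)) i).commutes r
      rw [Subring.mem_comap, this]
      exact h0 r
    · intro c
      refine hS _ fun a => ?_
      rw [hf]
      -- The product with the idempotent vanishes unless the column c is the i-th coordinate of a;
      -- in that case it is one of the listed generators.
      by_cases hc : c = a i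
      · subst hc
        rw [inFactor_mul_idem i a a 1 _ (fun _ _ => rfl) (fun i h => absurd h (lt_irrefl (a i)))]
        have := h1 a
        rwa [idem, unitTensor_congr (Function.update_eq_self i (1 : Fin n → R)).symm] at this
      · rw [inFactor_mul_idem_of_ne _ _ _ _ _ _ hc]
        exact S.zero_mem
    · intro c d hcd
      refine hS _ fun a => ?_
      rw [hf]
      by_cases hc : c = a i
      · subst hc
        have hst : IsStep i a (Function.update a i d) :=
          ⟨by simpa using hcd, fun j hj => by simp [Function.update_of_ne hj]⟩
        have := h2 i _ _ hst
        rw [← inFactor_mul_idem_step hst] at this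
        convert this using 3
        simp
      · rw [inFactor_mul_idem_of_ne _ _ _ _ _ _ hc]
        exact S.zero_mem
    · intro c d s hs hc' hd
      refine hS _ fun a => ?_
      rw [hf]
      by_cases hc : c = a i
      · subst hc
        have hst : IsWrap i a (Function.update a i d) :=
          ⟨hc', by simpa using hd, fun j hj => by simp [Function.update_of_ne hj]⟩
        have := h3 i _ _ hst ⟨s, hs⟩
        rw [← inFactor_mul_idem_wrap hst] at this
        convert this using 3
        simp
      · rw [inFactor_mul_idem_of_ne _ _ _ _ _ _ hc]
        exact S.zero_mem
  have : x ∈ S.comap f := key ▸ trivial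
  exact this
-- A product of two composable units depends only on its endpoints and the product of the
-- coefficients, not on the middle index. All commutativity relations of grids are instances.
lemma unitTensor_mul_eq (c b b' a : Idx p) {t s t' s' : Fin n → R} (h₁ h₂ h₃ h₄)
    (e : t * s = t' * s') :
    unitTensor I c b t h₁ * unitTensor I b a s h₂ =
      unitTensor I c b' t' h₃ * unitTensor I b' a s' h₄ := by
  rw [unitTensor_mul, unitTensor_mul, unitTensor_congr e]

lemma stepUnit_mul_stepUnit {i j : Fin n} {a b c d : Idx p} (hab : IsStep i a b)
    (hbd : IsStep j b d) (hac : IsStep j a c) (hcd : IsStep i c d) :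
    stepUnit I hbd * stepUnit I hab = stepUnit I hcd * stepUnit I hac :=
  unitTensor_mul_eq _ _ _ _ _ _ _ _ rfl

lemma stepUnit_mul_wrapUnit {i j : Fin n} {a b c d : Idx p} (hab : IsWrap i a b)
    (hbd : IsStep j b d) (hac : IsStep j a c) (hcd : IsWrap i c d) (s : I i) :
    stepUnit I hbd * wrapUnit hab s = wrapUnit hcd s * stepUnit I hac :=
  unitTensor_mul_eq _ _ _ _ _ _ _ _ (mul_comm _ _)

lemma wrapUnit_mul_wrapUnit {i j : Fin n} {a b c d : Idx p} (hab : IsWrap i a b)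
    (hbd : IsWrap j b d) (hac : IsWrap j a c) (hcd : IsWrap i c d) (s : I i) (t : I j) :
    wrapUnit hbd t * wrapUnit hab s = wrapUnit hcd s * wrapUnit hac t :=
  unitTensor_mul_eq _ _ _ _ _ _ _ _ (mul_comm _ _)

/-- The matrix unit in row `b` and column `a`, on or below the diagonal. -/
def lowerUnit (I : Fin n → Ideal R) (b a : Idx p) (h : a ≤ b) : tensorOrder p I :=
  unitTensor I b a 1 (fun i hi => absurd hi (not_lt.mpr (h i)))

lemma IsStep.le {i : Fin n} {a b : Idx p} (h : IsStep i a b) : a ≤ b := fun j => by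
  by_cases hji : j = i
  · subst hji; rw [Fin.le_def, h.1]; omega
  · rw [h.2 j hji]

lemma stepUnit_mul_lowerUnit {i : Fin n} {a b c : Idx p} (hab : a ≤ b) (hbc : IsStep i b c) :
    stepUnit I hbc * lowerUnit I b a hab = lowerUnit I c a (hab.trans hbc.le) :=
  (unitTensor_mul _ _ _ _ _ _ _).trans (unitTensor_congr (mul_one 1) _)

/-- This is the cycle condition inside the algebra: climbing from a to the end of the line, wrapping
with s and climbing back returns to a with coefficient s. -/
lemma lowerUnit_mul_wrapUnit_mul_lowerUnit {i : Fin n} {a b c : Idx p} (hab : a ≤ b) (hca : c ≤ a)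
    (hbc : IsWrap i b c) (s : I i) :
    lowerUnit I a c hca * (wrapUnit hbc s * lowerUnit I b a hab) =
      algebraMap R (tensorOrder p I) s.1 * idem I a := by
  rw [← smul_idem i]
  exact (congrArg _ (unitTensor_mul _ _ _ _ _ _ _)).trans ((unitTensor_mul _ _ _ _ _ _ _).trans
    (unitTensor_congr (by simp) _))

lemma inFactor_add (i : Fin n) (x y : triangular (p i) (I i)) :
    inFactor i (x + y) = inFactor i x + inFactor i y :=
  (PiTensorProduct.tprod R (s := fun i => triangular (p i) (I i))).map_update_add 1 i x y

lemma inFactor_smul (i : Fin n) (r : R) (x : triangular (p i) (I i)) :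
    inFactor i (r • x) = r • inFactor i x :=
  (PiTensorProduct.tprod R (s := fun i => triangular (p i) (I i))).map_update_smul 1 i r x

lemma wrapUnit_add {i : Fin n} {a b : Idx p} (h : IsWrap i a b) (s t : I i) :
    wrapUnit h (s + t) = wrapUnit h s + wrapUnit h t := by
  rw [← inFactor_mul_idem_wrap, ← inFactor_mul_idem_wrap, ← inFactor_mul_idem_wrap, ← add_mul,
    ← inFactor_add, ← triSingle_add]
  rfl

lemma wrapUnit_smul {i : Fin n} {a b : Idx p} (h : IsWrap i a b) (r : R) (s : I i) :
    wrapUnit h (r • s) = algebraMap R (tensorOrder p I) r * wrapUnit h s := by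
  rw [← inFactor_mul_idem_wrap, ← inFactor_mul_idem_wrap, ← mul_assoc, ← Algebra.smul_def,
    ← inFactor_smul, smul_triSingle]
  rfl

lemma wrapUnit_mul_idem {i : Fin n} {a b : Idx p} (h : IsWrap i a b) (s : I i) :
    wrapUnit h s * idem I a = wrapUnit h s := unitTensor_mul_idem _ _ _ _

lemma idem_mul_wrapUnit {i : Fin n} {a b : Idx p} (h : IsWrap i a b) (s : I i) :
    idem I b * wrapUnit h s = wrapUnit h s := idem_mul_unitTensor _ _ _ _

section Map
variable {S : Type u} [CommRing S] {J : Fin n → Ideal S} (f : R →+* S)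
  (hf : ∀ i, I i ≤ (J i).comap f)

lemma tensorOrderMap_unitTensor (b a : Idx p) (s : Fin n → R) (h) :
    tensorOrderMap p f hf (unitTensor I b a s h) =
      unitTensor J b a (f ∘ s) (fun i hi => hf i (h i hi)) := by
  have := tensorOrderMap_smul_tprod p f hf 1 fun i => triSingle (I i) (b i) (a i) (s i) (h i)
  rw [one_smul, map_one, one_smul] at this
  refine this.trans (congrArg _ (funext fun i => Subtype.ext ?_))
  exact Matrix.map_single _ _ _ f

lemma tensorOrderMap_idem (a : Idx p) : tensorOrderMap p f hf (idem I a) = idem J a :=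
  (tensorOrderMap_unitTensor f hf _ _ _ _).trans (unitTensor_congr (by ext; simp) _)

lemma tensorOrderMap_stepUnit {i : Fin n} {a b : Idx p} (h : IsStep i a b) :
    tensorOrderMap p f hf (stepUnit I h) = stepUnit J h :=
  (tensorOrderMap_unitTensor f hf _ _ _ _).trans (unitTensor_congr (by ext; simp) _)

lemma tensorOrderMap_lowerUnit {a b : Idx p} (h : a ≤ b) :
    tensorOrderMap p f hf (lowerUnit I b a h) = lowerUnit J b a h :=
  (tensorOrderMap_unitTensor f hf _ _ _ _).trans (unitTensor_congr (by ext; simp) _)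

lemma tensorOrderMap_wrapUnit {i : Fin n} {a b : Idx p} (h : IsWrap i a b) (s : I i) :
    tensorOrderMap p f hf (wrapUnit h s) = wrapUnit h ⟨f s.1, hf i s.2⟩ :=
  (tensorOrderMap_unitTensor f hf _ _ _ _).trans (unitTensor_congr (by
    ext j
    by_cases hj : j = i
    · subst hj; simp
    · simp [Function.update_of_ne hj]) _)

lemma tensorOrderMap_algebraMap (r : R) :
    tensorOrderMap p f hf (algebraMap R _ r) = algebraMap S _ (f r) := by
  rw [Algebra.algebraMap_eq_smul_one, Algebra.algebraMap_eq_smul_one, PiTensorProduct.one_def,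
    PiTensorProduct.one_def, tensorOrderMap_smul_tprod]
  exact congrArg (_ • PiTensorProduct.tprod _ ·) (funext fun i =>
    map_one (triangularMap (p i) _ (hf i)))
end Map
end MatrixUnits

end GLOrder
end

/-! ### From a grid of modules to an action of the tensor product -/

noncomputable section
namespace GLOrder

section ModuleGrid
variable {R : Type u} [CommRing R] {n : ℕ} {p : Fin n → ℕ} {I : Fin n → Ideal R}
  {M : Idx p → Type v} [∀ a, AddCommGroup (M a)] [∀ a, Module R (M a)]

/-- The relation between an element of `M a` and its images under the composites of consecutive
steps in direction `i`. -/
inductive Reach (step : ∀ (i : Fin n) (a b : Idx p), IsStep i a b → (M a →ₗ[R] M b)) (i : Fin n)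
    {a : Idx p} (m : M a) : ∀ {b : Idx p}, M b → Prop
  | refl : Reach step i m m
  | cons {b c : Idx p} {m' : M b} (hm : Reach step i m m') (h : IsStep i b c) :
    Reach step i m (step i b c h m')

/-- A grid of modules over `R`, with respect to the functors `- ⊗ Iᵢ`. -/
structure ModuleGrid (p : Fin n → ℕ) (I : Fin n → Ideal R) (M : Idx p → Type v)
    [∀ a, AddCommGroup (M a)] [∀ a, Module R (M a)] where
  /-- the interior structure maps -/
  step (i : Fin n) (a b : Idx p) : IsStep i a b → (M a →ₗ[R] M b)
  /-- the structure maps that wrap around -/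
  wrap (i : Fin n) (a b : Idx p) : IsWrap i a b → (I i →ₗ[R] M a →ₗ[R] M b)
  step_step {i j : Fin n} (hij : i ≠ j) {a b c d : Idx p} (hab : IsStep i a b) (hbd : IsStep j b d)
    (hac : IsStep j a c) (hcd : IsStep i c d) (m : M a) :
    step j b d hbd (step i a b hab m) = step i c d hcd (step j a c hac m)
  wrap_step {i j : Fin n} (hij : i ≠ j) {a b c d : Idx p} (hab : IsWrap i a b) (hbd : IsStep j b d)
    (hac : IsStep j a c) (hcd : IsWrap i c d) (s : I i) (m : M a) :
    step j b d hbd (wrap i a b hab s m) = wrap i c d hcd s (step j a c hac m)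
  wrap_wrap {i j : Fin n} (hij : i ≠ j) {a b c d : Idx p} (hab : IsWrap i a b) (hbd : IsWrap j b d)
    (hac : IsWrap j a c) (hcd : IsWrap i c d) (s : I i) (t : I j) (m : M a) :
    wrap j b d hbd t (wrap i a b hab s m) = wrap i c d hcd s (wrap j a c hac t m)
  cycle {i : Fin n} {a b c : Idx p} {m m'' : M a} {m' : M b} (s : I i) (hf : Reach step i m m')
    (hbc : IsWrap i b c) (hg : Reach step i (wrap i b c hbc s m') m'') : m'' = s.1 • m

lemma isStep_update {i : Fin n} {a : Idx p} (h : (a i : ℕ) + 1 < p i) :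
    IsStep i a (Function.update a i ⟨a i + 1, h⟩) :=
  ⟨by simp, fun _ hj => Function.update_of_ne hj _ _⟩

lemma isWrap_update {i : Fin n} {a : Idx p} (h : (a i : ℕ) + 1 = p i) :
    IsWrap i a (Function.update a i ⟨0, (a i).pos⟩) :=
  ⟨h, by simp, fun _ hj => Function.update_of_ne hj _ _⟩

lemma IsStep.eq_update {i : Fin n} {a b : Idx p} (h : IsStep i a b) :
    b = Function.update a i ⟨a i + 1, h.1 ▸ (b i).2⟩ := by
  funext j
  by_cases hj : j = i
  · subst hj; rw [Function.update_self]; exact Fin.ext h.1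
  · rw [Function.update_of_ne hj, h.2 j hj]

lemma IsWrap.eq_update {i : Fin n} {a b : Idx p} (h : IsWrap i a b) :
    b = Function.update a i ⟨0, (a i).pos⟩ := by
  funext j
  by_cases hj : j = i
  · subst hj; rw [Function.update_self]; exact Fin.ext h.2.1
  · rw [Function.update_of_ne hj, h.2.2 j hj]

namespace ModuleGrid
variable (G : ModuleGrid p I M)

/-- The projection to the components with `i`-th coordinate `c`. -/
def proj (R : Type u) [CommRing R] (M : Idx p → Type v) [∀ a, AddCommGroup (M a)]
    [∀ a, Module R (M a)] (i : Fin n) (c : Fin (p i)) : Module.End R (∀ a, M a) :=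
  LinearMap.lsum R M R fun a => if a i = c then LinearMap.single R M a else 0

/-- The sum of all steps in direction `i`. -/
def shift (i : Fin n) : Module.End R (∀ a, M a) :=
  LinearMap.lsum R M R fun a => if h : (a i : ℕ) + 1 < p i then
    LinearMap.single R M _ ∘ₗ G.step i a _ (isStep_update h) else 0

/-- The sum of all the maps that wrap around in direction `i`. -/
def turn (i : Fin n) (s : I i) : Module.End R (∀ a, M a) :=
  LinearMap.lsum R M R fun a => if h : (a i : ℕ) + 1 = p i then
    LinearMap.single R M _ ∘ₗ G.wrap i a _ (isWrap_update h) s else 0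

lemma proj_single (i : Fin n) (a : Idx p) (m : M a) :
    proj R M i (a i) (Pi.single a m) = Pi.single a m := by
  rw [proj, LinearMap.lsum_piSingle, if_pos rfl]
  rfl

lemma proj_single_of_ne {i : Fin n} {c : Fin (p i)} {a : Idx p} (h : a i ≠ c) (m : M a) :
    proj R M i c (Pi.single a m) = 0 := by
  rw [proj, LinearMap.lsum_piSingle, if_neg h]
  rfl

lemma shift_single {i : Fin n} {a b : Idx p} (h : IsStep i a b) (m : M a) :
    G.shift i (Pi.single a m) = Pi.single b (G.step i a b h m) := by
  have h1 : (a i : ℕ) + 1 < p i := h.1 ▸ (b i).2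
  have e := h.eq_update
  -- The target b and the updated index are equal only propositionally, while `M b` depends on b.
  -- Naming the updated index makes it possible to substitute.
  generalize hd : Function.update a i ⟨a i + 1, h1⟩ = d at e
  subst e
  subst hd
  rw [shift, LinearMap.lsum_piSingle, dif_pos h1]
  rfl

/-- The shift does not wrap around; leaving the end of a line is the business of `turn` alone. -/
lemma shift_single_last {i : Fin n} {a : Idx p} (h : (a i : ℕ) + 1 = p i) (m : M a) :
    G.shift i (Pi.single a m) = 0 := by
  rw [shift, LinearMap.lsum_piSingle, dif_neg (by omega)]
  rfl

lemma turn_single {i : Fin n} {a b : Idx p} (h : IsWrap i a b) (s : I i) (m : M a) :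
    G.turn i s (Pi.single a m) = Pi.single b (G.wrap i a b h s m) := by
  obtain rfl := h.eq_update
  rw [turn, LinearMap.lsum_piSingle, dif_pos h.1]
  rfl

lemma turn_single_of_ne {i : Fin n} {a : Idx p} (h : (a i : ℕ) + 1 ≠ p i) (s : I i) (m : M a) :
    G.turn i s (Pi.single a m) = 0 := by
  rw [turn, LinearMap.lsum_piSingle, dif_neg h]
  rfl

/-- The power of the shift is recorded as a `Reach` relation because the cycle axiom of a grid of
modules is stated for elements related by `Reach`. -/
lemma shift_pow_single (i : Fin n) (a : Idx p) (m : M a) (k : ℕ) (hk : (a i : ℕ) + k < p i) :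
    ∃ (b : Idx p) (m' : M b), Reach G.step i m m' ∧ (b i : ℕ) = a i + k ∧
      (∀ j, j ≠ i → b j = a j) ∧ (G.shift i ^ k) (Pi.single a m) = Pi.single b m' := by
  induction k with
  | zero => exact ⟨a, m, .refl, rfl, fun _ _ => rfl, by simp⟩
  | succ k ih =>
    obtain ⟨b, m', hm, hb, hb', e⟩ := ih (by omega)
    have h := isStep_update (i := i) (a := b) (by omega)
    refine ⟨_, _, hm.cons h, by rw [h.1, hb]; omega, fun j hj => (h.2 j hj).trans (hb' j hj), ?_⟩
    rw [pow_succ', Module.End.mul_apply, e, G.shift_single h]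

lemma step_or_last (i : Fin n) (a : Idx p) : (∃ b, IsStep i a b) ∨ (a i : ℕ) + 1 = p i := by
  by_cases h : (a i : ℕ) + 1 < p i
  · exact .inl ⟨_, isStep_update h⟩
  · exact .inr (by omega)

/-- The operators of a grid of modules satisfy the relations of `T_p(R, I)`. -/
def triRel (i : Fin n) : TriRel (p i) (I i) (Module.End R (∀ a, M a)) where
  P := proj R M i
  X := G.shift i
  W :=
    { toFun := G.turn i
      map_add' s t := by
        refine LinearMap.pi_ext fun a m => ?_
        rw [LinearMap.add_apply]
        by_cases h : (a i : ℕ) + 1 = p i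
        · simp only [G.turn_single (isWrap_update h), map_add, LinearMap.add_apply, Pi.single_add]
        · simp only [G.turn_single_of_ne h, add_zero]
      map_smul' r s := by
        refine LinearMap.pi_ext fun a m => ?_
        rw [RingHom.id_apply, LinearMap.smul_apply]
        by_cases h : (a i : ℕ) + 1 = p i
        · simp only [G.turn_single (isWrap_update h), map_smul, LinearMap.smul_apply,
            Pi.single_smul]
        · simp only [G.turn_single_of_ne h, smul_zero] }
  P_mul_self c := by
    refine LinearMap.pi_ext fun a m => ?_
    rw [Module.End.mul_apply]
    by_cases h : a i = c
    · subst h; simp only [proj_single]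
    · simp only [proj_single_of_ne h, map_zero]
  P_mul_ne c d hcd := by
    refine LinearMap.pi_ext fun a m => ?_
    rw [Module.End.mul_apply]
    by_cases h : a i = d
    · subst h; rw [proj_single, proj_single_of_ne hcd.symm]; rfl
    · rw [proj_single_of_ne h, map_zero]; rfl
  sum_P := by
    refine LinearMap.pi_ext fun a m => ?_
    rw [LinearMap.sum_apply, Finset.sum_eq_single (a i)]
    · exact proj_single i a m
    · exact fun c _ hc => proj_single_of_ne hc.symm m
    · simp
  X_mul_P c d hcd := by
    refine LinearMap.pi_ext fun a m => ?_
    rw [Module.End.mul_apply, Module.End.mul_apply]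
    obtain ⟨b, h⟩ | h := step_or_last i a
    · by_cases hc : a i = c
      · have hd : d = b i := Fin.ext (by rw [hcd, h.1, hc])
        subst hc hd
        rw [proj_single, G.shift_single h, proj_single]
      · rw [proj_single_of_ne hc, G.shift_single h, proj_single_of_ne, map_zero]
        intro hd
        exact hc (Fin.ext (by have := h.1; rw [hd] at this; omega))
    · rw [proj_single_of_ne (fun e => by rw [e] at h; omega), G.shift_single_last h, map_zero,
        map_zero]
  P_mul_W c s hc := by
    refine LinearMap.pi_ext fun a m => ?_
    rw [Module.End.mul_apply]
    change proj R M i c (G.turn i s _) = 0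
    by_cases h : (a i : ℕ) + 1 = p i
    · have hw := isWrap_update h
      rw [G.turn_single hw, proj_single_of_ne]
      intro e
      rw [← e] at hc
      exact hc hw.2.1
    · rw [G.turn_single_of_ne h, map_zero]
  W_mul_P c s hc := by
    refine LinearMap.pi_ext fun a m => ?_
    rw [Module.End.mul_apply]
    change G.turn i s _ = 0
    by_cases h : a i = c
    · subst h; rw [proj_single, G.turn_single_of_ne hc]
    · rw [proj_single_of_ne h, map_zero]
  cycle c s := by
    refine LinearMap.pi_ext fun a m => ?_
    rw [Module.End.mul_apply, Module.End.mul_apply, Module.End.mul_apply, LinearMap.smul_apply]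
    change (G.shift i ^ (c : ℕ)) (G.turn i s _) = _
    by_cases h : a i = c
    · subst h
      rw [proj_single]
      -- From a, exactly p_i - 1 - a_i steps reach the end of the line. After wrapping to coordinate
      -- 0, another a_i steps lead back to a, so the cycle axiom applies.
      obtain ⟨b, m', hm, hb, hb', e⟩ := G.shift_pow_single i a m (p i - 1 - a i) (by omega)
      have hw := isWrap_update (i := i) (a := b) (by omega)
      obtain ⟨d, m'', hm', hd, hd', e'⟩ := G.shift_pow_single i _ (G.wrap i b _ hw s m') (a i)
        (by rw [hw.2.1]; omega)
      rw [e, G.turn_single hw, e']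
      obtain rfl : d = a := by
        funext j
        by_cases hj : j = i
        · subst hj; exact Fin.ext (by rw [hd, hw.2.1]; omega)
        · rw [hd' j hj, hw.2.2 j hj, hb' j hj]
      rw [G.cycle s hm hw hm', Pi.single_smul]
    · rw [proj_single_of_ne h]
      simp only [map_zero, smul_zero]

lemma commute_proj_proj (i j : Fin n) (c : Fin (p i)) (d : Fin (p j)) :
    Commute (proj R M i c) (proj R M j d) := by
  refine LinearMap.pi_ext fun a m => ?_
  rw [Module.End.mul_apply, Module.End.mul_apply]
  by_cases h : a i = c <;> by_cases h' : a j = d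
  · subst h h'; simp only [proj_single]
  · subst h; simp only [proj_single, proj_single_of_ne h', map_zero]
  · subst h'; simp only [proj_single, proj_single_of_ne h, map_zero]
  · simp only [proj_single_of_ne h, proj_single_of_ne h', map_zero]

lemma commute_proj_shift {i j : Fin n} (hij : i ≠ j) (c : Fin (p i)) :
    Commute (proj R M i c) (G.shift j) := by
  refine LinearMap.pi_ext fun a m => ?_
  rw [Module.End.mul_apply, Module.End.mul_apply]
  obtain ⟨b, hb⟩ | hb := step_or_last j a
  · by_cases h : a i = c
    · subst h
      rw [proj_single, G.shift_single hb, ← hb.2 i hij, proj_single]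
    · rw [proj_single_of_ne h, G.shift_single hb, proj_single_of_ne (hb.2 i hij ▸ h), map_zero]
  · by_cases h : a i = c
    · subst h; rw [proj_single, G.shift_single_last hb, map_zero]
    · rw [proj_single_of_ne h, G.shift_single_last hb, map_zero, map_zero]

lemma commute_proj_turn {i j : Fin n} (hij : i ≠ j) (c : Fin (p i)) (s : I j) :
    Commute (proj R M i c) (G.turn j s) := by
  refine LinearMap.pi_ext fun a m => ?_
  rw [Module.End.mul_apply, Module.End.mul_apply]
  by_cases hl : (a j : ℕ) + 1 = p j
  · have hb := isWrap_update hl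
    by_cases h : a i = c
    · subst h
      rw [proj_single, G.turn_single hb, ← hb.2.2 i hij, proj_single]
    · rw [proj_single_of_ne h, G.turn_single hb, proj_single_of_ne (hb.2.2 i hij ▸ h), map_zero]
  · by_cases h : a i = c
    · subst h; rw [proj_single, G.turn_single_of_ne hl, map_zero]
    · rw [proj_single_of_ne h, G.turn_single_of_ne hl, map_zero, map_zero]

/-- If both steps exist this is the commutative square. Otherwise both composites vanish, since a
step in one direction does not change whether the other coordinate is last. The mixed cases with
`turn` follow the same pattern. -/
lemma commute_shift_shift {i j : Fin n} (hij : i ≠ j) : Commute (G.shift i) (G.shift j) := by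
  refine LinearMap.pi_ext fun a m => ?_
  rw [Module.End.mul_apply, Module.End.mul_apply]
  obtain ⟨b, hb⟩ | hb := step_or_last i a <;> obtain ⟨c, hc⟩ | hc := step_or_last j a
  · have hlt : (b j : ℕ) + 1 < p j := by rw [hb.2 j hij.symm, ← hc.1]; exact (c j).2
    have hbd := isStep_update hlt
    have hcd : IsStep i c (Function.update b j ⟨b j + 1, hlt⟩) := by
      refine ⟨?_, fun k hk => ?_⟩
      · rw [Function.update_of_ne hij, hb.1, hc.2 i hij]
      · by_cases hkj : k = j
        · subst hkj
          rw [Function.update_self]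
          exact Fin.ext ((congrArg (fun x : Fin _ => (x : ℕ) + 1) (hb.2 k hk)).trans hc.1.symm)
        · rw [Function.update_of_ne hkj, hb.2 k hk, hc.2 k hkj]
    rw [G.shift_single hb, G.shift_single hc, G.shift_single hbd, G.shift_single hcd,
      G.step_step hij hb hbd hc hcd]
  · rw [G.shift_single hb, G.shift_single_last hc, map_zero, G.shift_single_last]
    rw [hb.2 j hij.symm, hc]
  · rw [G.shift_single hc, G.shift_single_last hb, map_zero, G.shift_single_last]
    rw [hc.2 i hij, hb]
  · rw [G.shift_single_last hb, G.shift_single_last hc, map_zero, map_zero]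

lemma commute_turn_shift {i j : Fin n} (hij : i ≠ j) (s : I i) :
    Commute (G.turn i s) (G.shift j) := by
  refine LinearMap.pi_ext fun a m => ?_
  rw [Module.End.mul_apply, Module.End.mul_apply]
  by_cases hb : (a i : ℕ) + 1 = p i <;> obtain ⟨c, hc⟩ | hc := step_or_last j a
  · have hcd := isWrap_update (i := i) (a := c) (by rw [hc.2 i hij, hb])
    have hb' := isWrap_update hb
    have hbd : IsStep j (Function.update a i ⟨0, (a i).pos⟩)
        (Function.update c i ⟨0, (c i).pos⟩) := by
      refine ⟨?_, fun k hk => ?_⟩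
      · rw [Function.update_of_ne hij.symm, Function.update_of_ne hij.symm, hc.1]
      · by_cases hki : k = i
        · subst hki
          rw [Function.update_self, Function.update_self]
        · rw [Function.update_of_ne hki, Function.update_of_ne hki, hc.2 k hk]
    rw [G.turn_single hb', G.shift_single hc, G.shift_single hbd, G.turn_single hcd,
      G.wrap_step hij hb' hbd hc hcd]
  · rw [G.turn_single (isWrap_update hb), G.shift_single_last hc, map_zero, G.shift_single_last]
    rw [(isWrap_update hb).2.2 j hij.symm, hc]
  · rw [G.shift_single hc, G.turn_single_of_ne hb, map_zero, G.turn_single_of_ne]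
    rwa [hc.2 i hij]
  · rw [G.turn_single_of_ne hb, G.shift_single_last hc, map_zero, map_zero]

lemma commute_turn_turn {i j : Fin n} (hij : i ≠ j) (s : I i) (t : I j) :
    Commute (G.turn i s) (G.turn j t) := by
  refine LinearMap.pi_ext fun a m => ?_
  rw [Module.End.mul_apply, Module.End.mul_apply]
  by_cases hb : (a i : ℕ) + 1 = p i <;> by_cases hc : (a j : ℕ) + 1 = p j
  · have hb' := isWrap_update hb
    have hc' := isWrap_update hc
    have hcd := isWrap_update (i := i) (a := Function.update a j ⟨0, (a j).pos⟩)
      (by rw [hc'.2.2 i hij, hb])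
    have hbd := isWrap_update (i := j) (a := Function.update a i ⟨0, (a i).pos⟩)
      (by rw [hb'.2.2 j hij.symm, hc])
    rw [G.turn_single hb', G.turn_single hc', G.turn_single hbd, G.turn_single hcd]
    -- The two orders of wrapping end at indices that are equal by `Function.update_comm`; the
    -- components there must be identified before `wrap_wrap` can be used.
    have e : Function.update (Function.update a i ⟨0, (a i).pos⟩) j
        ⟨0, (Function.update a i ⟨0, (a i).pos⟩ j).pos⟩ =
      Function.update (Function.update a j ⟨0, (a j).pos⟩) i
        ⟨0, (Function.update a j ⟨0, (a j).pos⟩ i).pos⟩ := Function.update_comm hij _ _ _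
    generalize Function.update (Function.update a i ⟨0, (a i).pos⟩) j
        ⟨0, (Function.update a i ⟨0, (a i).pos⟩ j).pos⟩ = d at hbd e ⊢
    subst e
    rw [G.wrap_wrap hij hb' hbd hc' hcd]
  · rw [G.turn_single (isWrap_update hb), G.turn_single_of_ne hc, map_zero, G.turn_single_of_ne]
    rwa [(isWrap_update hb).2.2 j hij.symm]
  · rw [G.turn_single (isWrap_update hc), G.turn_single_of_ne hb, map_zero, G.turn_single_of_ne]
    rwa [(isWrap_update hc).2.2 i hij]
  · rw [G.turn_single_of_ne hb, G.turn_single_of_ne hc, map_zero, map_zero]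

/-- The centralizer of y is a subring, so `TriRel.hom_mem` reduces the claim to the generators. -/
lemma commute_of_generators {i : Fin n} {y : Module.End R (∀ a, M a)}
    (h1 : ∀ c, Commute (proj R M i c) y) (h2 : Commute (G.shift i) y)
    (h3 : ∀ s, Commute (G.turn i s) y) (x : triangular (p i) (I i)) :
    Commute ((G.triRel i).hom x) y := by
  have := (G.triRel i).hom_mem (Subring.centralizer {y}) ?_ ?_ ?_ ?_ x
  · exact (Subring.mem_centralizer_iff.mp this y rfl).symm
  · exact fun r => Subring.mem_centralizer_iff.mpr fun _ h => h ▸ (Algebra.commutes r y).symm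
  · exact fun c => Subring.mem_centralizer_iff.mpr fun _ h => h ▸ (h1 c).symm
  · exact Subring.mem_centralizer_iff.mpr fun _ h => h ▸ h2.symm
  · exact fun s => Subring.mem_centralizer_iff.mpr fun _ h => h ▸ (h3 s).symm

/-- The reduction to generators is applied in both arguments, which leaves the commutation of
projections, shifts and turns of two different directions. -/
lemma commute_hom_hom (i j : Fin n) (hij : i ≠ j) (x : triangular (p i) (I i))
    (y : triangular (p j) (I j)) : Commute ((G.triRel i).hom x) ((G.triRel j).hom y) := by
  refine G.commute_of_generators (fun c => ?_) ?_ (fun s => ?_) x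
  · exact (G.commute_of_generators (fun d => commute_proj_proj j i d c)
      (G.commute_proj_shift hij c).symm (fun t => (G.commute_proj_turn hij c t).symm) y).symm
  · exact (G.commute_of_generators (fun d => G.commute_proj_shift hij.symm d)
      (G.commute_shift_shift hij.symm) (fun t => G.commute_turn_shift hij.symm t) y).symm
  · exact (G.commute_of_generators (fun d => G.commute_proj_turn hij.symm d s)
      (G.commute_turn_shift hij s).symm (fun t => G.commute_turn_turn hij.symm t s) y).symm

/-- The action of `⨂ᵢ T_{pᵢ}(R, Iᵢ)` on the sum of the modules in a grid. -/
def act : tensorOrder p I →ₐ[R] Module.End R (∀ a, M a) :=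
  liftCommuting (fun i => (G.triRel i).hom) G.commute_hom_hom

lemma act_inFactor (i : Fin n) (x : triangular (p i) (I i)) :
    G.act (inFactor i x) = (G.triRel i).hom x :=
  liftCommuting_single _ _ _ _

/-- If b and a differ in coordinate i, the idempotent of index a absorbs on its right the i-th
diagonal unit with entry at a_i. That unit acts as a projection that kills M b. -/
lemma act_idem_of_ne {a b : Idx p} (h : b ≠ a) (m : M b) :
    G.act (idem I a) (Pi.single b m) = 0 := by
  obtain ⟨i, hi⟩ := Function.ne_iff.mp h
  have e : idem I a * inFactor i (triSingle (I i) (a i) (a i) 1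
      (fun h => absurd h (lt_irrefl (a i)))) = idem I a := by
    refine (PiTensorProduct.tprod_mul_tprod _ _).trans (congrArg _ (funext fun j => ?_))
    by_cases hj : j = i
    · subst hj
      simp only [Function.update_self, triSingle_mul, Pi.mul_apply, Pi.one_apply, mul_one]
    · simp [Function.update_of_ne hj]
  rw [← e, map_mul, act_inFactor, (G.triRel i).hom_idem, Module.End.mul_apply]
  exact (congrArg (G.act (idem I a)) (proj_single_of_ne hi m)).trans (map_zero _)

/-- The idempotents sum to the identity, and all of them except the one of index a kill this
component. -/
lemma act_idem_self (a : Idx p) (m : M a) :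
    G.act (idem I a) (Pi.single a m) = Pi.single a m := by
  have h : G.act (∑ b, idem I b) (Pi.single a m) = Pi.single a m := by
    rw [sum_idem, map_one]; rfl
  rw [map_sum, LinearMap.sum_apply, Finset.sum_eq_single a] at h
  · exact h
  · exact fun b _ hb => G.act_idem_of_ne hb.symm m
  · simp

lemma act_stepUnit {i : Fin n} {a b : Idx p} (h : IsStep i a b) (m : M a) :
    G.act (stepUnit I h) (Pi.single a m) = Pi.single b (G.step i a b h m) := by
  rw [← inFactor_mul_idem_step, map_mul, Module.End.mul_apply, act_idem_self, act_inFactor,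
    (G.triRel i).hom_step _ _ h.1, Module.End.mul_apply]
  exact (congrArg (G.shift i) (proj_single i a m)).trans (G.shift_single h m)

lemma act_wrapUnit {i : Fin n} {a b : Idx p} (h : IsWrap i a b) (s : I i) (m : M a) :
    G.act (wrapUnit h s) (Pi.single a m) = Pi.single b (G.wrap i a b h s m) := by
  rw [← inFactor_mul_idem_wrap, map_mul, Module.End.mul_apply, act_idem_self, act_inFactor,
    (G.triRel i).hom_wrap _ _ _ h.1 h.2.1]
  exact G.turn_single h s m

lemma act_stepUnit_of_ne {i : Fin n} {a b c : Idx p} (h : IsStep i a b) (hc : c ≠ a) (m : M c) :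
    G.act (stepUnit I h) (Pi.single c m) = 0 := by
  rw [← inFactor_mul_idem_step, map_mul, Module.End.mul_apply, G.act_idem_of_ne hc, map_zero]

lemma act_wrapUnit_of_ne {i : Fin n} {a b c : Idx p} (h : IsWrap i a b) (hc : c ≠ a) (s : I i)
    (m : M c) : G.act (wrapUnit h s) (Pi.single c m) = 0 := by
  rw [← inFactor_mul_idem_wrap, map_mul, Module.End.mul_apply, G.act_idem_of_ne hc, map_zero]

end ModuleGrid
end ModuleGrid

end GLOrder
end

/-! ### Modules over the sheaf of algebras as 𝒪-modules with an action -/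

noncomputable section
namespace GLOrder
variable {X : Scheme.{u}} {n : ℕ} {L : Fin n → X.IdealSheafData} {p : Fin n → ℕ}
  {M N N' : X.Modules} {U V : X.Opens}

/-- A morphism of sheaves of modules, from compatible linear maps on sections. -/
def secHom (φ : ∀ U : X.Opens, Γ(M, U) →ₗ[Γ(X, U)] Γ(N, U))
    (nat : ∀ (U V : X.Opens) (h : V ≤ U) m, φ V (M.presheaf.map (homOfLE h).op m) =
      N.presheaf.map (homOfLE h).op (φ U m)) : M ⟶ N where
  val :=
    { app U := ModuleCat.ofHom (X := M.val.obj U) (Y := N.val.obj U) (φ U.unop)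
      naturality {U V} f := by
        ext x
        exact nat U.unop V.unop f.unop.le x }

/-- The linear map on sections induced by a morphism of sheaves of modules. -/
def secMap (f : M ⟶ N) (U : X.Opens) : Γ(M, U) →ₗ[Γ(X, U)] Γ(N, U) where
  toFun := f.app U
  map_add' := map_add (f.app U).hom
  map_smul' := f.app_smul

lemma app_map (f : M ⟶ N) (h : V ≤ U) (m : Γ(M, U)) :
    f.app V (M.presheaf.map (homOfLE h).op m) = N.presheaf.map (homOfLE h).op (f.app U m) :=
  ConcreteCategory.congr_hom (f.mapPresheaf.naturality (homOfLE h).op) m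

lemma hom_ext_sections {f g : M ⟶ N} (h : ∀ (U : X.Opens) (m : Γ(M, U)), f.app U m = g.app U m) :
    f = g := by
  refine Scheme.Modules.hom_ext _ _ fun U => ?_
  ext m
  exact h U m

lemma comp_app_apply (f : M ⟶ N) (g : N ⟶ N') (m : Γ(M, U)) :
    (f ≫ g).app U m = g.app U (f.app U m) := rfl

lemma id_app_apply (m : Γ(M, U)) : Scheme.Modules.Hom.app (𝟙 M) U m = m := rfl

lemma sum_app_apply {J : Type*} (s : Finset J) (f : J → (M ⟶ N)) (m : Γ(M, U)) :
    (∑ j ∈ s, f j).app U m = ∑ j ∈ s, (f j).app U m := by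
  classical
  induction s using Finset.induction_on with
  | empty => rfl
  | insert j s hj ih =>
    rw [Finset.sum_insert hj, Finset.sum_insert hj, ← ih]
    rfl

/-- The sections over `U` of the presheaf of algebras `preOrder L p`. -/
abbrev PreOrd (L : Fin n → X.IdealSheafData) (p : Fin n → ℕ) (U : X.Opens) : Type u :=
  tensorOrder (R := Γ(X, U)) p fun i => idealSections (L i) U

/-- The restriction maps of `preOrder L p`. -/
def preOrdRes (h : V ≤ U) : PreOrd L p U →+* PreOrd L p V :=
  tensorOrderMap p (X.presheaf.map (homOfLE h).op).hom
    fun i => idealSections_map (L i) (homOfLE h).op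

/-- The map from `preOrder L p` to its sheafification. -/
def toOrderPresheaf (L : Fin n → X.IdealSheafData) (p : Fin n → ℕ) :
    preOrder L p ⟶ (order L p).obj :=
  toSheafify (Opens.grothendieckTopology X) (preOrder L p)

instance : Presheaf.IsLocallyInjective (Opens.grothendieckTopology X) (toOrderPresheaf L p) :=
  inferInstanceAs (Presheaf.IsLocallyInjective _ (toSheafify _ (preOrder L p)))

instance : Presheaf.IsLocallySurjective (Opens.grothendieckTopology X) (toOrderPresheaf L p) :=
  inferInstanceAs (Presheaf.IsLocallySurjective _ (toSheafify _ (preOrder L p)))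

/-- An action of the presheaf of algebras `preOrder L p` on a sheaf of `𝒪_X`-modules. -/
structure OrderAction (L : Fin n → X.IdealSheafData) (p : Fin n → ℕ) (N : X.Modules) where
  /-- the action on sections -/
  act (U : X.Opens) : PreOrd L p U →ₐ[Γ(X, U)] Module.End Γ(X, U) Γ(N, U)
  nat (U V : X.Opens) (h : V ≤ U) (c : PreOrd L p U) (m : Γ(N, U)) :
    N.presheaf.map (homOfLE h).op (act U c m) =
      act V (preOrdRes h c) (N.presheaf.map (homOfLE h).op m)

/-- The action on the sheaf of `𝒪_X`-modules that underlies a sheaf of modules over the order. -/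
def orderAction (M : SheafOfModules.{u} (order L p)) :
    OrderAction L p ((orderForget L p).obj M) where
  act U :=
    let φ : PreOrd L p U →+* (order L p).obj.obj (op U) :=
      ((toOrderPresheaf L p).app (op U)).hom
    let m : Module ((order L p).obj.obj (op U)) (M.val.obj (op U)) := inferInstance
    have hr (r : Γ(X, U)) (x : Γ((orderForget L p).obj M, U)) :
      (φ (algebraMap Γ(X, U) (PreOrd L p U) r) • (show M.val.obj (op U) from x)) =
        (show M.val.obj (op U) from r • x) := rfl
    { toFun c :=
        { toFun x := φ c • (show M.val.obj (op U) from x)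
          map_add' x y := smul_add (φ c) (show M.val.obj (op U) from x) _
          map_smul' r x := by
            rw [RingHom.id_apply]
            refine Eq.trans ?_ (hr r _)
            refine (congrArg (φ c • ·) (hr r x).symm).trans ?_
            refine (mul_smul (φ c) (φ (algebraMap Γ(X, U) (PreOrd L p U) r))
              (show M.val.obj (op U) from x)).symm.trans ?_
            refine Eq.trans (congrArg (· • (show M.val.obj (op U) from x)) ?_)
              (mul_smul (φ (algebraMap Γ(X, U) (PreOrd L p U) r)) (φ c)
                (show M.val.obj (op U) from x))
            rw [← map_mul, ← map_mul, Algebra.commutes] }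
      map_one' := LinearMap.ext fun x => by
        refine (congrArg (· • (show M.val.obj (op U) from x)) (map_one φ)).trans ?_
        exact one_smul _ (show M.val.obj (op U) from x)
      map_zero' := LinearMap.ext fun x => by
        refine (congrArg (· • (show M.val.obj (op U) from x)) (map_zero φ)).trans ?_
        exact zero_smul _ (show M.val.obj (op U) from x)
      map_mul' c d := LinearMap.ext fun x => by
        refine (congrArg (· • (show M.val.obj (op U) from x)) (map_mul φ c d)).trans ?_
        exact mul_smul _ _ (show M.val.obj (op U) from x)
      map_add' c d := LinearMap.ext fun x => by
        refine (congrArg (· • (show M.val.obj (op U) from x)) (map_add φ c d)).trans ?_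
        exact add_smul _ _ (show M.val.obj (op U) from x)
      commutes' r := LinearMap.ext fun x => hr r x }
  nat U V h c m := by
    have h1 := M.val.map_smul (homOfLE h).op
      (((toOrderPresheaf L p).app (op U)) c) m
    refine h1.trans ?_
    refine congrArg (· • (show M.val.obj (op V) from M.val.map (homOfLE h).op m)) ?_
    exact (NatTrans.naturality_apply (toOrderPresheaf L p)
      (homOfLE h).op c).symm

/-- A morphism of sheaves of modules that is compatible with given actions. -/
def IsEquivariant (α : OrderAction L p N) (β : OrderAction L p N') (f : N ⟶ N') : Prop :=
  ∀ (U : X.Opens) (c : PreOrd L p U) (m : Γ(N, U)),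
    f.app U (α.act U c m) = β.act U c (f.app U m)

lemma isEquivariant_map {M M' : SheafOfModules.{u} (order L p)} (f : M ⟶ M') :
    IsEquivariant (orderAction M) (orderAction M') ((orderForget L p).map f) := fun U _ _ =>
  (f.val.app (op U)).hom.map_smul _ _

/-- Equivariance speaks of the presheaf of algebras only. The map to its sheafification is locally
surjective and the target is a sheaf, so linearity over the presheaf extends to linearity over the
order. -/
lemma exists_map_eq {M M' : SheafOfModules.{u} (order L p)}
    (f : (orderForget L p).obj M ⟶ (orderForget L p).obj M')
    (hf : IsEquivariant (orderAction M) (orderAction M') f) :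
    ∃ g : M ⟶ M', (orderForget L p).map g = f := by
  let α := toOrderPresheaf L p
  let e := PresheafOfModules.restrictHomEquivOfIsLocallySurjective
    (J := Opens.grothendieckTopology X) α (M₁ := M.val) (M₂ := M'.val) M'.isSheaf
  let f' : (PresheafOfModules.restrictScalars α).obj M.val ⟶
      (PresheafOfModules.restrictScalars α).obj M'.val :=
    PresheafOfModules.homMk f.mapPresheaf
      (fun U c m => hf U.unop c m)
  refine ⟨⟨e.symm f'⟩, ?_⟩
  refine hom_ext_sections fun U m => ?_
  rfl

/-- The underlying sheaf of abelian groups. -/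
def absheaf (N : X.Modules) : Sheaf (Opens.grothendieckTopology X) Ab.{u} :=
  ⟨N.presheaf, N.isSheaf⟩

/-- The presheaf of modules over `preOrder L p` that corresponds to an action. -/
def OrderAction.presheafOfModules (α : OrderAction L p N) :
    PresheafOfModules.{u} (preOrder L p) :=
  letI (U : X.Opensᵒᵖ) : Module ((preOrder L p).obj U) (N.presheaf.obj U) :=
    Module.compHom (R := Module.End Γ(X, U.unop) Γ(N, U.unop)) Γ(N, U.unop)
      (α.act U.unop).toRingHom
  PresheafOfModules.ofPresheaf N.presheaf fun {U V} f c m => α.nat U.unop V.unop f.unop.le c m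

/-- The identification of the underlying presheaves of abelian groups. -/
def OrderAction.toAbsheaf (α : OrderAction L p N) :
    α.presheafOfModules.presheaf ⟶ (absheaf N).obj := 𝟙 N.presheaf

instance (α : OrderAction L p N) : IsIso α.toAbsheaf := inferInstanceAs (IsIso (𝟙 N.presheaf))

/-- The sheaf of modules over the order that corresponds to an action of `preOrder L p`. -/
def OrderAction.module (α : OrderAction L p N) : SheafOfModules.{u} (order L p) :=
  PresheafOfModules.sheafify (R := order L p)
    (toOrderPresheaf L p)
    (M₀ := α.presheafOfModules) (A := absheaf N) α.toAbsheaf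

/-- The underlying abelian presheaf is a sheaf already, so the unit of this sheafification is the
identity on sections; its semilinearity is the claim. -/
lemma OrderAction.module_act (α : OrderAction L p N) (c : PreOrd L p U) (m : Γ(N, U)) :
    (orderAction α.module).act U c m = α.act U c m :=
  (((PresheafOfModules.toSheafify (R := order L p)
    (toOrderPresheaf L p)
    (M₀ := α.presheafOfModules) (A := absheaf N) α.toAbsheaf).app
      (op U)).hom.map_smul c m).symm

/-- The sheaf of `𝒪_X`-modules that underlies `α.module`. -/
def OrderAction.forgetIso (α : OrderAction L p N) : (orderForget L p).obj α.module ≅ N where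
  hom := secHom (fun U =>
    { toFun m := m
      map_add' _ _ := rfl
      map_smul' r m := by
        have h := α.module_act (U := U) (algebraMap _ _ r) m
        rw [AlgHom.commutes, AlgHom.commutes] at h
        exact h }) fun _ _ _ _ => rfl
  inv := secHom (fun U =>
    { toFun m := m
      map_add' _ _ := rfl
      map_smul' r m := by
        have h := α.module_act (U := U) (algebraMap _ _ r) m
        rw [AlgHom.commutes, AlgHom.commutes] at h
        exact h.symm }) fun _ _ _ _ => rfl
  hom_inv_id := rfl
  inv_hom_id := rfl

lemma OrderAction.isEquivariant_forgetIso_hom (α : OrderAction L p N) :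
    IsEquivariant (orderAction α.module) α α.forgetIso.hom := fun _ c m => α.module_act c m

lemma OrderAction.isEquivariant_forgetIso_inv (α : OrderAction L p N) :
    IsEquivariant α (orderAction α.module) α.forgetIso.inv := fun _ c m => (α.module_act c m).symm

/-- A morphism is equivariant if it is compatible with the action of the generators. -/
lemma isEquivariant_of_generators (α : OrderAction L p N) (β : OrderAction L p N') (f : N ⟶ N')
    (h1 : ∀ (U : X.Opens) (a : Idx p) (m : Γ(N, U)),
      f.app U (α.act U (idem _ a) m) = β.act U (idem _ a) (f.app U m))
    (h2 : ∀ (U : X.Opens) (i : Fin n) (a b : Idx p) (h : IsStep i a b) (m : Γ(N, U)),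
      f.app U (α.act U (stepUnit _ h) m) = β.act U (stepUnit _ h) (f.app U m))
    (h3 : ∀ (U : X.Opens) (i : Fin n) (a b : Idx p) (h : IsWrap i a b)
      (s : idealSections (L i) U) (m : Γ(N, U)),
      f.app U (α.act U (wrapUnit h s) m) = β.act U (wrapUnit h s) (f.app U m)) :
    IsEquivariant α β f := by
  intro U
  let S : Subring (PreOrd L p U) :=
    { carrier := {c | ∀ m, f.app U (α.act U c m) = β.act U c (f.app U m)}
      mul_mem' {c d} hc hd m := by
        rw [map_mul, map_mul, Module.End.mul_apply, Module.End.mul_apply, hc, hd]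
      one_mem' m := by rw [map_one, map_one]; rfl
      add_mem' {c d} hc hd m := by
        rw [map_add, map_add, LinearMap.add_apply, LinearMap.add_apply, ← hc, ← hd, map_add]
      zero_mem' m := by
        rw [map_zero, map_zero, LinearMap.zero_apply, LinearMap.zero_apply, map_zero]
      neg_mem' {c} hc m := by
        rw [map_neg, map_neg, LinearMap.neg_apply, LinearMap.neg_apply, ← hc, map_neg] }
  -- Sections of the algebra whose action commutes with f form a subring. It contains the scalars
  -- because f is 𝒪-linear, and the other generators by hypothesis.
  have hS : S = ⊤ := tensorOrder_subring_eq_top S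
    (fun r m => by
      rw [AlgHom.commutes, AlgHom.commutes, Module.algebraMap_end_apply,
        Module.algebraMap_end_apply, f.app_smul])
    (h1 U) (h2 U) (h3 U)
  intro c m
  exact (hS ▸ Subring.mem_top c : c ∈ S) m

end GLOrder
end

/-! ### Peirce components of an 𝒪-module with an action -/

noncomputable section
namespace GLOrder
variable {X : Scheme.{u}} {n : ℕ} {L : Fin n → X.IdealSheafData} {p : Fin n → ℕ}
  {M N N' : X.Modules} {U V : X.Opens}

namespace OrderAction
variable (α : OrderAction L p N) (β : OrderAction L p N')

/-- The endomorphism by which a global section of `preOrder L p` acts. -/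
def endo (x : ∀ U : X.Opens, PreOrd L p U)
    (hx : ∀ (U V : X.Opens) (h : V ≤ U), preOrdRes h (x U) = x V) : N ⟶ N :=
  secHom (fun U => α.act U (x U)) fun U V h m => by rw [α.nat U V h, hx U V h]

/-- The idempotent endomorphism of index `a`. -/
def idemEnd (a : Idx p) : N ⟶ N :=
  α.endo (fun _ => idem _ a) fun _ _ _ => tensorOrderMap_idem _ _ a

/-- The endomorphism of a step. -/
def stepEnd {i : Fin n} {a b : Idx p} (h : IsStep i a b) : N ⟶ N :=
  α.endo (fun _ => stepUnit _ h) fun _ _ _ => tensorOrderMap_stepUnit _ _ h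

/-- The endomorphism of a sequence of steps. -/
def lowerEnd {a b : Idx p} (h : a ≤ b) : N ⟶ N :=
  α.endo (fun _ => lowerUnit _ b a h) fun _ _ _ => tensorOrderMap_lowerUnit _ _ h

lemma preOrdRes_wrapUnit {i : Fin n} {a b : Idx p} (h : IsWrap i a b) (hVU : V ≤ U)
    (s : idealSections (L i) U) :
    preOrdRes hVU (wrapUnit (I := fun i => idealSections (L i) U) h s) =
      wrapUnit (I := fun i => idealSections (L i) V) h (idealRes hVU s) :=
  tensorOrderMap_wrapUnit (I := fun i => idealSections (L i) U)
    (J := fun i => idealSections (L i) V) (X.presheaf.map (homOfLE hVU).op).hom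
    (fun i => idealSections_map (L i) (homOfLE hVU).op) h s

lemma act_wrapUnit_add {i : Fin n} {a b : Idx p} (h : IsWrap i a b) (m : Γ(N, U))
    (s s' : idealSections (L i) U) :
    α.act U (wrapUnit h (s + s')) m = α.act U (wrapUnit h s) m + α.act U (wrapUnit h s') m := by
  rw [wrapUnit_add, map_add, LinearMap.add_apply]

lemma act_wrapUnit_smul {i : Fin n} {a b : Idx p} (h : IsWrap i a b) (r : Γ(X, U)) (m : Γ(N, U))
    (s : idealSections (L i) U) :
    α.act U (wrapUnit h (r • s)) m = r • α.act U (wrapUnit h s) m := by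
  rw [wrapUnit_smul, map_mul, AlgHom.commutes, Module.End.mul_apply, Module.algebraMap_end_apply]

/-- The bilinear maps that wrap around. -/
def wrapBilin {i : Fin n} {a b : Idx p} (h : IsWrap i a b) : TwistBilin (L i) N N where
  map U m s := α.act U (wrapUnit h s) m
  add_left _ m m' _ := map_add _ m m'
  add_right _ m s s' := α.act_wrapUnit_add h m s s'
  smul_left _ r m _ := map_smul _ r m
  smul_right _ r m s := α.act_wrapUnit_smul h r m s
  nat U V hVU m s := (α.nat U V hVU _ m).trans
    (congrArg (fun c => α.act V c (N.presheaf.map (homOfLE hVU).op m)) (preOrdRes_wrapUnit h hVU s))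

/-- The morphism `N ⊗ 𝒪(-Lᵢ) ⟶ N` that wraps around. -/
def wrapMor {i : Fin n} {a b : Idx p} (h : IsWrap i a b) : (twist (L i)).obj N ⟶ N :=
  (α.wrapBilin h).lift

lemma idemEnd_app (a : Idx p) (m : Γ(N, U)) : (α.idemEnd a).app U m = α.act U (idem _ a) m := rfl

lemma stepEnd_app {i : Fin n} {a b : Idx p} (h : IsStep i a b) (m : Γ(N, U)) :
    (α.stepEnd h).app U m = α.act U (stepUnit _ h) m := rfl

lemma lowerEnd_app {a b : Idx p} (h : a ≤ b) (m : Γ(N, U)) :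
    (α.lowerEnd h).app U m = α.act U (lowerUnit _ b a h) m := rfl

lemma wrapMor_tw {i : Fin n} {a b : Idx p} (h : IsWrap i a b) (m : Γ(N, U))
    (s : idealSections (L i) U) : (α.wrapMor h).app U (tw m s) = α.act U (wrapUnit h s) m :=
  (α.wrapBilin h).lift_tw m s

lemma act_act (c d : PreOrd L p U) (m : Γ(N, U)) :
    α.act U c (α.act U d m) = α.act U (c * d) m := by rw [map_mul]; rfl

lemma idemEnd_comp_self (a : Idx p) : α.idemEnd a ≫ α.idemEnd a = α.idemEnd a :=
  hom_ext_sections fun U m => by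
    rw [comp_app_apply, idemEnd_app, idemEnd_app, act_act, idem_mul_self]

lemma sum_idemEnd : ∑ a : Idx p, α.idemEnd a = 𝟙 N :=
  hom_ext_sections fun U m => by
    rw [sum_app_apply, id_app_apply]
    simp only [idemEnd_app]
    rw [← LinearMap.sum_apply, ← map_sum, sum_idem, map_one]
    rfl

lemma idemEnd_comp_of_ne {a b : Idx p} (h : a ≠ b) : α.idemEnd a ≫ α.idemEnd b = 0 :=
  hom_ext_sections fun U m => by
    rw [comp_app_apply, idemEnd_app, idemEnd_app, act_act, idem_mul_of_ne h.symm, map_zero]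
    rfl

lemma stepEnd_comp_idemEnd {i : Fin n} {a b : Idx p} (h : IsStep i a b) :
    α.stepEnd h ≫ α.idemEnd b = α.stepEnd h :=
  hom_ext_sections fun U m => by
    rw [comp_app_apply, idemEnd_app, stepEnd_app, act_act, stepUnit, idem_mul_unitTensor]

lemma idemEnd_comp_stepEnd {i : Fin n} {a b : Idx p} (h : IsStep i a b) :
    α.idemEnd a ≫ α.stepEnd h = α.stepEnd h :=
  hom_ext_sections fun U m => by
    rw [comp_app_apply, idemEnd_app, stepEnd_app, stepEnd_app, act_act, stepUnit,
      unitTensor_mul_idem]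

lemma lowerEnd_comp_idemEnd {a b : Idx p} (h : a ≤ b) :
    α.lowerEnd h ≫ α.idemEnd b = α.lowerEnd h :=
  hom_ext_sections fun U m => by
    rw [comp_app_apply, idemEnd_app, lowerEnd_app, act_act, lowerUnit, idem_mul_unitTensor]

lemma lowerEnd_comp_stepEnd {i : Fin n} {a b c : Idx p} (h : a ≤ b) (h' : IsStep i b c) :
    α.lowerEnd h ≫ α.stepEnd h' = α.lowerEnd (h.trans h'.le) :=
  hom_ext_sections fun U m => by
    rw [comp_app_apply, stepEnd_app, lowerEnd_app, lowerEnd_app, act_act, stepUnit_mul_lowerUnit]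

lemma wrapMor_comp_idemEnd {i : Fin n} {a b : Idx p} (h : IsWrap i a b) :
    α.wrapMor h ≫ α.idemEnd b = α.wrapMor h :=
  twist_hom_ext fun U m s => by
    rw [comp_app_apply, idemEnd_app, wrapMor_tw, act_act, idem_mul_wrapUnit]

lemma map_idemEnd_comp_wrapMor {i : Fin n} {a b : Idx p} (h : IsWrap i a b) :
    (twist (L i)).map (α.idemEnd a) ≫ α.wrapMor h = α.wrapMor h :=
  twist_hom_ext fun U m s => by
    rw [comp_app_apply, twist_map_tw, wrapMor_tw, wrapMor_tw, idemEnd_app, act_act,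
      wrapUnit_mul_idem]

lemma stepEnd_comp_stepEnd {i j : Fin n} {a b c d : Idx p} (hab : IsStep i a b)
    (hbd : IsStep j b d) (hac : IsStep j a c) (hcd : IsStep i c d) :
    α.stepEnd hab ≫ α.stepEnd hbd = α.stepEnd hac ≫ α.stepEnd hcd :=
  hom_ext_sections fun U m => by
    rw [comp_app_apply, comp_app_apply, stepEnd_app, stepEnd_app, stepEnd_app, stepEnd_app,
      act_act, act_act, stepUnit_mul_stepUnit hab hbd hac hcd]

lemma wrapMor_comp_stepEnd {i j : Fin n} {a b c d : Idx p} (hab : IsWrap i a b)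
    (hbd : IsStep j b d) (hac : IsStep j a c) (hcd : IsWrap i c d) :
    α.wrapMor hab ≫ α.stepEnd hbd = (twist (L i)).map (α.stepEnd hac) ≫ α.wrapMor hcd :=
  twist_hom_ext fun U m s => by
    rw [comp_app_apply, comp_app_apply, twist_map_tw, wrapMor_tw, wrapMor_tw, stepEnd_app,
      stepEnd_app, act_act, act_act, stepUnit_mul_wrapUnit hab hbd hac hcd]

/-- On (m ⊗ s) ⊗ t the canonical isomorphism exchanges s and t, and the two products of corner
elements agree because s and t are commuting scalars. -/
lemma map_wrapMor_comp_wrapMor {i j : Fin n} {a b c d : Idx p} (hab : IsWrap i a b)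
    (hbd : IsWrap j b d) (hac : IsWrap j a c) (hcd : IsWrap i c d) :
    (twist (L j)).map (α.wrapMor hab) ≫ α.wrapMor hbd =
      (twistComm (L i) (L j)).hom.app N ≫ (twist (L i)).map (α.wrapMor hac) ≫ α.wrapMor hcd :=
  twist_twist_hom_ext fun U m s t => by
    rw [comp_app_apply, twist_map_tw, wrapMor_tw, wrapMor_tw, act_act]
    refine Eq.trans ?_ (congrArg (((twist (L i)).map (α.wrapMor hac) ≫ α.wrapMor hcd).app U)
      (twistComm_tw m s t)).symm
    rw [comp_app_apply, twist_map_tw, wrapMor_tw, wrapMor_tw, act_act,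
      wrapUnit_mul_wrapUnit hab hbd hac hcd]

/-- On all of N a full turn is η followed by the projection onto component a; the idempotent
disappears after restriction to that component, in `comp_cycle`. -/
lemma map_lowerEnd_comp_wrapMor_comp_lowerEnd {i : Fin n} {a b c : Idx p} (hab : a ≤ b)
    (hca : c ≤ a) (hbc : IsWrap i b c) :
    (twist (L i)).map (α.lowerEnd hab) ≫ α.wrapMor hbc ≫ α.lowerEnd hca =
      (twistToId (L i)).app N ≫ α.idemEnd a :=
  twist_hom_ext fun U m s => by
    rw [comp_app_apply, comp_app_apply, twist_map_tw, wrapMor_tw, lowerEnd_app, lowerEnd_app,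
      act_act, act_act, mul_assoc, lowerUnit_mul_wrapUnit_mul_lowerUnit hab hca hbc]
    refine Eq.trans ?_ (congrArg ((α.idemEnd a).app U) (twistToId_tw m s)).symm
    rw [idemEnd_app, map_mul, AlgHom.commutes, Module.End.mul_apply, Module.algebraMap_end_apply,
      map_smul]

/-- Sheaves of modules form an abelian category, so idempotents split. The splitting is chosen
arbitrarily, and only its two equations are used afterwards. -/
lemma exists_split (a : Idx p) : ∃ (Y : X.Modules) (i : Y ⟶ N) (r : N ⟶ Y),
    i ≫ r = 𝟙 Y ∧ r ≫ i = α.idemEnd a :=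
  IsIdempotentComplete.idempotents_split N (α.idemEnd a) (α.idemEnd_comp_self a)

/-- The component of index `a`. -/
def comp (a : Idx p) : X.Modules := (α.exists_split a).choose

/-- The inclusion of the component of index `a`. -/
def inc (a : Idx p) : α.comp a ⟶ N := (α.exists_split a).choose_spec.choose

/-- The projection to the component of index `a`. -/
def proj (a : Idx p) : N ⟶ α.comp a := (α.exists_split a).choose_spec.choose_spec.choose

lemma inc_proj (a : Idx p) : α.inc a ≫ α.proj a = 𝟙 _ :=
  (α.exists_split a).choose_spec.choose_spec.choose_spec.1

lemma proj_inc (a : Idx p) : α.proj a ≫ α.inc a = α.idemEnd a :=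
  (α.exists_split a).choose_spec.choose_spec.choose_spec.2

lemma inc_proj_assoc (a : Idx p) {Z : X.Modules} (f : α.comp a ⟶ Z) :
    α.inc a ≫ α.proj a ≫ f = f := by rw [← Category.assoc, inc_proj, Category.id_comp]

lemma proj_inc_assoc (a : Idx p) {Z : X.Modules} (f : N ⟶ Z) :
    α.proj a ≫ α.inc a ≫ f = α.idemEnd a ≫ f := by rw [← Category.assoc, proj_inc]

end OrderAction
end GLOrder
end

/-! ### The functor from modules over the order to grids -/

noncomputable section
namespace GLOrder
variable {X : Scheme.{u}} {n : ℕ} {L : Fin n → X.IdealSheafData} {p : Fin n → ℕ}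
  {M N N' : X.Modules} {U V : X.Opens}
  (hc : ∀ (i : Fin n) (M : X.Modules), IsCoherent M → IsCoherent (((twistData L).F i).obj M))

namespace OrderAction
variable (α : OrderAction L p N) (β : OrderAction L p N')

lemma stepEnd_comp_idemEnd_assoc {i : Fin n} {a b : Idx p} (h : IsStep i a b) {Z : X.Modules}
    (f : N ⟶ Z) : α.stepEnd h ≫ α.idemEnd b ≫ f = α.stepEnd h ≫ f := by
  rw [← Category.assoc, stepEnd_comp_idemEnd]

lemma lowerEnd_comp_idemEnd_assoc {a b : Idx p} (h : a ≤ b) {Z : X.Modules}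
    (f : N ⟶ Z) : α.lowerEnd h ≫ α.idemEnd b ≫ f = α.lowerEnd h ≫ f := by
  rw [← Category.assoc, lowerEnd_comp_idemEnd]

lemma wrapMor_comp_idemEnd_assoc {i : Fin n} {a b : Idx p} (h : IsWrap i a b) {Z : X.Modules}
    (f : N ⟶ Z) : α.wrapMor h ≫ α.idemEnd b ≫ f = α.wrapMor h ≫ f := by
  rw [← Category.assoc, wrapMor_comp_idemEnd]

lemma map_idemEnd_comp_wrapMor_assoc {i : Fin n} {a b : Idx p} (h : IsWrap i a b) {Z : X.Modules}
    (f : N ⟶ Z) : (twist (L i)).map (α.idemEnd a) ≫ α.wrapMor h ≫ f = α.wrapMor h ≫ f := by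
  rw [← Category.assoc, map_idemEnd_comp_wrapMor]

/-- The interior structure morphisms between the components. -/
def stepComp {i : Fin n} {a b : Idx p} (h : IsStep i a b) : α.comp a ⟶ α.comp b :=
  α.inc a ≫ α.stepEnd h ≫ α.proj b

/-- The composites of interior structure morphisms between the components. -/
def lowerComp {a b : Idx p} (h : a ≤ b) : α.comp a ⟶ α.comp b :=
  α.inc a ≫ α.lowerEnd h ≫ α.proj b

/-- The structure morphisms between the components that wrap around. -/
def wrapComp {i : Fin n} {a b : Idx p} (h : IsWrap i a b) :
    (twist (L i)).obj (α.comp a) ⟶ α.comp b :=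
  (twist (L i)).map (α.inc a) ≫ α.wrapMor h ≫ α.proj b

lemma lowerComp_refl (a : Idx p) : α.lowerComp (le_refl a) = 𝟙 (α.comp a) := by
  have : α.lowerEnd (le_refl a) = α.idemEnd a := rfl
  rw [lowerComp, this, ← proj_inc, Category.assoc, inc_proj, inc_proj_assoc]

lemma lowerComp_comp_stepComp {i : Fin n} {a b c : Idx p} (h : a ≤ b) (h' : IsStep i b c) :
    α.lowerComp h ≫ α.stepComp h' = α.lowerComp (h.trans h'.le) := by
  simp only [lowerComp, stepComp, Category.assoc, proj_inc_assoc, lowerEnd_comp_idemEnd_assoc]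
  rw [← α.lowerEnd_comp_stepEnd h h', Category.assoc]

lemma stepComp_comp_stepComp {i j : Fin n} {a b c d : Idx p} (hab : IsStep i a b)
    (hbd : IsStep j b d) (hac : IsStep j a c) (hcd : IsStep i c d) :
    α.stepComp hab ≫ α.stepComp hbd = α.stepComp hac ≫ α.stepComp hcd := by
  simp only [stepComp, Category.assoc, proj_inc_assoc, stepEnd_comp_idemEnd_assoc]
  rw [← Category.assoc (α.stepEnd hab), α.stepEnd_comp_stepEnd hab hbd hac hcd, Category.assoc]

lemma wrapComp_comp_stepComp {i j : Fin n} {a b c d : Idx p} (hab : IsWrap i a b)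
    (hbd : IsStep j b d) (hac : IsStep j a c) (hcd : IsWrap i c d) :
    α.wrapComp hab ≫ α.stepComp hbd = (twist (L i)).map (α.stepComp hac) ≫ α.wrapComp hcd := by
  simp only [wrapComp, stepComp, Category.assoc, proj_inc_assoc, wrapMor_comp_idemEnd_assoc]
  rw [← Functor.map_comp_assoc, Category.assoc, Category.assoc, proj_inc, stepEnd_comp_idemEnd,
    Functor.map_comp_assoc, ← Category.assoc (α.wrapMor hab),
    α.wrapMor_comp_stepEnd hab hbd hac hcd, Category.assoc]

lemma map_wrapComp_comp_wrapComp {i j : Fin n} {a b d : Idx p} (hab : IsWrap i a b)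
    (hbd : IsWrap j b d) :
    (twist (L j)).map (α.wrapComp hab) ≫ α.wrapComp hbd =
      (twist (L j)).map ((twist (L i)).map (α.inc a)) ≫ (twist (L j)).map (α.wrapMor hab) ≫
        α.wrapMor hbd ≫ α.proj d := by
  rw [wrapComp, wrapComp, ← Functor.map_comp_assoc, Category.assoc, Category.assoc,
    proj_inc, wrapMor_comp_idemEnd, Functor.map_comp_assoc]

/-- The relation holds on N by `map_wrapMor_comp_wrapMor`; naturality of `twistComm` along the
inclusion of the component carries it over. -/
lemma wrapComp_comm {i j : Fin n} {a b c d : Idx p} (hab : IsWrap i a b)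
    (hbd : IsWrap j b d) (hac : IsWrap j a c) (hcd : IsWrap i c d) :
    (twist (L j)).map (α.wrapComp hab) ≫ α.wrapComp hbd =
      (twistComm (L i) (L j)).hom.app (α.comp a) ≫
        (twist (L i)).map (α.wrapComp hac) ≫ α.wrapComp hcd := by
  rw [map_wrapComp_comp_wrapComp, map_wrapComp_comp_wrapComp]
  have nat := (twistComm (L i) (L j)).hom.naturality (α.inc a)
  have e := congrArg (fun f => (twist (L j)).map ((twist (L i)).map (α.inc a)) ≫ f ≫ α.proj d)
    (α.map_wrapMor_comp_wrapMor hab hbd hac hcd)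
  have e' := congrArg (· ≫ (twist (L i)).map (α.wrapMor hac) ≫ α.wrapMor hcd ≫ α.proj d) nat
  simp only [Category.assoc] at e e'
  exact e.trans e'

lemma comp_cycle {i : Fin n} {a b c : Idx p} (hab : a ≤ b) (hca : c ≤ a) (hbc : IsWrap i b c) :
    (twist (L i)).map (α.lowerComp hab) ≫ α.wrapComp hbc ≫ α.lowerComp hca =
      (twistToId (L i)).app (α.comp a) := by
  have nat := (twistToId (L i)).naturality (α.inc a)
  have e2 := congrArg (fun f => (twist (L i)).map (α.inc a) ≫ f ≫ α.proj a)
    (α.map_lowerEnd_comp_wrapMor_comp_lowerEnd hab hca hbc)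
  have e3 := congrArg (· ≫ α.proj a) nat
  rw [lowerComp, lowerComp, wrapComp]
  simp only [Category.assoc] at e2 e3 ⊢
  rw [← Functor.map_comp_assoc, Category.assoc, Category.assoc, proj_inc, lowerEnd_comp_idemEnd,
    proj_inc_assoc, wrapMor_comp_idemEnd_assoc, Functor.map_comp_assoc]
  refine e2.trans ?_
  rw [← proj_inc, Category.assoc, inc_proj, Category.comp_id]
  refine e3.trans ?_
  refine (congrArg ((twistToId (L i)).app (α.comp a) ≫ ·) (α.inc_proj a)).trans ?_
  exact Category.comp_id _

/-- The components as objects of the category of coherent sheaves. -/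
def cohComp (hN : IsCoherent N) (a : Idx p) : (IsCoherent (X := X)).FullSubcategory :=
  ⟨α.comp a, isCoherent_of_retract (α.inc a) (α.proj a) (α.inc_proj a) hN⟩

/-- The interior structure morphisms in the category of coherent sheaves. -/
def cohStep (hN : IsCoherent N) (i : Fin n) (a b : Idx p) (h : IsStep i a b) :
    α.cohComp hN a ⟶ α.cohComp hN b :=
  ObjectProperty.homMk (α.stepComp h)

/-- The structure morphisms that wrap around in the category of coherent sheaves. -/
def cohWrap (hN : IsCoherent N) (i : Fin n) (a b : Idx p) (h : IsWrap i a b) :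
    (((twistData L).restrict IsCoherent hc).F i).obj (α.cohComp hN a) ⟶ α.cohComp hN b :=
  ObjectProperty.homMk (α.wrapComp h)

/-- Each composite of steps is the action of a single lower matrix unit. Thus the cycle axiom, which
quantifies over all climbs, reduces to `comp_cycle`. -/
lemma isClimb_hom (hN : IsCoherent N) {i : Fin n} {a b : Idx p}
    {f : α.cohComp hN a ⟶ α.cohComp hN b} (hf : IsClimb (α.cohStep hN) i f) :
    ∃ h : a ≤ b, f.hom = α.lowerComp h := by
  induction hf with
  | refl => exact ⟨le_rfl, (α.lowerComp_refl _).symm⟩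
  | cons hf h ih =>
    obtain ⟨h', e⟩ := ih
    exact ⟨h'.trans h.le, (congrArg (· ≫ (α.cohStep hN _ _ _ h).hom) e).trans
      (α.lowerComp_comp_stepComp h' h)⟩

/-- The grid of coherent sheaves that corresponds to a coherent sheaf with an action. -/
def grid (hN : IsCoherent N) : Grid ((twistData L).restrict IsCoherent hc) p where
  obj := α.cohComp hN
  step := α.cohStep hN
  wrap := α.cohWrap hc hN
  step_step _ _ _ _ _ hab hbd hac hcd :=
    ObjectProperty.hom_ext _ (α.stepComp_comp_stepComp hab hbd hac hcd)
  wrap_step _ _ _ _ _ hab hbd hac hcd :=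
    ObjectProperty.hom_ext _ (α.wrapComp_comp_stepComp hab hbd hac hcd)
  wrap_wrap _ _ _ _ _ hab hbd hac hcd :=
    ObjectProperty.hom_ext _ (α.wrapComp_comm hab hbd hac hcd)
  cycle {i a b c f g} hf hbc hg := by
    obtain ⟨h, e⟩ := α.isClimb_hom hN hf
    obtain ⟨h', e'⟩ := α.isClimb_hom hN hg
    apply ObjectProperty.hom_ext
    refine Eq.trans ?_ (α.comp_cycle h h' hbc)
    exact congrArg₂ (fun (f : α.comp a ⟶ α.comp b) (g : α.comp c ⟶ α.comp a) =>
      (twist (L i)).map f ≫ α.wrapComp hbc ≫ g) e e'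

end OrderAction

section Hom
variable {α : OrderAction L p N} {β : OrderAction L p N'} {f : N ⟶ N'}

lemma IsEquivariant.idemEnd_comp (hf : IsEquivariant α β f) (a : Idx p) :
    α.idemEnd a ≫ f = f ≫ β.idemEnd a := hom_ext_sections fun U m => hf U _ m

lemma IsEquivariant.stepEnd_comp (hf : IsEquivariant α β f) {i : Fin n} {a b : Idx p}
    (h : IsStep i a b) : α.stepEnd h ≫ f = f ≫ β.stepEnd h := hom_ext_sections fun U m => hf U _ m

lemma IsEquivariant.wrapMor_comp (hf : IsEquivariant α β f) {i : Fin n} {a b : Idx p}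
    (h : IsWrap i a b) : α.wrapMor h ≫ f = (twist (L i)).map f ≫ β.wrapMor h :=
  twist_hom_ext fun U m s => by
    rw [comp_app_apply, comp_app_apply, twist_map_tw, OrderAction.wrapMor_tw,
      OrderAction.wrapMor_tw, hf]

lemma isEquivariant_of_comp (h1 : ∀ a, α.idemEnd a ≫ f = f ≫ β.idemEnd a)
    (h2 : ∀ (i : Fin n) (a b : Idx p) (h : IsStep i a b), α.stepEnd h ≫ f = f ≫ β.stepEnd h)
    (h3 : ∀ (i : Fin n) (a b : Idx p) (h : IsWrap i a b),
      α.wrapMor h ≫ f = (twist (L i)).map f ≫ β.wrapMor h) : IsEquivariant α β f :=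
  isEquivariant_of_generators α β f
    (fun U a m => congrArg (fun g => g.app U m) (h1 a))
    (fun U i a b h m => congrArg (fun g => g.app U m) (h2 i a b h))
    (fun U i a b h s m => by
      have := congrArg (fun g => g.app U (tw m s)) (h3 i a b h)
      dsimp only at this
      rwa [comp_app_apply, comp_app_apply, twist_map_tw, OrderAction.wrapMor_tw,
        OrderAction.wrapMor_tw] at this)

lemma IsEquivariant.stepComp_comp (hf : IsEquivariant α β f) {i : Fin n} {a b : Idx p}
    (h : IsStep i a b) : α.stepComp h ≫ α.inc b ≫ f ≫ β.proj b =
      (α.inc a ≫ f ≫ β.proj a) ≫ β.stepComp h := by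
  simp only [OrderAction.stepComp, Category.assoc, OrderAction.proj_inc_assoc,
    OrderAction.stepEnd_comp_idemEnd_assoc]
  rw [← Category.assoc (α.stepEnd h), hf.stepEnd_comp, ← Category.assoc (β.idemEnd a),
    β.idemEnd_comp_stepEnd, Category.assoc]

lemma IsEquivariant.wrapComp_comp (hf : IsEquivariant α β f) {i : Fin n} {a b : Idx p}
    (h : IsWrap i a b) : α.wrapComp h ≫ α.inc b ≫ f ≫ β.proj b =
      (twist (L i)).map (α.inc a ≫ f ≫ β.proj a) ≫ β.wrapComp h := by
  simp only [OrderAction.wrapComp, Category.assoc, OrderAction.proj_inc_assoc,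
    OrderAction.wrapMor_comp_idemEnd_assoc]
  rw [← Functor.map_comp_assoc, Category.assoc, Category.assoc, OrderAction.proj_inc,
    Functor.map_comp, Functor.map_comp, Category.assoc, Category.assoc,
    OrderAction.map_idemEnd_comp_wrapMor_assoc, ← Category.assoc (α.wrapMor h),
    hf.wrapMor_comp, Category.assoc]

/-- The morphism of grids induced by an equivariant morphism. -/
def IsEquivariant.gridHom (hf : IsEquivariant α β f) (hN : IsCoherent N) (hN' : IsCoherent N') :
    α.grid hc hN ⟶ β.grid hc hN' where
  app a := ObjectProperty.homMk (α.inc a ≫ f ≫ β.proj a)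
  step_app h := ObjectProperty.hom_ext _ (hf.stepComp_comp h)
  wrap_app h := ObjectProperty.hom_ext _ (hf.wrapComp_comp h)

lemma IsEquivariant.gridHom_app_hom (hf : IsEquivariant α β f) (hN : IsCoherent N)
    (hN' : IsCoherent N') (a : Idx p) :
    ((hf.gridHom hc hN hN').app a).hom = α.inc a ≫ f ≫ β.proj a := rfl

/-- The idempotent that appears between f and g commutes with f and is absorbed by the inclusion. -/
lemma IsEquivariant.comp_app {N'' : X.Modules} {γ : OrderAction L p N''} {g : N' ⟶ N''}
    (hf : IsEquivariant α β f) (a : Idx p) :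
    (α.inc a ≫ f ≫ β.proj a) ≫ (β.inc a ≫ g ≫ γ.proj a) = α.inc a ≫ (f ≫ g) ≫ γ.proj a := by
  have : α.inc a ≫ α.idemEnd a = α.inc a := by rw [← α.proj_inc, α.inc_proj_assoc]
  simp only [Category.assoc, OrderAction.proj_inc_assoc]
  rw [← Category.assoc f, ← hf.idemEnd_comp, Category.assoc, ← Category.assoc (α.inc a), this]

/-- An equivariant morphism commutes with the idempotents, so it has no off-diagonal blocks and is
the sum of its diagonal blocks. -/
lemma IsEquivariant.eq_of_gridHom_eq {g : N ⟶ N'} (hf : IsEquivariant α β f)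
    (h : ∀ a, α.inc a ≫ f ≫ β.proj a = α.inc a ≫ g ≫ β.proj a)
    (hg : IsEquivariant α β g) : f = g := by
  have key {f : N ⟶ N'} (hf : IsEquivariant α β f) :
      f = ∑ a, α.proj a ≫ (α.inc a ≫ f ≫ β.proj a) ≫ β.inc a := by
    conv_lhs => rw [← Category.id_comp f, ← α.sum_idemEnd, Preadditive.sum_comp]
    refine Finset.sum_congr rfl fun a _ => ?_
    rw [Category.assoc, Category.assoc, OrderAction.proj_inc, OrderAction.proj_inc_assoc,
      ← hf.idemEnd_comp, ← Category.assoc (α.idemEnd a), α.idemEnd_comp_self]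
  rw [key hf, key hg]
  simp only [h]

/-- Take f to be the block diagonal morphism with the components of φ as blocks. It commutes with
the idempotents by construction and with steps and wraps by the squares of φ. These elements and the
scalars generate the algebra, so f is equivariant. -/
lemma exists_gridHom_eq (hN : IsCoherent N) (hN' : IsCoherent N')
    (φ : α.grid hc hN ⟶ β.grid hc hN') :
    ∃ (f : N ⟶ N') (hf : IsEquivariant α β f), hf.gridHom hc hN hN' = φ := by
  let ψ (a : Idx p) : α.comp a ⟶ β.comp a := (φ.app a).hom
  let f : N ⟶ N' := ∑ a, α.proj a ≫ ψ a ≫ β.inc a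
  have h1 (a : Idx p) : α.idemEnd a ≫ f = α.proj a ≫ ψ a ≫ β.inc a := by
    rw [Preadditive.comp_sum, Finset.sum_eq_single a]
    · rw [← α.proj_inc, Category.assoc, α.inc_proj_assoc]
    · intro b _ hb
      have : α.idemEnd a ≫ α.proj b = 0 := by
        have := congrArg (· ≫ α.proj b) (α.idemEnd_comp_of_ne hb.symm)
        rwa [← α.proj_inc b, Category.assoc, Category.assoc, α.inc_proj, Category.comp_id,
          Limits.zero_comp] at this
      rw [← Category.assoc, this, Limits.zero_comp]
    · simp
  have h2 (a : Idx p) : f ≫ β.idemEnd a = α.proj a ≫ ψ a ≫ β.inc a := by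
    rw [Preadditive.sum_comp, Finset.sum_eq_single a]
    · rw [← β.proj_inc, Category.assoc, Category.assoc, β.inc_proj_assoc]
    · intro b _ hb
      have : β.inc b ≫ β.idemEnd a = 0 := by
        have := congrArg (β.inc b ≫ ·) (β.idemEnd_comp_of_ne hb)
        rwa [← β.proj_inc b, Category.assoc, β.inc_proj_assoc, Limits.comp_zero] at this
      rw [Category.assoc, Category.assoc, this, Limits.comp_zero, Limits.comp_zero]
    · simp
  have hs {i : Fin n} {a b : Idx p} (h : IsStep i a b) :
      α.stepComp h ≫ ψ b = ψ a ≫ β.stepComp h :=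
    congrArg (fun g => g.hom) (φ.step_app h)
  have hw {i : Fin n} {a b : Idx p} (h : IsWrap i a b) :
      α.wrapComp h ≫ ψ b = (twist (L i)).map (ψ a) ≫ β.wrapComp h :=
    congrArg (fun g => g.hom) (φ.wrap_app h)
  have hf : IsEquivariant α β f := by
    refine isEquivariant_of_comp (fun a => (h1 a).trans (h2 a).symm) (fun i a b h => ?_)
      (fun i a b h => ?_)
    · have e := congrArg (fun g => α.proj a ≫ g ≫ β.inc b) (hs h)
      simp only [OrderAction.stepComp, Category.assoc, β.proj_inc, β.stepEnd_comp_idemEnd,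
        α.proj_inc_assoc] at e
      rw [← α.stepEnd_comp_idemEnd, Category.assoc, h1, ← β.idemEnd_comp_stepEnd,
        ← Category.assoc f, h2]
      simp only [Category.assoc]
      rw [← e, ← Category.assoc (α.idemEnd a), α.idemEnd_comp_stepEnd]
    · have e := congrArg (fun g => (twist (L i)).map (α.proj a) ≫ g ≫ β.inc b) (hw h)
      simp only [OrderAction.wrapComp, Category.assoc, β.proj_inc, β.wrapMor_comp_idemEnd] at e
      rw [← Functor.map_comp_assoc, α.proj_inc, α.map_idemEnd_comp_wrapMor_assoc] at e
      rw [← α.wrapMor_comp_idemEnd, Category.assoc, h1, e, ← β.map_idemEnd_comp_wrapMor,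
        ← Functor.map_comp_assoc _ f, h2]
      simp only [Functor.map_comp, Category.assoc, β.map_idemEnd_comp_wrapMor]
  refine ⟨f, hf, ?_⟩
  refine Grid.Hom.ext (funext fun a => ObjectProperty.hom_ext _ ?_)
  rw [hf.gridHom_app_hom]
  have : α.inc a ≫ f = α.inc a ≫ α.idemEnd a ≫ f := by
    rw [← α.proj_inc, Category.assoc, α.inc_proj_assoc]
  rw [← Category.assoc, this, h1, α.inc_proj_assoc, Category.assoc, β.inc_proj, Category.comp_id]
end Hom

/-- The functor from modules over the order to grids. -/
def toGrid : OrderMod L p ⥤ Grid ((twistData L).restrict IsCoherent hc) p where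
  obj M := (orderAction M.obj).grid hc M.property
  map {M M'} f := (isEquivariant_map f.hom).gridHom hc M.property M'.property
  map_id M := by
    refine Grid.Hom.ext (funext fun a => ObjectProperty.hom_ext _ ?_)
    refine (IsEquivariant.gridHom_app_hom ..).trans ?_
    refine Eq.trans ?_ ((orderAction M.obj).inc_proj a)
    refine congrArg ((orderAction M.obj).inc a ≫ ·) ?_
    exact Category.id_comp _
  map_comp {M M' M''} f g := by
    refine Grid.Hom.ext (funext fun a => ObjectProperty.hom_ext _ ?_)
    have hf := isEquivariant_map f.hom
    exact (hf.comp_app (γ := orderAction M''.obj) (g := (orderForget L p).map g.hom) a).symm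

end GLOrder
end

/-! ### The total sheaf of a grid -/

noncomputable section
namespace GLOrder
open Limits
attribute [local instance] Abelian.hasFiniteBiproducts
variable {X : Scheme.{u}} {n : ℕ} {L : Fin n → X.IdealSheafData} {p : Fin n → ℕ}
  {M N N' : X.Modules} {U V : X.Opens}
  {hc : ∀ (i : Fin n) (M : X.Modules), IsCoherent M → IsCoherent (((twistData L).F i).obj M)}

section Intertwining
variable {A A' R R' E E' : Type*} [Ring A] [Ring A'] [CommRing R] [CommRing R'] [AddCommGroup E]
  [AddCommGroup E'] [Module R E] [Module R' E']

/-- The elements of a ring whose action is compatible with a given additive map. -/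
def intertwiningSubring (f : A →+* A') (σ : A →+* Module.End R E) (σ' : A' →+* Module.End R' E')
    (r : E →+ E') : Subring A where
  carrier := {c | ∀ x, r (σ c x) = σ' (f c) (r x)}
  mul_mem' {c d} hc hd x := by
    rw [map_mul, map_mul, map_mul, Module.End.mul_apply, Module.End.mul_apply, hc, hd]
  one_mem' x := by rw [map_one, map_one, map_one]; rfl
  add_mem' {c d} hc hd x := by
    rw [map_add, map_add, map_add, LinearMap.add_apply, LinearMap.add_apply, ← hc, ← hd, map_add]
  zero_mem' x := by
    rw [map_zero, map_zero, map_zero, LinearMap.zero_apply, LinearMap.zero_apply, map_zero]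
  neg_mem' {c} hc x := by
    rw [map_neg, map_neg, map_neg, LinearMap.neg_apply, LinearMap.neg_apply, ← hc, map_neg]
end Intertwining

section Reach
variable {R : Type u} [CommRing R] {M : Idx p → Type v} [∀ a, AddCommGroup (M a)]
  [∀ a, Module R (M a)]

lemma Reach.induct {step : ∀ (i : Fin n) (a b : Idx p), IsStep i a b → (M a →ₗ[R] M b)} {i : Fin n}
    {a b : Idx p} {m : M a} {m' : M b} {motive : ∀ b, M b → Prop} (refl : motive a m)
    (cons : ∀ (b c : Idx p) (m' : M b) (h : IsStep i b c), motive b m' →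
      motive c (step i b c h m')) (h : Reach step i m m') : motive b m' := by
  induction h with
  | refl => exact refl
  | cons hm h ih => exact cons _ _ _ h ih
end Reach

section GridIso
variable {A : Type v} [Category.{w} A] {D : GridData n A}

lemma Grid.isIso_of_app {G H : Grid D p} (φ : G ⟶ H) (h : ∀ a, IsIso (φ.app a)) : IsIso φ := by
  let ψ : H ⟶ G :=
    { app a := inv (φ.app a)
      step_app hs := by
        rw [IsIso.comp_inv_eq, Category.assoc, IsIso.eq_inv_comp, φ.step_app hs]
      wrap_app hw := by
        rw [IsIso.comp_inv_eq, Category.assoc, Functor.map_inv, IsIso.eq_inv_comp,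
          φ.wrap_app hw] }
  exact ⟨ψ, Grid.Hom.ext (funext fun a => IsIso.hom_inv_id _),
    Grid.Hom.ext (funext fun a => IsIso.inv_hom_id _)⟩
end GridIso

namespace Grid
variable (G : Grid ((twistData L).restrict IsCoherent hc) p)

/-- The sheaves of modules in a grid. -/
def sheafObj (a : Idx p) : X.Modules := (G.obj a).obj

/-- The interior structure morphisms as morphisms of sheaves of modules. -/
def sheafStep {i : Fin n} {a b : Idx p} (h : IsStep i a b) : G.sheafObj a ⟶ G.sheafObj b :=
  (G.step i a b h).hom

/-- The structure morphisms that wrap around as morphisms of sheaves of modules. -/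
def sheafWrap {i : Fin n} {a b : Idx p} (h : IsWrap i a b) :
    (twist (L i)).obj (G.sheafObj a) ⟶ G.sheafObj b :=
  (G.wrap i a b h).hom

lemma sheafStep_sheafStep {i j : Fin n} (hij : i ≠ j) {a b c d : Idx p} (hab : IsStep i a b)
    (hbd : IsStep j b d) (hac : IsStep j a c) (hcd : IsStep i c d) :
    G.sheafStep hab ≫ G.sheafStep hbd = G.sheafStep hac ≫ G.sheafStep hcd :=
  congrArg (fun f => f.hom) (G.step_step hij hab hbd hac hcd)

lemma sheafWrap_sheafStep {i j : Fin n} (hij : i ≠ j) {a b c d : Idx p} (hab : IsWrap i a b)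
    (hbd : IsStep j b d) (hac : IsStep j a c) (hcd : IsWrap i c d) :
    G.sheafWrap hab ≫ G.sheafStep hbd = (twist (L i)).map (G.sheafStep hac) ≫ G.sheafWrap hcd :=
  congrArg (fun f => f.hom) (G.wrap_step hij hab hbd hac hcd)

lemma sheafWrap_sheafWrap {i j : Fin n} (hij : i ≠ j) {a b c d : Idx p} (hab : IsWrap i a b)
    (hbd : IsWrap j b d) (hac : IsWrap j a c) (hcd : IsWrap i c d) :
    (twist (L j)).map (G.sheafWrap hab) ≫ G.sheafWrap hbd =
      (twistComm (L i) (L j)).hom.app (G.sheafObj a) ≫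
        (twist (L i)).map (G.sheafWrap hac) ≫ G.sheafWrap hcd :=
  congrArg (fun f => f.hom) (G.wrap_wrap hij hab hbd hac hcd)

/-- The cycle axiom of a grid concerns composites of morphisms, that of a module grid concerns
elements. A chain of elements is lifted here to a composite that sends its first member to its last.
-/
lemma exists_isClimb {i : Fin n} {a b : Idx p} {m : Γ(G.sheafObj a, U)} {m' : Γ(G.sheafObj b, U)}
    (h : Reach (R := Γ(X, U)) (M := fun a => Γ(G.sheafObj a, U))
      (fun _ _ _ h => secMap (G.sheafStep h) U) i m m') :
    ∃ f : G.obj a ⟶ G.obj b, IsClimb G.step i f ∧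
      Scheme.Modules.Hom.app (M := G.sheafObj a) (N := G.sheafObj b) f.hom U m = m' := by
  refine Reach.induct (M := fun a => Γ(G.sheafObj a, U)) (motive := fun b m' =>
    ∃ f : G.obj a ⟶ G.obj b, IsClimb G.step i f ∧
      Scheme.Modules.Hom.app (M := G.sheafObj a) (N := G.sheafObj b) f.hom U m = m') ?_ ?_ h
  · exact ⟨𝟙 _, .refl _, rfl⟩
  · rintro b c m' h ⟨f, hf, e⟩
    exact ⟨f ≫ G.step _ _ _ h, hf.cons h, congrArg ((G.sheafStep h).app U) e⟩

/-- The grid of modules of sections over `U`. -/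
def sections (U : X.Opens) : ModuleGrid (R := Γ(X, U)) p (fun i => idealSections (L i) U)
    (fun a => Γ(G.sheafObj a, U)) where
  step _ _ _ h := secMap (G.sheafStep h) U
  wrap _ _ _ h := LinearMap.mk₂ Γ(X, U) (fun s m => (G.sheafWrap h).app U (tw m s))
    (fun s s' m => by rw [tw_add_right, map_add])
    (fun r s m => by rw [tw_smul_right, Scheme.Modules.Hom.app_smul])
    (fun s m m' => by rw [tw_add_left, map_add])
    (fun r s m => by rw [tw_smul_left, Scheme.Modules.Hom.app_smul])
  step_step hij _ _ _ _ hab hbd hac hcd m :=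
    congrArg (fun f => f.app U m) (G.sheafStep_sheafStep hij hab hbd hac hcd)
  wrap_step {i j} hij _ _ _ _ hab hbd hac hcd s m := by
    have e := congrArg (fun f => f.app U (tw m s)) (G.sheafWrap_sheafStep hij hab hbd hac hcd)
    refine e.trans ?_
    exact congrArg ((G.sheafWrap hcd).app U) (twist_map_tw _ m s)
  wrap_wrap {i j} hij _ _ _ _ hab hbd hac hcd s t m := by
    have e := congrArg (fun f => f.app U (tw (tw m s) t))
      (G.sheafWrap_sheafWrap hij hab hbd hac hcd)
    refine (congrArg ((G.sheafWrap hbd).app U) (twist_map_tw _ (tw m s) t)).symm.trans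
      (e.trans ?_)
    refine (congrArg (((twist (L i)).map (G.sheafWrap hac) ≫ G.sheafWrap hcd).app U)
      (twistComm_tw m s t)).trans ?_
    exact congrArg ((G.sheafWrap hcd).app U) (twist_map_tw _ (tw m t) s)
  cycle {i a b c m m'' m'} s hf hbc hg := by
    obtain ⟨f, hf, e⟩ := G.exists_isClimb hf
    obtain ⟨g, hg, e'⟩ := G.exists_isClimb hg
    have h : (twist (L i)).map f.hom ≫ G.sheafWrap hbc ≫ g.hom =
      (twistToId (L i)).app (G.sheafObj a) := congrArg (fun f => f.hom) (G.cycle hf hbc hg)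
    -- Evaluating the cycle condition on m ⊗ s turns η into multiplication by s.
    have h2 := congrArg (fun f => f.app U (tw m s)) h
    refine e'.symm.trans (Eq.trans ?_ (h2.trans (twistToId_tw m s)))
    refine congrArg (Scheme.Modules.Hom.app (M := G.sheafObj c) (N := G.sheafObj a) g.hom U) ?_
    refine congrArg ((G.sheafWrap hbc).app U) ?_
    exact Eq.trans (congrArg (fun m => tw m s) e.symm) (twist_map_tw (M := G.sheafObj a)
      (N := G.sheafObj b) f.hom m s).symm

/-- The sum of all sheaves of modules in a grid. -/
def total : X.Modules := ⨁ G.sheafObj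

/-- The inclusions into the sum. -/
def totalι (a : Idx p) : G.sheafObj a ⟶ G.total := biproduct.ι G.sheafObj a

/-- The projections from the sum. -/
def totalπ (a : Idx p) : G.total ⟶ G.sheafObj a := biproduct.π G.sheafObj a

lemma totalι_totalπ (a : Idx p) : G.totalι a ≫ G.totalπ a = 𝟙 _ := biproduct.ι_π_self _ a

lemma totalι_totalπ_ne {a b : Idx p} (h : a ≠ b) : G.totalι a ≫ G.totalπ b = 0 :=
  biproduct.ι_π_ne _ h

lemma sum_totalπ_totalι : ∑ a, G.totalπ a ≫ G.totalι a = 𝟙 G.total := biproduct.total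

/-- The sections of the sum. -/
def sectionsEquiv (U : X.Opens) : Γ(G.total, U) ≃ₗ[Γ(X, U)] ∀ a, Γ(G.sheafObj a, U) :=
  LinearEquiv.ofLinearMap (LinearMap.pi fun a => secMap (G.totalπ a) U)
    (LinearMap.lsum Γ(X, U) (fun a => Γ(G.sheafObj a, U)) Γ(X, U) fun a => secMap (G.totalι a) U)
    (by
      refine LinearMap.pi_ext fun a m => ?_
      rw [LinearMap.comp_apply, LinearMap.lsum_piSingle, LinearMap.id_apply]
      funext b
      rw [LinearMap.pi_apply]
      by_cases h : a = b
      · subst h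
        rw [Pi.single_eq_same]
        exact congrArg (fun f => f.app U m) (G.totalι_totalπ a)
      · rw [Pi.single_eq_of_ne (Ne.symm h)]
        exact congrArg (fun f => f.app U m) (G.totalι_totalπ_ne h))
    (by
      refine LinearMap.ext fun x => ?_
      rw [LinearMap.comp_apply, LinearMap.lsum_apply, LinearMap.sum_apply]
      have := congrArg (fun f => f.app U x) G.sum_totalπ_totalι
      rw [sum_app_apply] at this
      exact this)

lemma sectionsEquiv_symm_single (a : Idx p) (m : Γ(G.sheafObj a, U)) :
    (G.sectionsEquiv U).symm (Pi.single a m) = (G.totalι a).app U m :=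
  LinearMap.lsum_piSingle (R := Γ(X, U)) (φ := fun a => Γ(G.sheafObj a, U)) Γ(X, U)
    (fun a => secMap (G.totalι a) U) a m

/-- The componentwise restriction of sections. -/
def piRes (h : V ≤ U) : (∀ a, Γ(G.sheafObj a, U)) →+ ∀ a, Γ(G.sheafObj a, V) where
  toFun x a := (G.sheafObj a).presheaf.map (homOfLE h).op (x a)
  map_zero' := funext fun _ => map_zero _
  map_add' _ _ := funext fun _ => map_add _ _ _

lemma piRes_single (h : V ≤ U) (a : Idx p) (m : Γ(G.sheafObj a, U)) :
    G.piRes h (Pi.single a m) = Pi.single a ((G.sheafObj a).presheaf.map (homOfLE h).op m) := by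
  funext b
  change (G.sheafObj b).presheaf.map (homOfLE h).op
    ((Pi.single a m : ∀ a, Γ(G.sheafObj a, U)) b) = _
  by_cases hb : b = a
  · subst hb; rw [Pi.single_eq_same, Pi.single_eq_same]
  · rw [Pi.single_eq_of_ne hb, Pi.single_eq_of_ne hb, map_zero]

lemma sectionsEquiv_map (h : V ≤ U) (x : Γ(G.total, U)) :
    G.sectionsEquiv V (G.total.presheaf.map (homOfLE h).op x) =
      G.piRes h (G.sectionsEquiv U x) :=
  funext fun a => app_map (G.totalπ a) h x

lemma piRes_act_algebraMap (h : V ≤ U) (r : Γ(X, U)) (x) :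
    G.piRes h ((G.sections U).act (algebraMap _ _ r) x) =
      (G.sections V).act (preOrdRes h (algebraMap _ _ r)) (G.piRes h x) := by
  have e : preOrdRes h (algebraMap Γ(X, U) (PreOrd L p U) r) = algebraMap Γ(X, V) _
    (X.presheaf.map (homOfLE h).op r) := tensorOrderMap_algebraMap _ _ r
  rw [e, AlgHom.commutes, AlgHom.commutes, Module.algebraMap_end_apply,
    Module.algebraMap_end_apply]
  exact funext fun a => (G.sheafObj a).map_smul (homOfLE h) r (x a)

lemma piRes_act_idem (h : V ≤ U) (a b : Idx p) (m : Γ(G.sheafObj b, U)) :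
    G.piRes h ((G.sections U).act (idem _ a) (Pi.single b m)) =
      (G.sections V).act (idem _ a)
        (Pi.single b ((G.sheafObj b).presheaf.map (homOfLE h).op m)) := by
  by_cases hb : b = a
  · subst hb
    rw [ModuleGrid.act_idem_self, ModuleGrid.act_idem_self, piRes_single]
  · rw [ModuleGrid.act_idem_of_ne _ hb, ModuleGrid.act_idem_of_ne _ hb, map_zero]

lemma piRes_act_stepUnit (h : V ≤ U) {i : Fin n} {a b : Idx p} (hab : IsStep i a b) (c : Idx p)
    (m : Γ(G.sheafObj c, U)) :
    G.piRes h ((G.sections U).act (stepUnit _ hab) (Pi.single c m)) =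
      (G.sections V).act (stepUnit _ hab)
        (Pi.single c ((G.sheafObj c).presheaf.map (homOfLE h).op m)) := by
  by_cases hb : c = a
  · subst hb
    rw [ModuleGrid.act_stepUnit, ModuleGrid.act_stepUnit, piRes_single]
    exact congrArg (Pi.single b) (app_map (G.sheafStep hab) h m).symm
  · rw [ModuleGrid.act_stepUnit_of_ne _ _ hb, ModuleGrid.act_stepUnit_of_ne _ _ hb, map_zero]

lemma piRes_act_wrapUnit (h : V ≤ U) {i : Fin n} {a b : Idx p} (hab : IsWrap i a b)
    (s : idealSections (L i) U) (c : Idx p) (m : Γ(G.sheafObj c, U)) :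
    G.piRes h ((G.sections U).act (wrapUnit hab s) (Pi.single c m)) =
      (G.sections V).act (wrapUnit hab (idealRes h s))
        (Pi.single c ((G.sheafObj c).presheaf.map (homOfLE h).op m)) := by
  by_cases hb : c = a
  · subst hb
    refine (congrArg (G.piRes h) ((G.sections U).act_wrapUnit hab s m)).trans ?_
    refine Eq.trans ?_ ((G.sections V).act_wrapUnit hab (idealRes h s) _).symm
    rw [piRes_single]
    refine congrArg (Pi.single b) ?_
    refine (app_map (G.sheafWrap hab) h (tw m s)).symm.trans ?_
    exact congrArg ((G.sheafWrap hab).app V) (map_tw h m s)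
  · refine (congrArg (G.piRes h) ((G.sections U).act_wrapUnit_of_ne hab hb s m)).trans ?_
    refine Eq.trans ?_ ((G.sections V).act_wrapUnit_of_ne hab hb (idealRes h s) _).symm
    exact map_zero _

/-- The sections c for which the claim holds form a subring, so generators suffice. For the
non-scalar generators only families concentrated in a single component need to be checked. -/
lemma piRes_act (h : V ≤ U) (c : PreOrd L p U) :
    ∀ x, G.piRes h ((G.sections U).act c x) =
      (G.sections V).act (preOrdRes h c) (G.piRes h x) := by
  let S : Subring (PreOrd L p U) := intertwiningSubring (A := PreOrd L p U)
    (A' := PreOrd L p V) (R := Γ(X, U)) (R' := Γ(X, V)) (preOrdRes h)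
    (G.sections U).act.toRingHom (G.sections V).act.toRingHom (G.piRes h)
  have key (c : PreOrd L p U) (c' : PreOrd L p V) (e : preOrdRes h c = c')
      (hc : ∀ a (m : Γ(G.sheafObj a, U)),
      G.piRes h ((G.sections U).act c (Pi.single a m)) =
        (G.sections V).act c'
          (Pi.single a ((G.sheafObj a).presheaf.map (homOfLE h).op m))) : c ∈ S := by
    subst e
    have : (G.piRes h).comp ((G.sections U).act c).toAddMonoidHom =
        ((G.sections V).act (preOrdRes h c)).toAddMonoidHom.comp (G.piRes h) := by
      refine AddMonoidHom.functions_ext _ _ _ fun a m => ?_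
      refine (hc a m).trans ?_
      exact congrArg ((G.sections V).act (preOrdRes h c)) (G.piRes_single h a m).symm
    exact fun x => DFunLike.congr_fun this x
  have hS : S = ⊤ := tensorOrder_subring_eq_top S (fun r x => G.piRes_act_algebraMap h r x)
    (fun a => key _ _ (tensorOrderMap_idem _ _ a) (G.piRes_act_idem h a))
    (fun i a b hab => key _ _ (tensorOrderMap_stepUnit _ _ hab) (G.piRes_act_stepUnit h hab))
    (fun i a b hab s => key _ _ (OrderAction.preOrdRes_wrapUnit hab h s)
      (G.piRes_act_wrapUnit h hab s))
  exact (hS ▸ Subring.mem_top c : c ∈ S)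

/-- The action of the order on the sum of all sheaves of modules in a grid. -/
def action : OrderAction L p G.total where
  act U := ((G.sectionsEquiv U).symm.conjAlgEquiv Γ(X, U)).toAlgHom.comp (G.sections U).act
  nat U V h c m := by
    change G.total.presheaf.map (homOfLE h).op
      ((G.sectionsEquiv U).symm ((G.sections U).act c (G.sectionsEquiv U m))) =
      (G.sectionsEquiv V).symm ((G.sections V).act (preOrdRes h c) (G.sectionsEquiv V
        (G.total.presheaf.map (homOfLE h).op m)))
    rw [LinearEquiv.eq_symm_apply, sectionsEquiv_map, sectionsEquiv_map, ← piRes_act,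
      LinearEquiv.apply_symm_apply]

lemma action_act (c : PreOrd L p U) (x : Γ(G.total, U)) :
    G.action.act U c x =
      (G.sectionsEquiv U).symm ((G.sections U).act c (G.sectionsEquiv U x)) := rfl

lemma hom_ext_total {Z : X.Modules} {f g : G.total ⟶ Z}
    (h : ∀ a, G.totalι a ≫ f = G.totalι a ≫ g) : f = g :=
  biproduct.hom_ext' _ _ h

lemma action_act_ι (c : PreOrd L p U) (a : Idx p) (m : Γ(G.sheafObj a, U)) :
    G.action.act U c ((G.totalι a).app U m) =
      (G.sectionsEquiv U).symm ((G.sections U).act c (Pi.single a m)) := by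
  rw [action_act, ← sectionsEquiv_symm_single, LinearEquiv.apply_symm_apply]

lemma totalι_idemEnd (a : Idx p) : G.totalι a ≫ G.action.idemEnd a = G.totalι a :=
  hom_ext_sections fun U m => by
    rw [comp_app_apply, OrderAction.idemEnd_app, action_act_ι, ModuleGrid.act_idem_self,
      sectionsEquiv_symm_single]

lemma totalι_idemEnd_of_ne {a b : Idx p} (h : b ≠ a) : G.totalι b ≫ G.action.idemEnd a = 0 :=
  hom_ext_sections fun U m => by
    rw [comp_app_apply, OrderAction.idemEnd_app, action_act_ι, ModuleGrid.act_idem_of_ne _ h,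
      map_zero]
    rfl

/-- The idempotent of index a is the projection onto the a-th summand, so the component split off
abstractly is isomorphic to the given sheaf. This underlies `fromTotal`. -/
lemma action_idemEnd (a : Idx p) : G.action.idemEnd a = G.totalπ a ≫ G.totalι a :=
  G.hom_ext_total fun b => by
    by_cases h : b = a
    · subst h
      rw [totalι_idemEnd, ← Category.assoc, totalι_totalπ, Category.id_comp]
    · rw [totalι_idemEnd_of_ne _ h, ← Category.assoc, totalι_totalπ_ne _ h, zero_comp]

lemma action_stepEnd {i : Fin n} {a b : Idx p} (h : IsStep i a b) :
    G.action.stepEnd h = G.totalπ a ≫ G.sheafStep h ≫ G.totalι b := by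
  have : G.totalι a ≫ G.action.stepEnd h = G.sheafStep h ≫ G.totalι b :=
    hom_ext_sections fun U m => by
      rw [comp_app_apply, OrderAction.stepEnd_app, action_act_ι, ModuleGrid.act_stepUnit,
        sectionsEquiv_symm_single]
      rfl
  rw [← G.action.idemEnd_comp_stepEnd, action_idemEnd, Category.assoc, this]

lemma action_wrapMor {i : Fin n} {a b : Idx p} (h : IsWrap i a b) :
    G.action.wrapMor h = (twist (L i)).map (G.totalπ a) ≫ G.sheafWrap h ≫ G.totalι b := by
  have : (twist (L i)).map (G.totalι a) ≫ G.action.wrapMor h = G.sheafWrap h ≫ G.totalι b :=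
    twist_hom_ext fun U m s => by
      rw [comp_app_apply, twist_map_tw, OrderAction.wrapMor_tw, action_act_ι,
        ModuleGrid.act_wrapUnit, sectionsEquiv_symm_single]
      rfl
  rw [← G.action.map_idemEnd_comp_wrapMor, action_idemEnd, Functor.map_comp, Category.assoc, this]

lemma isCoherent_total : IsCoherent G.total := isCoherent_biproduct _ fun a => (G.obj a).property

lemma stepComp_comp_totalπ {i : Fin n} {a b : Idx p} (h : IsStep i a b) :
    G.action.stepComp h ≫ G.action.inc b ≫ G.totalπ b =
      (G.action.inc a ≫ G.totalπ a) ≫ G.sheafStep h := by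
  rw [OrderAction.stepComp, Category.assoc, Category.assoc, OrderAction.proj_inc_assoc,
    OrderAction.stepEnd_comp_idemEnd_assoc, action_stepEnd, Category.assoc, Category.assoc,
    totalι_totalπ, Category.comp_id, Category.assoc]

lemma wrapComp_comp_totalπ {i : Fin n} {a b : Idx p} (h : IsWrap i a b) :
    G.action.wrapComp h ≫ G.action.inc b ≫ G.totalπ b =
      (twist (L i)).map (G.action.inc a ≫ G.totalπ a) ≫ G.sheafWrap h := by
  rw [OrderAction.wrapComp, Category.assoc, Category.assoc, OrderAction.proj_inc_assoc,
    OrderAction.wrapMor_comp_idemEnd_assoc, action_wrapMor, Category.assoc, Category.assoc,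
    totalι_totalπ, Category.comp_id, Functor.map_comp, Category.assoc]

/-- The comparison of a grid with the one constructed from the sum of its sheaves. -/
def fromTotal : G.action.grid hc G.isCoherent_total ⟶ G where
  app a := ObjectProperty.homMk (G.action.inc a ≫ G.totalπ a)
  step_app h := ObjectProperty.hom_ext _ (G.stepComp_comp_totalπ h)
  wrap_app h := ObjectProperty.hom_ext _ (G.wrapComp_comp_totalπ h)

lemma inc_totalπ_totalι_proj (a : Idx p) :
    (G.action.inc a ≫ G.totalπ a) ≫ G.totalι a ≫ G.action.proj a = 𝟙 _ := by
  rw [Category.assoc, ← Category.assoc (G.totalπ a), ← action_idemEnd, ← G.action.proj_inc,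
    Category.assoc, G.action.inc_proj_assoc, G.action.inc_proj]

lemma totalι_proj_inc_totalπ (a : Idx p) :
    (G.totalι a ≫ G.action.proj a) ≫ G.action.inc a ≫ G.totalπ a = 𝟙 _ := by
  rw [Category.assoc, G.action.proj_inc_assoc, ← Category.assoc, totalι_idemEnd, totalι_totalπ]

instance : IsIso G.fromTotal :=
  Grid.isIso_of_app _ fun a => ⟨ObjectProperty.homMk (G.totalι a ≫ G.action.proj a),
    ObjectProperty.hom_ext _ (G.inc_totalπ_totalι_proj a),
    ObjectProperty.hom_ext _ (G.totalι_proj_inc_totalπ a)⟩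

end Grid

/-- An equivariant isomorphism gives isomorphic grids: the blocks of g invert those of f by
`comp_app`. -/
lemma IsEquivariant.isIso_gridHom {α : OrderAction L p N} {β : OrderAction L p N'} {f : N ⟶ N'}
    {g : N' ⟶ N} (hf : IsEquivariant α β f) (hg : IsEquivariant β α g) (hfg : f ≫ g = 𝟙 N)
    (hgf : g ≫ f = 𝟙 N') (hN : IsCoherent N) (hN' : IsCoherent N') :
    IsIso (hf.gridHom hc hN hN') :=
  Grid.isIso_of_app _ fun a => ⟨ObjectProperty.homMk (β.inc a ≫ g ≫ α.proj a),
    ObjectProperty.hom_ext _ ((hf.comp_app a).trans (by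
      rw [hfg, Category.id_comp, α.inc_proj]; rfl)),
    ObjectProperty.hom_ext _ ((hg.comp_app a).trans (by
      rw [hgf, Category.id_comp, β.inc_proj]; rfl))⟩

/-! ### The equivalence and its linearity -/

variable (hc)

instance : (toGrid (p := p) hc).Faithful where
  map_injective {M M'} f g h := by
    apply ObjectProperty.hom_ext
    have e : (orderForget L p).map f.hom = (orderForget L p).map g.hom :=
      (isEquivariant_map f.hom).eq_of_gridHom_eq
        (fun a => congrArg (fun φ : (toGrid hc).obj M ⟶ (toGrid hc).obj M' =>
          (Grid.Hom.app φ a).hom) h) (isEquivariant_map g.hom)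
    apply SheafOfModules.hom_ext
    ext U x
    exact congrArg (fun φ => φ.app U.unop x) e

instance : (toGrid (p := p) hc).Full where
  map_surjective {M M'} φ := by
    obtain ⟨f, hf, e⟩ := exists_gridHom_eq hc M.property M'.property φ
    -- The equivariant morphism of 𝒪-modules is linear over the whole order, not only over the
    -- presheaf of algebras.
    obtain ⟨g, rfl⟩ := exists_map_eq f hf
    exact ⟨ObjectProperty.homMk g, e⟩

instance : (toGrid (p := p) hc).EssSurj where
  mem_essImage G := by
    let α := G.action
    have hM : IsCoherent ((orderForget L p).obj α.module) :=
      isCoherent_of_retract α.forgetIso.hom α.forgetIso.inv α.forgetIso.hom_inv_id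
        G.isCoherent_total
    -- The 𝒪-module underlying `α.module` is equivariantly isomorphic to the total sheaf, so it has
    -- the same grid up to isomorphism; `fromTotal` compares that grid with G.
    have := α.isEquivariant_forgetIso_hom.isIso_gridHom (hc := hc) α.isEquivariant_forgetIso_inv
      α.forgetIso.hom_inv_id α.forgetIso.inv_hom_id hM G.isCoherent_total
    exact ⟨⟨α.module, hM⟩, ⟨@asIso _ _ _ _ _ this ≪≫ asIso G.fromTotal⟩⟩

/-- On morphisms the functor is composition with a fixed inclusion and a fixed projection, both
𝒪-linear, so it respects sums and scalars from k. -/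
lemma isLinear_toGrid {k : Type u} [Field k] (s : X ⟶ Spec (.of k)) :
    IsLinear s (toGrid (L := L) (p := p) hc) := by
  constructor
  · intro M N f g a
    apply ObjectProperty.hom_ext
    change (orderAction M.obj).inc a ≫ ((orderForget L p).map f.hom + (orderForget L p).map g.hom) ≫
      (orderAction N.obj).proj a = (orderAction M.obj).inc a ≫ (orderForget L p).map f.hom ≫
      (orderAction N.obj).proj a + (orderAction M.obj).inc a ≫ (orderForget L p).map g.hom ≫
      (orderAction N.obj).proj a
    rw [Preadditive.add_comp, Preadditive.comp_add]
  · intro c M N f g h a U m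
    refine (congrArg (((orderAction N.obj).proj a).app U)
      (h U (((orderAction M.obj).inc a).app U m))).trans ?_
    exact ((orderAction N.obj).proj a).app_smul _ _

end GLOrder
end

theorem mainTheorem7 {k : Type u} [Field k] [IsAlgClosed k]
    {X : Scheme.{u}} (s : X ⟶ Spec (.of k)) (hX : GLOrder.IsProjectiveOver s)
    {n : ℕ} (L : Fin n → X.IdealSheafData) (hL : ∀ i, GLOrder.IsEffectiveCartier (L i))
    (p : Fin n → ℕ) (hp : ∀ i, 2 ≤ p i) :
    ∃ h : ∀ (i : Fin n) (M : X.Modules),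
        GLOrder.IsCoherent M → GLOrder.IsCoherent (((GLOrder.twistData L).F i).obj M),
      ∃ e : GLOrder.OrderMod L p ≌
          GLOrder.Grid ((GLOrder.twistData L).restrict GLOrder.IsCoherent h) p,
        GLOrder.IsLinear s e.functor := by
  have hc (i : Fin n) (M : X.Modules) (hM : GLOrder.IsCoherent M) :
      GLOrder.IsCoherent (((GLOrder.twistData L).F i).obj M) :=
    GLOrder.isCoherent_twist (hL i) hM
  have : (GLOrder.toGrid (p := p) hc).IsEquivalence := { }
  exact ⟨hc, (GLOrder.toGrid hc).asEquivalence, GLOrder.isLinear_toGrid hc s⟩
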